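/- Let $X\ge 0$ be a real random variable such that the function $h$ defined by $\mathbb P(X>x)=1/h(x)$, $x\ge0$, is regularly varying at $+\infty$ with index $\alpha>0$. For $N\ge1$ let $c_N=h^{-1}(2N\log_2N)$, where $h^{-1}(v)=\inf\{x\ge0:h(x)>v\}$, and let $(\gamma_N)_{N\ge1}$ be real numbers with $\gamma_N/(2N\log_2N)\to1$ as $N\to\infty$. A stairs measure is a non-zero measure $\mu$ on $(0,\infty)$ with $\mu([a,\infty))<\infty$ for every $a>0$. Given such $\mu$, take a Poisson point process on $\{(t,x):t,x>0\}$ with intensity $dt\otimes\mu$, put $\xi_t=x$ if $(t,x)$ is one of its points and $\xi_t=0$ otherwise, and define the $\mu$-stairs process by $\mathcal R(t)=0$ for $t\le0$ and, inductively on the intervals $(n,n+1]$, $n=0,1,2,\dots$, $$\mathcal R(t)=\max_{s\in[0,1]}\bigl(\mathcal R(t-s-1)+\xi_{t-s}\bigr),\qquad t>0 .$$ Its first regeneration time is $\tau_1=\inf\{t>1:\mathcal R(t)=\mathcal R(t-1)\}$. Let $\mu_N$ be the stairs measure determined by $$\mu_N((x,\infty))=-\gamma_N\log\bigl(1-h(c_Nx)^{-1}\bigr),\qquad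 x>0,$$ for those $N\ge1$ for which this formula defines a stairs measure, and let $\mathcal R^N$ and $\tau^N_1$ be the $\mu_N$-stairs process and its first regeneration time. Then, for each such $N$, $\tau^N_1$ is almost surely finite and integrable, and for every $\varepsilon>0$ there exists $x_0=x_0(\varepsilon)>0$, not depending on $N$, such that for all such $N$ $$\sup_{x\ge x_0}\left|\frac{\mathbb P(\mathcal R^N(\tau^N_1)>x)}{\mathbb E[\tau^N_1]\,\mu_N([x,\infty))}-1\right|<\varepsilon .$$ -/

import Mathlib

open MeasureTheory ProbabilityTheory Set Filter Topology
open scoped NNReal ENNReal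

noncomputable section

/-! ### Regular variation and the tail function -/

/-- `f` varies regularly at `+∞` with index `ρ`. -/
def IsRegularlyVarying (f : ℝ → ℝ) (ρ : ℝ) : Prop :=
  Measurable f ∧ (∀ᶠ x in atTop, 0 < f x) ∧
    ∀ l : ℝ, 0 < l → Tendsto (fun x => f (l * x) / f x) atTop (𝓝 (l ^ ρ))

/-- The function `h` with `P(X > x) = 1 / h(x)`. -/
def tailInv {Ω : Type*} [MeasurableSpace Ω] (P : Measure Ω) (X : Ω → ℝ) (x : ℝ) : ℝ :=
  1 / P.real {ω | x < X ω}

/-- The generalized inverse `h⁻¹(v) = inf {x ≥ 0 : h(x) > v}`. -/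
def generalizedInverse (h : ℝ → ℝ) (v : ℝ) : ℝ :=
  sInf {x : ℝ | 0 ≤ x ∧ v < h x}

/-- The spatial scale `c_N = h⁻¹(2 N log₂ N)`. -/
def spaceScale (h : ℝ → ℝ) (N : ℕ) : ℝ :=
  generalizedInverse h (2 * (N : ℝ) * Real.logb 2 (N : ℝ))

/-! ### Stairs measures and Poisson point processes -/

/-- A stairs measure: a non-zero measure on `(0, ∞)` (that is, a measure on `ℝ` carried by
`(0, ∞)`) which is finite on `[a, ∞)` for every `a > 0`. -/
structure IsStairsMeasure (μ : Measure ℝ) : Prop where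
  carrier : μ (Iic 0) = 0
  ne_zero : μ ≠ 0
  finite_tail : ∀ a : ℝ, 0 < a → μ (Ici a) < ∞

/-- The random set `pts` is a Poisson point process on the open quadrant `{(t, x) : t, x > 0}`
with intensity `ν`: it is a random countable set, the numbers of points in disjoint Borel sets
are independent, and the number of points in `A` is Poisson with parameter `ν A`
(almost surely infinite if `ν A = ∞`). -/
structure IsPoissonPointProcess {Ω : Type*} [MeasurableSpace Ω] (P : Measure Ω)
    (pts : Ω → Set (ℝ × ℝ)) (ν : Measure (ℝ × ℝ)) : Prop where
  subset_quadrant : ∀ ω, pts ω ⊆ Ioi (0 : ℝ) ×ˢ Ioi (0 : ℝ)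
  countable : ∀ ω, (pts ω).Countable
  measurable_count : ∀ A : Set (ℝ × ℝ), MeasurableSet A →
    Measurable fun ω => (pts ω ∩ A).encard
  law_count : ∀ A : Set (ℝ × ℝ), MeasurableSet A → ν A ≠ ∞ →
    P.map (fun ω => (pts ω ∩ A).encard) =
      (poissonMeasure (ν A).toNNReal).map (fun k : ℕ => (k : ℕ∞))
  count_eq_top : ∀ A : Set (ℝ × ℝ), MeasurableSet A → ν A = ∞ →
    ∀ᵐ ω ∂P, (pts ω ∩ A).encard = ⊤
  indep_count : ∀ (n : ℕ) (A : Fin n → Set (ℝ × ℝ)), (∀ i, MeasurableSet (A i)) →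
    Pairwise (fun i j => Disjoint (A i) (A j)) →
    iIndepFun (fun i ω => (pts ω ∩ A i).encard) P

/-- The intensity `dt ⊗ μ` on `{(t, x) : t, x > 0}`. -/
def stairsIntensity (μ : Measure ℝ) : Measure (ℝ × ℝ) :=
  ((volume : Measure ℝ).restrict (Ioi 0)).prod μ

/-! ### The stairs process and its regeneration times -/

/-- `ξ_t = x` if `(t, x)` is a point of `S`, and `ξ_t = 0` if there is no point at time `t`.
(For the Poisson process there is almost surely at most one point at each time; `sSup {x} = x`
and `sSup ∅ = 0`.) -/
def markAt (S : Set (ℝ × ℝ)) (t : ℝ) : ℝ :=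
  sSup {x : ℝ | (t, x) ∈ S}

/-- The stairs process driven by `ξ`, after `n` steps of its inductive definition; it has its
final value at all `t ≤ n`. -/
def stairsAux (ξ : ℝ → ℝ) : ℕ → ℝ → ℝ
  | 0, _ => 0
  | n + 1, t =>
      if t ≤ 0 then 0
      else ⨆ s : Icc (0 : ℝ) 1, (stairsAux ξ n (t - s - 1) + ξ (t - s))

/-- The stairs process `R(t)` driven by `ξ`, characterised by `stairs_of_nonpos` and
`stairs_of_pos` below. -/
def stairs (ξ : ℝ → ℝ) (t : ℝ) : ℝ :=
  stairsAux ξ ⌈t⌉₊ t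

theorem stairsAux_of_nonpos (ξ : ℝ → ℝ) (n : ℕ) {t : ℝ} (ht : t ≤ 0) :
    stairsAux ξ n t = 0 := by
  cases n with
  | zero => rfl
  | succ n => simp [stairsAux, ht]

theorem stairsAux_stable (ξ : ℝ → ℝ) (n : ℕ) :
    ∀ (m : ℕ) (t : ℝ), t ≤ n → n ≤ m → stairsAux ξ m t = stairsAux ξ n t := by
  induction n with
  | zero =>
    intro m t ht _
    have ht' : t ≤ 0 := by simpa using ht
    rw [stairsAux_of_nonpos ξ m ht', stairsAux_of_nonpos ξ 0 ht']
  | succ n ih =>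
    intro m t ht hm
    obtain ⟨k, rfl⟩ : ∃ k, m = k + 1 := ⟨m - 1, by omega⟩
    by_cases h0 : t ≤ 0
    · rw [stairsAux_of_nonpos ξ _ h0, stairsAux_of_nonpos ξ _ h0]
    · simp only [stairsAux, h0, if_false]
      refine iSup_congr fun s => ?_
      rw [ih k (t - s - 1) (by have := s.2.1; push_cast at ht; linarith) (by omega)]

theorem stairs_of_nonpos (ξ : ℝ → ℝ) {t : ℝ} (ht : t ≤ 0) : stairs ξ t = 0 :=
  stairsAux_of_nonpos ξ _ ht

/-- The recursion `R(t) = max_{s ∈ [0,1]} (R(t - s - 1) + ξ_{t - s})` for `t > 0`. -/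
theorem stairs_of_pos (ξ : ℝ → ℝ) {t : ℝ} (ht : 0 < t) :
    stairs ξ t = ⨆ s : Icc (0 : ℝ) 1, (stairs ξ (t - s - 1) + ξ (t - s)) := by
  obtain ⟨n, hn⟩ : ∃ n, ⌈t⌉₊ = n + 1 := ⟨⌈t⌉₊ - 1, by have := Nat.ceil_pos.2 ht; omega⟩
  have hle : t ≤ n + 1 := by
    have := Nat.le_ceil t
    rw [hn] at this
    exact_mod_cast this
  unfold stairs
  rw [hn]
  simp only [stairsAux, not_le.2 ht, if_false]
  refine iSup_congr fun s => ?_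
  have hs : t - s - 1 ≤ (n : ℝ) := by have := s.2.1; linarith
  rw [stairsAux_stable ξ _ n (t - s - 1) (Nat.le_ceil _) (Nat.ceil_le.2 hs)]

/-- The set whose infimum is the next regeneration time of the path `R` after `u`. -/
def regenSet (R : ℝ → ℝ) (u : ℝ) : Set ℝ :=
  {t : ℝ | u + 1 < t ∧ R t = R (t - 1)}

/-- The regeneration times: `τ_0 = 0`, `τ_n = inf {t > τ_{n-1} + 1 : R(t) = R(t - 1)}`. -/
def regenTime (R : ℝ → ℝ) : ℕ → ℝ
  | 0 => 0
  | n + 1 => sInf (regenSet R (regenTime R n))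

/-- The path `t ↦ R(t)` of the stairs process built from the points `pts ω`. -/
def stairsPath {Ω : Type*} (pts : Ω → Set (ℝ × ℝ)) (ω : Ω) : ℝ → ℝ :=
  stairs (markAt (pts ω))

/-- The first regeneration time `τ_1` of the stairs process. -/
def firstRegen {Ω : Type*} (pts : Ω → Set (ℝ × ℝ)) (ω : Ω) : ℝ :=
  regenTime (stairsPath pts ω) 1

end

/-!
The law of `R(τ₁)` is governed by one big jump: far out, `R(τ₁) > x` happens essentially when a
single point with mark larger than `x` falls before `τ₁`, and the expected number of such points is
`E[τ₁] T(x)`, where `T(x) = μ((x, ∞))`, by Wald's identity.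

*Regeneration times have exponential tails.* The value `R(t)` is the largest sum of marks at times
which are at least `1` apart. If the mark at time `u` dominates twice every other mark within time
distance `1`, then `R(u + 1) = R(u)`
(`IsStairsInput.stairs_add_one_eq_of_dominant`). Disjoint blocks of three time units contain such a
mark independently of each other, with probability at least `p = T(2) exp(-3 T(1))`, whence
`P(τ₁ > 3 n) ≤ (1 - p) ^ n` (`IsPoissonPointProcess.real_lt_firstRegen_le`).

*The time `τ₁` is a stopping time.* Wald's identity needs the event `τ₁ > s` to be determined, up to
null sets, by the points up to time `s` (`exists_measurableSet_lt_firstRegen`). The path at a dyadic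
time is the limit of a recursion over dyadic cells (`tendsto_dyadicStairs`), which is measurable
with respect to the numbers of points in product sets. The path is right-continuous, and constant
just before every time, so that `τ₁ ≤ s` if and only if the increments `R(q) - R(q - 1)` over
dyadic `q ∈ [1, s]` come arbitrarily close to `0` (`IsStairsInput.sInf_regenSet_le_iff`).

*Two bounds for a fixed measure.* If all marks up to `τ₁` are at most `z`, and at most `b` outside
one unit cell, then `R(τ₁) ≤ z + b n` on `τ₁ ≤ n`; this and Wald's identity give the upper bound
`real_stairsPath_firstRegen_le`, with error terms for a large `τ₁` and for two marks larger than
`b`. Since `R(τ₁)` is at least every mark up to time `τ₁`, the Bonferroni inequality gives the lower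
bound `le_real_stairsPath_firstRegen`.

*Uniformity.* The measure `μ_N` has tail `γ_N g(c_N x)` with one function `g = -log (1 - 1 / h)`,
which is regularly varying with index `-α`. Its Potter bounds hold uniformly on every `[c₀, ∞)`
(`IsRegularTail.potter`), and `γ_N g(c_N)` stays between two positive constants by the choice of
`c_N` (`eventually_normalisation`). Hence on `[1, ∞)` all tails in the family lie between
fixed multiples of two fixed powers of `x`, the exponential rate of `τ₁` is bounded below
independently of `N`, and one threshold serves all measures (`IsRegularTail.exists_threshold`).
-/

/-! ### Pathwise properties of the stairs process -/

/-- The pathwise properties of `ξ = markAt S` for a locally finite configuration `S`: nonnegative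
marks, carried by positive times, with finitely many marks above any level `a > 0` up to any
time. Infinitely many small marks may accumulate. -/
structure IsStairsInput (ξ : ℝ → ℝ) : Prop where
  nonneg : ∀ t, 0 ≤ ξ t
  zero_of_nonpos : ∀ t, t ≤ 0 → ξ t = 0
  finite : ∀ a : ℝ, 0 < a → ∀ L : ℝ, {t | t ≤ L ∧ a < ξ t}.Finite

namespace IsStairsInput

variable {ξ : ℝ → ℝ}

theorem exists_bound (h : IsStairsInput ξ) (L : ℝ) : ∃ B : ℝ, 0 ≤ B ∧ ∀ t ≤ L, ξ t ≤ B := by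
  obtain ⟨B, hB⟩ := ((h.finite 1 one_pos L).image ξ).bddAbove
  refine ⟨max B 1, by positivity, fun t ht => ?_⟩
  by_cases h1 : 1 < ξ t
  · exact le_max_of_le_left (hB ⟨t, ⟨ht, h1⟩, rfl⟩)
  · exact le_max_of_le_right (not_lt.1 h1)

theorem stairs_mem_Icc (h : IsStairsInput ξ) {B L : ℝ} (hB : 0 ≤ B) (hξ : ∀ t ≤ L, ξ t ≤ B)
    (n : ℕ) : ∀ t ≤ L, t ≤ n → stairs ξ t ∈ Icc 0 (n * B) := by
  induction n with
  | zero =>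
    intro t _ ht
    rw [stairs_of_nonpos ξ (by simpa using ht)]
    simp
  | succ n ih =>
    intro t htL ht
    rcases le_or_gt t 0 with h0 | h0
    · rw [stairs_of_nonpos ξ h0]
      exact ⟨le_rfl, by positivity⟩
    have key : ∀ s : Icc (0 : ℝ) 1,
        stairs ξ (t - s - 1) + ξ (t - s) ∈ Icc 0 (((n + 1 : ℕ) : ℝ) * B) := by
      intro s
      have hs := s.2.1
      push_cast at ht ⊢
      have h1 := ih (t - s - 1) (by linarith) (by linarith)
      have h2 := hξ (t - s) (by linarith)
      have h3 := h.nonneg (t - s)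
      exact ⟨add_nonneg h1.1 h3, by linarith [h1.2]⟩
    rw [stairs_of_pos ξ h0]
    exact ⟨Real.iSup_nonneg fun s => (key s).1, ciSup_le fun s => (key s).2⟩

theorem stairs_nonneg (h : IsStairsInput ξ) (t : ℝ) : 0 ≤ stairs ξ t := by
  obtain ⟨B, hB, hξ⟩ := h.exists_bound t
  exact (h.stairs_mem_Icc hB hξ ⌈t⌉₊ t le_rfl (Nat.le_ceil t)).1

theorem bddAbove_range (h : IsStairsInput ξ) (t : ℝ) :
    BddAbove (range fun s : Icc (0 : ℝ) 1 => stairs ξ (t - s - 1) + ξ (t - s)) := by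
  obtain ⟨B, hB, hξ⟩ := h.exists_bound t
  refine ⟨(⌈t⌉₊ : ℝ) * B + B, ?_⟩
  rintro _ ⟨s, rfl⟩
  have hs := s.2.1
  have h1 := (h.stairs_mem_Icc hB hξ ⌈t⌉₊ (t - s - 1) (by linarith)
    (by linarith [Nat.le_ceil t])).2
  have h2 := hξ (t - s) (by linarith)
  simp only
  linarith

theorem add_le_stairs_of_mem (h : IsStairsInput ξ) {t v : ℝ} (hv : v ≤ t) (hv' : t - 1 ≤ v) :
    stairs ξ (v - 1) + ξ v ≤ stairs ξ t := by
  rcases le_or_gt t 0 with h0 | h0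
  · rw [stairs_of_nonpos ξ h0, stairs_of_nonpos ξ (by linarith), h.zero_of_nonpos v (by linarith)]
    simp
  · rw [stairs_of_pos ξ h0]
    have := le_ciSup (h.bddAbove_range t) ⟨t - v, by linarith, by linarith⟩
    simpa using this

theorem stairs_sub_one_le (h : IsStairsInput ξ) (t : ℝ) : stairs ξ (t - 1) ≤ stairs ξ t :=
  le_trans (le_add_of_nonneg_right (h.nonneg t)) (h.add_le_stairs_of_mem le_rfl (by linarith))

theorem stairs_le_of_window {t c : ℝ} (hc : 0 ≤ c)
    (H : ∀ v, t - 1 ≤ v → v ≤ t → stairs ξ (v - 1) + ξ v ≤ c) : stairs ξ t ≤ c := by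
  rcases le_or_gt t 0 with h0 | h0
  · rwa [stairs_of_nonpos ξ h0]
  · rw [stairs_of_pos ξ h0]
    exact ciSup_le fun s => H _ (by linarith [s.2.2]) (by linarith [s.2.1])

theorem stairs_le_stairs_of_le_add_one (h : IsStairsInput ξ) {t t' : ℝ} (h1 : t ≤ t')
    (h2 : t' ≤ t + 1) : stairs ξ t ≤ stairs ξ t' := by
  refine stairs_le_of_window (h.stairs_nonneg _) fun v hv hv' => ?_
  rcases le_or_gt (t' - 1) v with h3 | h3
  · exact h.add_le_stairs_of_mem (by linarith) h3
  · exact (h.add_le_stairs_of_mem (t := t' - 1) h3.le (by linarith)).trans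
      (h.stairs_sub_one_le t')

theorem stairs_mono (h : IsStairsInput ξ) : Monotone (stairs ξ) := by
  have key : ∀ n : ℕ, ∀ t t' : ℝ, t ≤ t' → t' ≤ t + n → stairs ξ t ≤ stairs ξ t' := by
    intro n
    induction n with
    | zero => intro t t' h1 h2; rw [le_antisymm h1 (by simpa using h2)]
    | succ n ih =>
      intro t t' h1 h2
      push_cast at h2
      rcases le_or_gt t' (t + 1) with h3 | h3
      · exact h.stairs_le_stairs_of_le_add_one h1 h3
      · exact (h.stairs_le_stairs_of_le_add_one (t' := t + 1) (by linarith) le_rfl).trans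
          (ih _ _ h3.le (by linarith))
  intro t t' htt'
  exact key ⌈t' - t⌉₊ t t' htt' (by linarith [Nat.le_ceil (t' - t)])

theorem add_le_stairs (h : IsStairsInput ξ) {t v : ℝ} (hv : v ≤ t) :
    stairs ξ (v - 1) + ξ v ≤ stairs ξ t :=
  (h.add_le_stairs_of_mem le_rfl (by linarith)).trans (h.stairs_mono hv)

theorem le_stairs (h : IsStairsInput ξ) {t v : ℝ} (hv : v ≤ t) : ξ v ≤ stairs ξ t :=
  (le_add_of_nonneg_left (h.stairs_nonneg _)).trans (h.add_le_stairs hv)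

/-- Between `t` and `t'` the path grows only through the marks in `(t, t']`. -/
theorem stairs_le (h : IsStairsInput ξ) {t t' c : ℝ} (hc : stairs ξ t ≤ c)
    (H : ∀ v, t < v → v ≤ t' → stairs ξ (v - 1) + ξ v ≤ c) : stairs ξ t' ≤ c := by
  refine stairs_le_of_window ((h.stairs_nonneg t).trans hc) fun v _ hv => ?_
  rcases le_or_gt v t with h1 | h1
  · exact (h.add_le_stairs h1).trans hc
  · exact H v h1 hv

theorem stairs_le_add (h : IsStairsInput ξ) {t t' a : ℝ} (ha : 0 ≤ a) (h1 : t' ≤ t + 1)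
    (H : ∀ v, t < v → v ≤ t' → ξ v ≤ a) : stairs ξ t' ≤ stairs ξ t + a :=
  h.stairs_le (by linarith) fun v hv hv' =>
    add_le_add (h.stairs_mono (by linarith)) (H v hv hv')

theorem exists_right_small (h : IsStairsInput ξ) (t : ℝ) {a : ℝ} (ha : 0 < a) :
    ∃ δ : ℝ, 0 < δ ∧ ∀ v, t < v → v ≤ t + δ → ξ v ≤ a := by
  have hfin : ({v | v ≤ t + 1 ∧ a < ξ v} ∩ Ioi t).Finite := (h.finite a ha _).inter_of_left _
  have hev : ∀ᶠ v in 𝓝[>] t, v ∉ {v | v ≤ t + 1 ∧ a < ξ v} ∩ Ioi t :=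
    nhdsWithin_le_nhds (hfin.isClosed.isOpen_compl.mem_nhds (by simp))
  obtain ⟨u, hu, hu'⟩ := (mem_nhdsGT_iff_exists_Ioc_subset).1 hev
  refine ⟨min (u - t) 1, lt_min (sub_pos.2 hu) one_pos, fun v hv hv' => ?_⟩
  by_contra hcon
  have h1 : v ≤ u := by linarith [min_le_left (u - t) 1]
  have h2 : v ≤ t + 1 := by linarith [min_le_right (u - t) 1]
  exact hu' ⟨hv, h1⟩ ⟨⟨h2, not_le.1 hcon⟩, hv⟩

theorem exists_left_small (h : IsStairsInput ξ) (t : ℝ) {a : ℝ} (ha : 0 < a) :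
    ∃ s, s < t ∧ ∀ v, s < v → v < t → ξ v ≤ a := by
  have hfin : ({v | v ≤ t ∧ a < ξ v} ∩ Iio t).Finite := (h.finite a ha _).inter_of_left _
  have hev : ∀ᶠ v in 𝓝[<] t, v ∉ {v | v ≤ t ∧ a < ξ v} ∩ Iio t :=
    nhdsWithin_le_nhds (hfin.isClosed.isOpen_compl.mem_nhds (by simp))
  obtain ⟨u, hu, hu'⟩ := (mem_nhdsLT_iff_exists_Ico_subset).1 hev
  refine ⟨u, hu, fun v hv hv' => ?_⟩
  by_contra hcon
  exact hu' ⟨hv.le, hv'⟩ ⟨⟨hv'.le, not_le.1 hcon⟩, hv'⟩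

/-- Right-continuity of the path. -/
theorem stairs_right_cont (h : IsStairsInput ξ) (t : ℝ) {a : ℝ} (ha : 0 < a) :
    ∃ δ : ℝ, 0 < δ ∧ ∀ t', t' ≤ t + δ → stairs ξ t' ≤ stairs ξ t + a := by
  obtain ⟨δ, hδ, H⟩ := h.exists_right_small t ha
  refine ⟨min δ 1, by positivity, fun t' ht' => h.stairs_le_add ha.le
    (by linarith [min_le_right δ 1]) fun v hv hv' => H v hv (by linarith [min_le_left δ 1])⟩

/-- The path is constant just before any time `w`: as soon as it exceeds its value at `w - 1`,
the marks close to `w`, which are too small, do not make it grow. -/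
theorem stairs_left_const (h : IsStairsInput ξ) (w : ℝ) :
    ∃ s, s < w ∧ ∀ t, s ≤ t → t < w → stairs ξ t = stairs ξ s := by
  by_cases hall : ∀ s, w - 1 ≤ s → s < w → stairs ξ s = stairs ξ (w - 1)
  · exact ⟨w - 1, by linarith, hall⟩
  push Not at hall
  obtain ⟨s₀, h1, h2, h3⟩ := hall
  have h4 : stairs ξ (w - 1) < stairs ξ s₀ := lt_of_le_of_ne (h.stairs_mono h1) (Ne.symm h3)
  obtain ⟨s₁, hs₁, H⟩ := h.exists_left_small w (sub_pos.2 h4)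
  refine ⟨max s₀ s₁, max_lt h2 hs₁, fun t ht htw => le_antisymm ?_ (h.stairs_mono ht)⟩
  refine h.stairs_le le_rfl fun v hv hv' => ?_
  have h5 := H v ((le_max_right _ _).trans_lt hv) (hv'.trans_lt htw)
  have h6 : stairs ξ (v - 1) ≤ stairs ξ (w - 1) := h.stairs_mono (by linarith)
  have h7 : stairs ξ s₀ ≤ stairs ξ (max s₀ s₁) := h.stairs_mono (le_max_left _ _)
  linarith

/-- A mark that dominates twice all other marks within distance `1` produces a regeneration one
time unit later. -/
theorem stairs_add_one_eq_of_dominant (h : IsStairsInput ξ) {u a : ℝ} (ha : 0 ≤ a)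
    (hu : 2 * a ≤ ξ u) (H : ∀ v, u - 1 < v → v < u + 1 → v ≠ u → ξ v ≤ a) (h1 : ξ (u + 1) = 0) :
    stairs ξ (u + 1) = stairs ξ u := by
  refine le_antisymm (h.stairs_le le_rfl fun v hv hv' => ?_) (h.stairs_mono (by linarith))
  rcases hv'.eq_or_lt with rfl | hlt
  · simp [h1]
  have h2 : stairs ξ (v - 1) ≤ stairs ξ (u - 1) + a :=
    h.stairs_le_add ha (by linarith) fun w hw hw' => H w hw (by linarith) (by linarith)
  have h3 := H v (by linarith) hlt hv.ne'
  have h4 := h.add_le_stairs (le_refl u)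
  linarith

/-- If all marks up to time `t ≤ n` are at most `z`, and at most `b` outside one unit time cell,
then the path at `t` is at most `n * b + z`: the times of the marks which add up are separated by
at least `1`, so each unit cell contributes at most one of them. -/
theorem stairs_le_of_one_big_cell {t b z k₀ : ℝ} (hb : 0 ≤ b) (hz : 0 ≤ z)
    (H1 : ∀ v ≤ t, ξ v ≤ z) (H2 : ∀ v ≤ t, ¬ (k₀ < v ∧ v ≤ k₀ + 1) → ξ v ≤ b)
    {n : ℕ} (hn : t ≤ n) : stairs ξ t ≤ n * b + z := by
  have key : ∀ n : ℕ, ∀ s ≤ t, s ≤ n → stairs ξ s ≤ n * b + if k₀ < s then z else 0 := by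
    intro n
    induction n with
    | zero =>
      intro s _ hs
      rw [stairs_of_nonpos ξ (by simpa using hs)]
      split_ifs <;> simp [hz]
    | succ n ih =>
      intro s hst hs
      push_cast at hs ⊢
      have hif : 0 ≤ if k₀ < s then z else 0 := by split_ifs <;> simp [hz]
      refine stairs_le_of_window (by positivity) fun v hv hv' => ?_
      have h1 := ih (v - 1) (by linarith) (by linarith)
      by_cases hv2 : k₀ < v ∧ v ≤ k₀ + 1
      · rw [if_neg (by linarith [hv2.2])] at h1
        rw [if_pos (by linarith [hv2.1])]
        linarith [H1 v (by linarith)]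
      · have h2 := H2 v (by linarith) hv2
        have h3 : (if k₀ < v - 1 then z else 0) ≤ if k₀ < s then z else 0 := by
          split_ifs <;> linarith
        linarith
  refine (key n t le_rfl hn).trans ?_
  split_ifs <;> linarith

/-! ### The first regeneration time of a path -/

theorem sInf_regenSet_le {R : ℝ → ℝ} {t : ℝ} (ht : 1 < t) (h : R t = R (t - 1)) :
    sInf (regenSet R 0) ≤ t :=
  csInf_le ⟨1, fun s hs => by have := hs.1; linarith⟩ ⟨by linarith, h⟩

theorem one_le_sInf_regenSet {R : ℝ → ℝ} (h : (regenSet R 0).Nonempty) :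
    1 ≤ sInf (regenSet R 0) :=
  le_csInf h fun s hs => by have := hs.1; linarith

/-- The infimum defining `τ₁` is a regeneration itself, by right-continuity (at `τ₁ = 1` the
strict inequality in `regenSet` may fail, but the equation still holds). -/
theorem stairs_sInf_regenSet (h : IsStairsInput ξ) (hne : (regenSet (stairs ξ) 0).Nonempty) :
    stairs ξ (sInf (regenSet (stairs ξ) 0)) = stairs ξ (sInf (regenSet (stairs ξ) 0) - 1) := by
  set τ := sInf (regenSet (stairs ξ) 0)
  refine le_antisymm (le_of_forall_pos_le_add fun a ha => ?_) (h.stairs_sub_one_le τ)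
  obtain ⟨δ, hδ, H⟩ := h.stairs_right_cont (τ - 1) ha
  obtain ⟨t, ht, htδ⟩ := exists_lt_of_csInf_lt hne (lt_add_of_pos_right τ hδ)
  have h1 : τ ≤ t := csInf_le ⟨1, fun s hs => by have := hs.1; linarith⟩ ht
  calc stairs ξ τ ≤ stairs ξ t := h.stairs_mono h1
    _ = stairs ξ (t - 1) := ht.2
    _ ≤ _ := H _ (by linarith)

/-- If the increments `R t - R (t - 1)` over a compact time interval never vanish, then they are
bounded away from `0`. -/
theorem exists_pos_le_increment (h : IsStairsInput ξ) {s : ℝ}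
    (hs : ∀ t ∈ Icc 1 s, stairs ξ t ≠ stairs ξ (t - 1)) :
    ∃ c : ℝ, 0 < c ∧ ∀ t ∈ Icc 1 s, c ≤ stairs ξ t - stairs ξ (t - 1) := by
  have hpos : ∀ t ∈ Icc 1 s, 0 < stairs ξ t - stairs ξ (t - 1) := fun t ht =>
    sub_pos.2 (lt_of_le_of_ne (h.stairs_sub_one_le t) (Ne.symm (hs t ht)))
  refine isCompact_Icc.induction_on
    (p := fun A => ∃ c : ℝ, 0 < c ∧ ∀ t ∈ A, c ≤ stairs ξ t - stairs ξ (t - 1)) ?_ ?_ ?_ ?_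
  · exact ⟨1, one_pos, by simp⟩
  · rintro A A' hAA' ⟨c, hc, H⟩
    exact ⟨c, hc, fun t ht => H t (hAA' ht)⟩
  · rintro A A' ⟨c, hc, H⟩ ⟨c', hc', H'⟩
    refine ⟨min c c', lt_min hc hc', ?_⟩
    rintro t (ht | ht)
    · exact (min_le_left _ _).trans (H t ht)
    · exact (min_le_right _ _).trans (H' t ht)
  · intro t ht
    -- to the right of `t` the increment is close to its value at `t` or larger, and just to the
    -- left of `t` it is constant
    have hD := hpos t ht
    set D := stairs ξ t - stairs ξ (t - 1)
    obtain ⟨δ, hδ, H⟩ := h.stairs_right_cont (t - 1) (half_pos hD)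
    obtain ⟨s₁, hs₁, H₁⟩ := h.stairs_left_const t
    obtain ⟨s₂, hs₂, H₂⟩ := h.stairs_left_const (t - 1)
    set l := max s₁ (s₂ + 1)
    have hl : l < t := max_lt hs₁ (by linarith)
    obtain ⟨c, hc, Hc⟩ : ∃ c : ℝ, 0 < c ∧ ∀ u ∈ Icc 1 s, l < u → u < t →
        c ≤ stairs ξ u - stairs ξ (u - 1) := by
      by_cases hex : ∃ u ∈ Icc 1 s, l < u ∧ u < t
      · obtain ⟨u, hu, hlu, hut⟩ := hex
        refine ⟨_, hpos u hu, fun u' _ hlu' hut' => ?_⟩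
        have e1 := H₁ u ((le_max_left _ _).trans hlu.le) hut
        have e2 := H₁ u' ((le_max_left _ _).trans hlu'.le) hut'
        have l2 : s₂ + 1 ≤ l := le_max_right _ _
        have e3 := H₂ (u - 1) (by linarith) (by linarith)
        have e4 := H₂ (u' - 1) (by linarith) (by linarith)
        rw [e1, e2, e3, e4]
      · push Not at hex
        exact ⟨1, one_pos, fun u hu h1 h2 => absurd h2 (not_lt.2 (hex u hu h1))⟩
    refine ⟨Ioo l (t + δ) ∩ Icc 1 s, ?_, min c (D / 2), lt_min hc (half_pos hD), ?_⟩
    · rw [inter_comm]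
      exact inter_mem_nhdsWithin _ (Ioo_mem_nhds hl (by linarith))
    · rintro u ⟨⟨hu1, hu2⟩, hu3⟩
      rcases lt_or_ge u t with hut | hut
      · exact (min_le_left _ _).trans (Hc u hu3 hu1 hut)
      · refine (min_le_right _ _).trans ?_
        have e1 := h.stairs_mono hut
        have e2 := H (u - 1) (by linarith)
        simp only [D] at e2 ⊢
        linarith

/-- Discrete characterisation of `τ₁ ≤ s`, for `s` in a right-dense set `Q` of times: there are
times in `Q` up to `s` at which the increment over the last time unit is arbitrarily small. The
hypothesis `h1` is needed at time `1`, where a vanishing increment is not by definition a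
regeneration. -/
theorem sInf_regenSet_le_iff (h : IsStairsInput ξ) (hne : (regenSet (stairs ξ) 0).Nonempty)
    (h1 : stairs ξ 1 = 0 → ∃ δ : ℝ, 0 < δ ∧ ∀ v, 1 < v → v ≤ 1 + δ → ξ v = 0)
    {Q : Set ℝ} (hQ : ∀ a b : ℝ, 1 ≤ a → a < b → ∃ q ∈ Q, a < q ∧ q < b) {s : ℝ} (hsQ : s ∈ Q)
    (hs : 1 ≤ s) :
    sInf (regenSet (stairs ξ) 0) ≤ s ↔
      ∀ ε : ℝ, 0 < ε → ∃ q ∈ Q, 1 ≤ q ∧ q ≤ s ∧ stairs ξ q < stairs ξ (q - 1) + ε := by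
  constructor
  · intro hτ ε hε
    have hτ1 := one_le_sInf_regenSet hne
    have hτ2 := h.stairs_sInf_regenSet hne
    set τ := sInf (regenSet (stairs ξ) 0)
    rcases hτ.eq_or_lt with heq | hlt
    · exact ⟨s, hsQ, hs, le_rfl, by rw [← heq, hτ2]; linarith⟩
    · obtain ⟨δ, hδ, H⟩ := h.stairs_right_cont τ (half_pos hε)
      obtain ⟨q, hq, hq1, hq2⟩ := hQ τ (min s (τ + δ)) hτ1 (lt_min hlt (by linarith))
      have h2 := H q (hq2.le.trans (min_le_right _ _))
      have h3 : stairs ξ (τ - 1) ≤ stairs ξ (q - 1) := h.stairs_mono (by linarith)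
      exact ⟨q, hq, by linarith, hq2.le.trans (min_le_left _ _), by linarith⟩
  · intro H
    by_contra hlt
    rw [not_le] at hlt
    obtain ⟨c, hc, Hc⟩ := h.exists_pos_le_increment (s := s) (by
      intro t ht heq
      rcases ht.1.eq_or_lt with rfl | h1t
      · have hR1 : stairs ξ 1 = 0 := by rw [heq, sub_self, stairs_of_nonpos ξ le_rfl]
        obtain ⟨δ, hδ, Hδ⟩ := h1 hR1
        -- the path stays at `0` after time `1`, so that `τ₁ = 1`
        have key : sInf (regenSet (stairs ξ) 0) ≤ 1 := by
          refine le_of_forall_pos_le_add fun a ha => ?_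
          have hm : 0 < min δ (min a 1) := by positivity
          have m1 := min_le_left δ (min a 1)
          have m2 := (min_le_right δ (min a 1)).trans (min_le_left a 1)
          have m3 := (min_le_right δ (min a 1)).trans (min_le_right a 1)
          set d := min δ (min a 1)
          refine (sInf_regenSet_le (t := 1 + d) (by linarith) ?_).trans (by linarith)
          refine le_antisymm ?_ (h.stairs_sub_one_le _)
          have e1 : stairs ξ (1 + d) ≤ stairs ξ 1 := h.stairs_le le_rfl fun v hv hv' => by
            rw [Hδ v hv (by linarith), add_zero]
            exact h.stairs_mono (by linarith)
          linarith [h.stairs_nonneg (1 + d - 1)]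
        linarith
      · exact absurd (sInf_regenSet_le h1t heq) (not_le.2 (hlt.trans_le' ht.2)))
    obtain ⟨q, _, hq1, hq2, hq3⟩ := H c hc
    have := Hc q ⟨hq1, hq2⟩
    linarith

end IsStairsInput

/-! ### Discretisation of the stairs process -/

/-- A configuration of points in the open quadrant with finitely many points of mark `> a` up to
time `L`, for all `a > 0` and `L`. -/
structure IsLocallyFiniteConfig (S : Set (ℝ × ℝ)) : Prop where
  subset_quadrant : S ⊆ Ioi (0 : ℝ) ×ˢ Ioi (0 : ℝ)
  finite : ∀ a : ℝ, 0 < a → ∀ L : ℝ, (S ∩ (Ioc 0 L ×ˢ Ioi a)).Finite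

namespace IsLocallyFiniteConfig

variable {S : Set (ℝ × ℝ)}

theorem bddAbove (h : IsLocallyFiniteConfig S) (t : ℝ) : BddAbove {x : ℝ | (t, x) ∈ S} := by
  obtain ⟨B, hB⟩ := ((h.finite 1 one_pos t).image Prod.snd).bddAbove
  refine ⟨max B 1, fun x hx => ?_⟩
  by_cases h1 : 1 < x
  · exact le_max_of_le_left
      (hB ⟨(t, x), ⟨hx, ⟨(h.subset_quadrant hx).1, le_rfl⟩, h1⟩, rfl⟩)
  · exact le_max_of_le_right (not_lt.1 h1)

theorem le_markAt (h : IsLocallyFiniteConfig S) {t x : ℝ} (hx : (t, x) ∈ S) : x ≤ markAt S t :=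
  le_csSup (h.bddAbove t) hx

theorem lt_markAt_iff (h : IsLocallyFiniteConfig S) {t c : ℝ} (hc : 0 ≤ c) :
    c < markAt S t ↔ ∃ x, c < x ∧ (t, x) ∈ S := by
  constructor
  · intro hlt
    rcases Set.eq_empty_or_nonempty {x : ℝ | (t, x) ∈ S} with he | hne
    · rw [markAt, he, Real.sSup_empty] at hlt
      exact absurd hlt (not_lt.2 hc)
    · obtain ⟨x, hx, hcx⟩ := exists_lt_of_lt_csSup hne hlt
      exact ⟨x, hcx, hx⟩
  · rintro ⟨x, hcx, hx⟩
    exact hcx.trans_le (h.le_markAt hx)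

theorem isStairsInput (h : IsLocallyFiniteConfig S) : IsStairsInput (markAt S) where
  nonneg t := Real.sSup_nonneg fun _ hx => (h.subset_quadrant hx).2.le
  zero_of_nonpos t ht := by
    have : {x : ℝ | (t, x) ∈ S} = ∅ := by
      ext x
      simp only [mem_ofPred_eq, mem_empty_iff_false, iff_false]
      exact fun hx => absurd (h.subset_quadrant hx).1 (not_lt.2 ht)
    rw [markAt, this, Real.sSup_empty]
  finite a ha L := by
    refine ((h.finite a ha L).image Prod.fst).subset ?_
    rintro t ⟨htL, hat⟩
    obtain ⟨x, hax, hx⟩ := (h.lt_markAt_iff ha.le).1 hat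
    exact ⟨(t, x), ⟨hx, ⟨(h.subset_quadrant hx).1, htL⟩, hax⟩, rfl⟩

end IsLocallyFiniteConfig

/-- The dyadic time cell `(j / 2 ^ k, (j + 1) / 2 ^ k]`. -/
def dyadicCell (k j : ℕ) : Set ℝ := Ioc ((j : ℝ) / 2 ^ k) (((j : ℝ) + 1) / 2 ^ k)

/-- The supremum of the marks of the configuration `S` in a dyadic time cell. -/
noncomputable def cellMark (S : Set (ℝ × ℝ)) (k j : ℕ) : ℝ≥0∞ :=
  ⨆ p : ℝ × ℝ, ⨆ _ : p ∈ S ∩ (dyadicCell k j ×ˢ univ), ENNReal.ofReal p.2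

/-- The stairs recursion on a grid of mesh `1 / (d + 1)`: the marks `M i` that add up belong to
cells whose indices differ by at least `d + 1`. -/
noncomputable def gridStairs (M : ℕ → ℝ≥0∞) (d : ℕ) : ℕ → ℝ≥0∞
  | 0 => 0
  | j + 1 => max (gridStairs M d j) (gridStairs M d (j - d) + M j)

/-- The grid approximation of mesh `2 ^ (-k)` of the stairs process driven by `S`. -/
noncomputable def dyadicStairs (S : Set (ℝ × ℝ)) (k j : ℕ) : ℝ≥0∞ :=
  gridStairs (cellMark S k) (2 ^ k - 1) j

theorem dyadicStairs_succ (S : Set (ℝ × ℝ)) (k j : ℕ) :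
    dyadicStairs S k (j + 1) =
      max (dyadicStairs S k j) (dyadicStairs S k (j - (2 ^ k - 1)) + cellMark S k j) := by
  rw [dyadicStairs, gridStairs]
  rfl

theorem dyadicStairs_zero (S : Set (ℝ × ℝ)) (k : ℕ) : dyadicStairs S k 0 = 0 := by
  rw [dyadicStairs, gridStairs]

theorem dyadic_sub_le (k j : ℕ) :
    ((j : ℝ) + 1) / 2 ^ k - 1 ≤ ((j - (2 ^ k - 1) : ℕ) : ℝ) / 2 ^ k := by
  have h2 : (0 : ℝ) < 2 ^ k := by positivity
  have h3 : j + 1 ≤ (j - (2 ^ k - 1)) + 2 ^ k := by have := Nat.one_le_two_pow (n := k); omega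
  rw [div_sub_one h2.ne']
  gcongr
  have : ((j + 1 : ℕ) : ℝ) ≤ ((j - (2 ^ k - 1) + 2 ^ k : ℕ) : ℝ) := by exact_mod_cast h3
  push_cast at this
  linarith

namespace IsLocallyFiniteConfig

variable {S : Set (ℝ × ℝ)}

theorem ofReal_markAt_le_cellMark (h : IsLocallyFiniteConfig S) {k j : ℕ} {v : ℝ}
    (hv : v ∈ dyadicCell k j) : ENNReal.ofReal (markAt S v) ≤ cellMark S k j := by
  refine le_of_forall_lt fun c hc => ?_
  have hct : c ≠ ∞ := hc.ne_top
  rw [ENNReal.lt_ofReal_iff_toReal_lt hct] at hc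
  obtain ⟨x, hcx, hx⟩ := (h.lt_markAt_iff ENNReal.toReal_nonneg).1 hc
  refine lt_of_lt_of_le ((ENNReal.lt_ofReal_iff_toReal_lt hct).2 hcx) ?_
  exact le_iSup₂_of_le (f := fun (p : ℝ × ℝ) (_ : p ∈ S ∩ (dyadicCell k j ×ˢ univ)) =>
    ENNReal.ofReal p.2) (v, x) ⟨hx, hv, trivial⟩ le_rfl

/-- The grid recursion allows marks slightly closer than `1` to add up, so it dominates. -/
theorem ofReal_stairs_le_dyadicStairs (h : IsLocallyFiniteConfig S) (k j : ℕ) :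
    ENNReal.ofReal (stairs (markAt S) ((j : ℝ) / 2 ^ k)) ≤ dyadicStairs S k j := by
  have hI := h.isStairsInput
  induction j using Nat.strong_induction_on with
  | _ j ih =>
    cases j with
    | zero => simp [stairs_of_nonpos]
    | succ j =>
      rw [dyadicStairs_succ]
      by_cases htop : max (dyadicStairs S k j)
          (dyadicStairs S k (j - (2 ^ k - 1)) + cellMark S k j) = ∞
      · rw [htop]; exact le_top
      rw [ENNReal.ofReal_le_iff_le_toReal htop]
      refine hI.stairs_le (t := (j : ℝ) / 2 ^ k) ?_ fun v hv hv' => ?_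
      · rw [← ENNReal.ofReal_le_iff_le_toReal htop]
        exact (ih j (by omega)).trans (le_max_left _ _)
      · rw [← ENNReal.ofReal_le_iff_le_toReal htop,
          ENNReal.ofReal_add (hI.stairs_nonneg _) (hI.nonneg _)]
        refine le_trans (add_le_add ?_ ?_) (le_max_right _ _)
        · refine le_trans (ENNReal.ofReal_le_ofReal (hI.stairs_mono ?_)) (ih _ (by omega))
          push_cast at hv'
          linarith [dyadic_sub_le k j]
        · exact h.ofReal_markAt_le_cellMark ⟨hv, by push_cast at hv'; exact hv'⟩

/-- If no two marks larger than `a` have a time distance in `[1 - 2 ^ (-k), 1)`, then the grid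
approximation exceeds the stairs process by at most `2 * a * (t + 1)` at time `t`. -/
theorem dyadicStairs_le (h : IsLocallyFiniteConfig S) {a L : ℝ} (ha : 0 < a) {k : ℕ}
    (H : ∀ u ≤ L, ∀ w ≤ L, a < markAt S u → a < markAt S w → u - 1 < w → w < u →
      u - 1 + 1 / 2 ^ k < w) (j : ℕ) (hj : (j : ℝ) / 2 ^ k ≤ L) :
    dyadicStairs S k j ≤
      ENNReal.ofReal (stairs (markAt S) ((j : ℝ) / 2 ^ k) + 2 * a * ((j : ℝ) / 2 ^ k + 1)) := by
  have hI := h.isStairsInput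
  have h2 : (0 : ℝ) < 2 ^ k := by positivity
  have h21 : (1 : ℝ) / 2 ^ k ≤ 1 := by
    rw [div_le_one h2]; exact one_le_pow₀ one_le_two
  induction j using Nat.strong_induction_on with
  | _ j ih =>
    cases j with
    | zero => rw [dyadicStairs_zero]; exact zero_le
    | succ j =>
      push_cast at hj ⊢
      have hstep : ((j : ℝ) + 1) / 2 ^ k = (j : ℝ) / 2 ^ k + 1 / 2 ^ k := by ring
      have hinv : (0 : ℝ) < 1 / 2 ^ k := by positivity
      have hj0 : (0 : ℝ) ≤ (j : ℝ) / 2 ^ k := by positivity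
      rw [dyadicStairs_succ]
      refine max_le ?_ ?_
      · refine (ih j (by omega) (by linarith)).trans (ENNReal.ofReal_le_ofReal ?_)
        have := hI.stairs_mono (show (j : ℝ) / 2 ^ k ≤ ((j : ℝ) + 1) / 2 ^ k by linarith)
        have : 2 * a * ((j : ℝ) / 2 ^ k + 1) ≤ 2 * a * (((j : ℝ) + 1) / 2 ^ k + 1) := by
          gcongr; linarith
        linarith
      set t := ((j : ℝ) + 1) / 2 ^ k with ht
      have ht0 : 0 ≤ t := by positivity
      have hprev : dyadicStairs S k (j - (2 ^ k - 1)) ≤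
          ENNReal.ofReal (stairs (markAt S) (t - 1) + 2 * a * t) := by
        rcases le_or_gt (2 ^ k) (j + 1) with hk | hk
        · have e1 : ((j - (2 ^ k - 1) : ℕ) : ℝ) / 2 ^ k = t - 1 := by
            have e2 : (j - (2 ^ k - 1)) + 2 ^ k = j + 1 := by
              have := Nat.one_le_two_pow (n := k); omega
            have e3 : ((j - (2 ^ k - 1) : ℕ) : ℝ) = (j : ℝ) + 1 - 2 ^ k := by
              have : ((j - (2 ^ k - 1) + 2 ^ k : ℕ) : ℝ) = ((j + 1 : ℕ) : ℝ) := by rw [e2]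
              push_cast at this
              linarith
            rw [e3, ht]; field_simp
          have := ih (j - (2 ^ k - 1)) (by omega) (by rw [e1]; linarith)
          rw [e1] at this
          simpa using this
        · rw [show j - (2 ^ k - 1) = 0 by omega, dyadicStairs_zero]
          exact zero_le
      have hprev0 : 0 ≤ stairs (markAt S) (t - 1) + 2 * a * t :=
        add_nonneg (hI.stairs_nonneg _) (by positivity)
      have hRt : stairs (markAt S) (t - 1) ≤ stairs (markAt S) t := hI.stairs_sub_one_le t
      have hle : dyadicStairs S k (j - (2 ^ k - 1)) ≤
          ENNReal.ofReal (stairs (markAt S) t + 2 * a * (t + 1)) :=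
        hprev.trans (ENNReal.ofReal_le_ofReal (by linarith))
      refine add_le_of_le_tsub_left_of_le hle (iSup₂_le fun p hp => ?_)
      refine ENNReal.le_sub_of_add_le_left (hle.trans_lt ENNReal.ofReal_lt_top).ne ?_
      refine (add_le_add_left hprev _).trans ?_
      have hp2 : 0 ≤ p.2 := (h.subset_quadrant hp.1).2.le
      rw [← ENNReal.ofReal_add hprev0 hp2]
      refine ENNReal.ofReal_le_ofReal ?_
      -- a mark up to `a` is paid for by the error term; a larger mark at time `p.1` is added to
      -- `R (p.1 - 1)` in the stairs recursion, which by the gap condition is within `a` of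
      -- `R (t - 1)`
      rcases le_or_gt p.2 a with hpa | hpa
      · linarith
      · have hmark := h.le_markAt (t := p.1) (x := p.2) hp.1
        have hcell : (j : ℝ) / 2 ^ k < p.1 ∧ p.1 ≤ t := hp.2.1
        have h3 := hI.add_le_stairs hcell.2
        have h4 : stairs (markAt S) (t - 1) ≤ stairs (markAt S) (p.1 - 1) + a := by
          refine hI.stairs_le_add ha.le (by linarith) fun w hw hw' => ?_
          by_contra hcon
          have hwL : w ≤ L := by linarith
          have hwp : w < p.1 := by
            rcases h21.eq_or_lt with h5 | h5
            · rcases hcell.2.eq_or_lt with h6 | h6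
              · linarith
              · linarith
            · linarith
          have := H p.1 (by linarith) w hwL (hpa.trans_le hmark) (not_le.1 hcon) hw hwp
          linarith
        linarith

/-- Up to a given time there are finitely many marks larger than `a`, so that for fine meshes none
of their gaps lies in the critical range of `dyadicStairs_le`. -/
theorem tendsto_dyadicStairs (h : IsLocallyFiniteConfig S) (k i : ℕ) :
    Tendsto (fun l => dyadicStairs S (k + l) (i * 2 ^ l)) atTop
      (𝓝 (ENNReal.ofReal (stairs (markAt S) ((i : ℝ) / 2 ^ k)))) := by
  have hI := h.isStairsInput
  have e1 : ∀ l : ℕ, ((i * 2 ^ l : ℕ) : ℝ) / 2 ^ (k + l) = (i : ℝ) / 2 ^ k := by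
    intro l
    push_cast
    rw [pow_add]
    field_simp
  have hq0 : (0 : ℝ) ≤ (i : ℝ) / 2 ^ k := by positivity
  set q := (i : ℝ) / 2 ^ k with hq
  have hlow : ∀ l, ENNReal.ofReal (stairs (markAt S) q) ≤ dyadicStairs S (k + l) (i * 2 ^ l) := by
    intro l
    have := h.ofReal_stairs_le_dyadicStairs (k + l) (i * 2 ^ l)
    rwa [e1] at this
  refine tendsto_order.2 ⟨fun c hc => Eventually.of_forall fun l => hc.trans_le (hlow l), ?_⟩
  intro c hc
  obtain ⟨ε, hε, hεc⟩ : ∃ ε : ℝ, 0 < ε ∧ ENNReal.ofReal (stairs (markAt S) q + ε) < c := by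
    obtain ⟨r, hr, hrc⟩ := ENNReal.lt_iff_exists_nnreal_btwn.1 hc
    have hr' : stairs (markAt S) q < r := by
      rw [ENNReal.ofReal_lt_coe_iff (hI.stairs_nonneg _)] at hr
      exact hr
    exact ⟨r - stairs (markAt S) q, by linarith, by simpa using hrc⟩
  set a := ε / (2 * (q + 1)) with ha_def
  have ha : 0 < a := by positivity
  have hfin := hI.finite a ha q
  have hev : ∀ᶠ l : ℕ in atTop, ∀ u ∈ {t | t ≤ q ∧ a < markAt S t},
      ∀ w ∈ {t | t ≤ q ∧ a < markAt S t}, u - 1 < w → u - 1 + 1 / 2 ^ (k + l) < w := by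
    rw [Filter.eventually_all_finite hfin]
    intro u _
    rw [Filter.eventually_all_finite hfin]
    intro w _
    by_cases huw : u - 1 < w
    · have ht : Tendsto (fun l : ℕ => u - 1 + 1 / (2 : ℝ) ^ (k + l)) atTop (𝓝 (u - 1 + 0)) := by
        refine tendsto_const_nhds.add ?_
        have h1 := (tendsto_add_atTop_iff_nat k).2
          (tendsto_pow_atTop_nhds_zero_of_lt_one (r := (1 / 2 : ℝ)) (by norm_num) (by norm_num))
        refine h1.congr fun l => ?_
        rw [add_comm, one_div_pow]
      rw [add_zero] at ht
      exact (ht.eventually_lt_const huw).mono fun l hl _ => hl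
    · exact Eventually.of_forall fun l hl => absurd hl huw
  filter_upwards [hev] with l hl
  have := h.dyadicStairs_le ha (L := q) (k := k + l)
    (fun u hu w hw hau haw huw _ => hl u ⟨hu, hau⟩ w ⟨hw, haw⟩ huw) (i * 2 ^ l) (by rw [e1])
  rw [e1] at this
  refine this.trans_lt ?_
  rwa [show 2 * a * (q + 1) = ε by rw [ha_def]; field_simp]

end IsLocallyFiniteConfig

/-! ### Independence and counting for Poisson point processes -/

/-- The σ-algebra generated by the numbers of points in the measurable subsets of `U`. -/
@[reducible]
noncomputable def countSigma {Ω : Type*} (pts : Ω → Set (ℝ × ℝ)) (U : Set (ℝ × ℝ)) :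
    MeasurableSpace Ω :=
  ⨆ A : {A : Set (ℝ × ℝ) // MeasurableSet A},
    MeasurableSpace.comap (fun ω => (pts ω ∩ (A.1 ∩ U)).encard) inferInstance

theorem measurable_count_countSigma {Ω : Type*} (pts : Ω → Set (ℝ × ℝ)) {A U : Set (ℝ × ℝ)}
    (hA : MeasurableSet A) (hAU : A ⊆ U) :
    Measurable[countSigma pts U] fun ω => (pts ω ∩ A).encard := by
  rw [measurable_iff_comap_le]
  refine le_iSup_of_le (⟨A, hA⟩ : {A : Set (ℝ × ℝ) // MeasurableSet A}) ?_
  rw [inter_eq_left.2 hAU]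

theorem measurableSet_countSigma {Ω : Type*} (pts : Ω → Set (ℝ × ℝ)) {A U : Set (ℝ × ℝ)}
    (hA : MeasurableSet A) (hAU : A ⊆ U) (s : Set ℕ∞) :
    MeasurableSet[countSigma pts U] {ω | (pts ω ∩ A).encard ∈ s} :=
  measurable_count_countSigma pts hA hAU (MeasurableSet.of_discrete (s := s))

theorem countSigma_mono {Ω : Type*} (pts : Ω → Set (ℝ × ℝ)) {U V : Set (ℝ × ℝ)}
    (hU : MeasurableSet U) (hUV : U ⊆ V) : countSigma pts U ≤ countSigma pts V := by
  refine iSup_le fun A => ?_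
  rw [← measurable_iff_comap_le]
  exact measurable_count_countSigma pts (A.2.inter hU) (inter_subset_right.trans hUV)

/-- The atom of the partition of `U` generated by the finite family `s` which consists of the
points belonging to exactly those members of `s` that lie in `σ`. -/
def familyAtom (U : Set (ℝ × ℝ)) (s σ : Finset {A : Set (ℝ × ℝ) // MeasurableSet A}) :
    Set (ℝ × ℝ) :=
  U ∩ {x | ∀ A ∈ s, x ∈ A.1 ↔ A ∈ σ}

theorem measurableSet_familyAtom {U : Set (ℝ × ℝ)} (hU : MeasurableSet U)
    (s σ : Finset {A : Set (ℝ × ℝ) // MeasurableSet A}) : MeasurableSet (familyAtom U s σ) := by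
  refine hU.inter ?_
  have : {x : ℝ × ℝ | ∀ A ∈ s, x ∈ A.1 ↔ A ∈ σ} = ⋂ A ∈ s, {x | x ∈ A.1 ↔ A ∈ σ} := by
    ext x; simp
  rw [this]
  refine Finset.measurableSet_biInter s fun A _ => ?_
  by_cases hA : A ∈ σ
  · simp only [hA, iff_true]; exact A.2
  · simp only [hA, iff_false]; exact A.2.compl

theorem disjoint_familyAtom (U : Set (ℝ × ℝ)) {s σ σ' : Finset {A : Set (ℝ × ℝ) // MeasurableSet A}}
    (hσ : σ ⊆ s) (hσ' : σ' ⊆ s) (hne : σ ≠ σ') :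
    Disjoint (familyAtom U s σ) (familyAtom U s σ') := by
  rw [Set.disjoint_left]
  rintro x ⟨_, hx⟩ ⟨_, hx'⟩
  refine hne (Finset.ext fun A => ⟨fun hA => ?_, fun hA => ?_⟩)
  · exact (hx' A (hσ hA)).1 ((hx A (hσ hA)).2 hA)
  · exact (hx A (hσ' hA)).1 ((hx' A (hσ' hA)).2 hA)

theorem encard_inter_eq_sum_familyAtom (S U : Set (ℝ × ℝ))
    (s : Finset {A : Set (ℝ × ℝ) // MeasurableSet A}) {A : {A : Set (ℝ × ℝ) // MeasurableSet A}}
    (hA : A ∈ s) :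
    (S ∩ (A.1 ∩ U)).encard =
      ∑ σ : {σ : s.powerset // A ∈ σ.1}, (S ∩ familyAtom U s σ.1.1).encard := by
  classical
  rw [← finsum_eq_sum_of_fintype, ← Set.encard_iUnion_of_finite]
  · congr 1
    ext x
    simp only [mem_inter_iff, mem_iUnion, familyAtom, mem_ofPred_eq]
    constructor
    · rintro ⟨hS, hxA, hU⟩
      refine ⟨⟨⟨s.filter fun B => x ∈ B.1, by simp⟩, Finset.mem_filter.2 ⟨hA, hxA⟩⟩, hS, hU, ?_⟩
      intro B hB
      simp [hB]
    · rintro ⟨σ, hS, hU, h⟩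
      exact ⟨hS, (h A hA).2 σ.2, hU⟩
  · intro σ σ' hne
    refine Disjoint.mono inter_subset_right inter_subset_right (disjoint_familyAtom U
      (Finset.mem_powerset.1 σ.1.2) (Finset.mem_powerset.1 σ'.1.2) fun h => hne ?_)
    exact Subtype.ext (Subtype.ext h)

section Poisson

variable {Ω : Type*} [MeasurableSpace Ω] {P : Measure Ω} {pts : Ω → Set (ℝ × ℝ)}
  {ν : Measure (ℝ × ℝ)}

namespace IsPoissonPointProcess

theorem countSigma_le (h : IsPoissonPointProcess P pts ν) {U : Set (ℝ × ℝ)}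
    (hU : MeasurableSet U) : countSigma pts U ≤ ‹MeasurableSpace Ω› :=
  iSup_le fun A => (h.measurable_count _ (A.2.inter hU)).comap_le

/-- The counts of finitely many subsets of `U` and `V` are sums of counts of disjoint atoms, which
are independent by definition. -/
theorem indep_finset (h : IsPoissonPointProcess P pts ν)
    {U V : Set (ℝ × ℝ)} (hU : MeasurableSet U) (hV : MeasurableSet V) (hUV : Disjoint U V)
    (s t : Finset {A : Set (ℝ × ℝ) // MeasurableSet A}) :
    Indep
      (⨆ A ∈ s, MeasurableSpace.comap (fun ω => (pts ω ∩ (A.1 ∩ U)).encard) inferInstance)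
      (⨆ A ∈ t, MeasurableSpace.comap (fun ω => (pts ω ∩ (A.1 ∩ V)).encard) inferInstance) P := by
  classical
  let ι := s.powerset ⊕ t.powerset
  let B : ι → Set (ℝ × ℝ) := Sum.elim (fun σ => familyAtom U s σ.1) (fun σ => familyAtom V t σ.1)
  have hB : ∀ i, MeasurableSet (B i) := by
    rintro (σ | σ)
    · exact measurableSet_familyAtom hU _ _
    · exact measurableSet_familyAtom hV _ _
  have hdisj : Pairwise fun i j => Disjoint (B i) (B j) := by
    rintro (σ | σ) (σ' | σ') hne
    · exact disjoint_familyAtom U (Finset.mem_powerset.1 σ.2) (Finset.mem_powerset.1 σ'.2)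
        fun h => hne (congrArg Sum.inl (Subtype.ext h))
    · exact hUV.mono inter_subset_left inter_subset_left
    · exact hUV.symm.mono inter_subset_left inter_subset_left
    · exact disjoint_familyAtom V (Finset.mem_powerset.1 σ.2) (Finset.mem_powerset.1 σ'.2)
        fun h => hne (congrArg Sum.inr (Subtype.ext h))
  let e := Fintype.equivFin ι
  have hind : iIndepFun (fun (i : ι) ω => (pts ω ∩ B i).encard) P := by
    have := (h.indep_count _ (fun i => B (e.symm i)) (fun i => hB _)
      (fun i j hij => hdisj (e.symm.injective.ne hij))).precomp e.injective
    simpa using this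
  have hle : ∀ i : ι, MeasurableSpace.comap (fun ω => (pts ω ∩ B i).encard) inferInstance ≤
      ‹MeasurableSpace Ω› := fun i => (h.measurable_count _ (hB i)).comap_le
  have key := indep_iSup_of_disjoint hle hind.iIndep
    (S := range Sum.inl) (T := range Sum.inr) (by
      rw [Set.disjoint_left]; rintro _ ⟨x, rfl⟩ ⟨y, hy⟩; cases hy)
  -- each count of the family is a sum of counts of atoms
  have aux : ∀ (W : Set (ℝ × ℝ)) (r : Finset {A : Set (ℝ × ℝ) // MeasurableSet A})
      (m : MeasurableSpace Ω),
      (∀ σ : r.powerset, MeasurableSpace.comap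
        (fun ω => (pts ω ∩ familyAtom W r σ.1).encard) inferInstance ≤ m) →
      (⨆ A ∈ r, MeasurableSpace.comap
        (fun ω => (pts ω ∩ (A.1 ∩ W)).encard) inferInstance) ≤ m := by
    intro W r m hm
    refine iSup₂_le fun A hA => ?_
    rw [← measurable_iff_comap_le]
    simp_rw [fun ω => encard_inter_eq_sum_familyAtom (pts ω) W r hA]
    exact Finset.measurable_fun_sum _ fun σ _ => measurable_iff_comap_le.2 (hm σ.1)
  refine indep_of_indep_of_le_left (indep_of_indep_of_le_right key ?_) ?_
  · exact aux V t _ fun σ => le_iSup₂_of_le (f := fun (i : ι) (_ : i ∈ range Sum.inr) =>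
      MeasurableSpace.comap (fun ω => (pts ω ∩ B i).encard) inferInstance)
      (Sum.inr σ) ⟨σ, rfl⟩ le_rfl
  · exact aux U s _ fun σ => le_iSup₂_of_le (f := fun (i : ι) (_ : i ∈ range Sum.inl) =>
      MeasurableSpace.comap (fun ω => (pts ω ∩ B i).encard) inferInstance)
      (Sum.inl σ) ⟨σ, rfl⟩ le_rfl

/-- The restrictions of a Poisson point process to disjoint sets are independent. -/
theorem indep_countSigma [IsProbabilityMeasure P] (h : IsPoissonPointProcess P pts ν)
    {U V : Set (ℝ × ℝ)} (hU : MeasurableSet U) (hV : MeasurableSet V) (hUV : Disjoint U V) :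
    Indep (countSigma pts U) (countSigma pts V) P := by
  classical
  have hle : ∀ (W : Set (ℝ × ℝ)), MeasurableSet W →
      ∀ s : Finset {A : Set (ℝ × ℝ) // MeasurableSet A},
      (⨆ A ∈ s, MeasurableSpace.comap (fun ω => (pts ω ∩ (A.1 ∩ W)).encard) inferInstance) ≤
        ‹MeasurableSpace Ω› := fun W hW s =>
    iSup₂_le fun A _ => (h.measurable_count _ (A.2.inter hW)).comap_le
  have hdir : ∀ W : Set (ℝ × ℝ), Directed (· ≤ ·)
      fun s : Finset {A : Set (ℝ × ℝ) // MeasurableSet A} =>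
        ⨆ A ∈ s, MeasurableSpace.comap (fun ω => (pts ω ∩ (A.1 ∩ W)).encard) inferInstance :=
    fun W => Monotone.directed_le fun s t hst => biSup_mono fun A hA => Finset.mem_of_subset hst hA
  unfold countSigma
  rw [iSup_eq_iSup_finset]
  refine indep_iSup_of_directed_le (fun s => ?_) (hle U hU) (h.countSigma_le hV) (hdir U)
  rw [iSup_eq_iSup_finset fun A : {A : Set (ℝ × ℝ) // MeasurableSet A} =>
    MeasurableSpace.comap (fun ω => (pts ω ∩ (A.1 ∩ V)).encard) inferInstance]
  exact (indep_iSup_of_directed_le (fun t => (h.indep_finset hU hV hUV s t).symm) (hle V hV)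
    (hle U hU s) (hdir V)).symm

theorem real_encard_eq (h : IsPoissonPointProcess P pts ν) {A : Set (ℝ × ℝ)}
    (hA : MeasurableSet A) (hν : ν A ≠ ∞) (k : ℕ) :
    P.real {ω | (pts ω ∩ A).encard = k} =
      Real.exp (-ν.real A) * ν.real A ^ k / k.factorial := by
  have h1 := congrArg (fun m => m.real {((k : ℕ) : ℕ∞)}) (h.law_count A hA hν)
  rw [map_measureReal_apply (h.measurable_count A hA) .of_discrete,
    map_measureReal_apply (measurable_from_top) .of_discrete] at h1
  have h2 : (fun k : ℕ => (k : ℕ∞)) ⁻¹' {((k : ℕ) : ℕ∞)} = {k} := by ext; simp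
  rw [h2, poissonMeasure_real_singleton] at h1
  exact h1

theorem ae_encard_ne_top (h : IsPoissonPointProcess P pts ν) {A : Set (ℝ × ℝ)}
    (hA : MeasurableSet A) (hν : ν A ≠ ∞) : ∀ᵐ ω ∂P, (pts ω ∩ A).encard ≠ ⊤ := by
  have h1 := congrArg (fun m => m {(⊤ : ℕ∞)}) (h.law_count A hA hν)
  rw [Measure.map_apply (h.measurable_count A hA) .of_discrete,
    Measure.map_apply (measurable_from_top) .of_discrete] at h1
  have h2 : (fun k : ℕ => (k : ℕ∞)) ⁻¹' {(⊤ : ℕ∞)} = ∅ := by ext; simp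
  rw [h2, measure_empty] at h1
  rw [ae_iff]
  simpa [preimage] using h1

theorem real_encard_eq_zero (h : IsPoissonPointProcess P pts ν) {A : Set (ℝ × ℝ)}
    (hA : MeasurableSet A) (hν : ν A ≠ ∞) :
    P.real {ω | (pts ω ∩ A).encard = 0} = Real.exp (-ν.real A) := by
  have := h.real_encard_eq hA hν 0
  simpa using this

theorem real_encard_ne_zero [IsProbabilityMeasure P] (h : IsPoissonPointProcess P pts ν)
    {A : Set (ℝ × ℝ)} (hA : MeasurableSet A) (hν : ν A ≠ ∞) :
    P.real {ω | (pts ω ∩ A).encard ≠ 0} = 1 - Real.exp (-ν.real A) := by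
  rw [← h.real_encard_eq_zero hA hν]
  exact probReal_compl_eq_one_sub (h.measurable_count A hA (MeasurableSet.of_discrete (s := {0})))

theorem real_encard_ne_zero_le [IsProbabilityMeasure P] (h : IsPoissonPointProcess P pts ν)
    {A : Set (ℝ × ℝ)} (hA : MeasurableSet A) (hν : ν A ≠ ∞) :
    P.real {ω | (pts ω ∩ A).encard ≠ 0} ≤ ν.real A := by
  rw [h.real_encard_ne_zero hA hν]
  linarith [Real.one_sub_le_exp_neg (ν.real A)]

theorem real_inter_of_countSigma [IsProbabilityMeasure P] (h : IsPoissonPointProcess P pts ν)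
    {U V : Set (ℝ × ℝ)} (hU : MeasurableSet U) (hV : MeasurableSet V) (hUV : Disjoint U V)
    {E F : Set Ω} (hE : MeasurableSet[countSigma pts U] E)
    (hF : MeasurableSet[countSigma pts V] F) : P.real (E ∩ F) = P.real E * P.real F := by
  have := (Indep_iff _ _ _).1 (h.indep_countSigma hU hV hUV) E F hE hF
  simp only [measureReal_def, this, ENNReal.toReal_mul]

end IsPoissonPointProcess

end Poisson

/-! ### Almost sure regularity of the driving configuration -/

section Dyadic

theorem dyadicCell_subset_Iic (k j : ℕ) : dyadicCell k j ⊆ Iic (((j : ℝ) + 1) / 2 ^ k) :=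
  fun _ h => h.2

theorem measurableSet_dyadicCell (k j : ℕ) : MeasurableSet (dyadicCell k j) := measurableSet_Ioc

theorem exists_mem_dyadicCell (k : ℕ) {t : ℝ} (ht : 0 < t) : ∃ j : ℕ, t ∈ dyadicCell k j := by
  have h2 : (0 : ℝ) < 2 ^ k := by positivity
  have hpos : 0 < ⌈t * 2 ^ k⌉₊ := Nat.ceil_pos.2 (by positivity)
  obtain ⟨j, hj⟩ : ∃ j, ⌈t * 2 ^ k⌉₊ = j + 1 := ⟨⌈t * 2 ^ k⌉₊ - 1, by omega⟩
  refine ⟨j, ?_, ?_⟩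
  · rw [div_lt_iff₀ h2]
    exact Nat.lt_ceil.1 (by omega)
  · rw [le_div_iff₀ h2]
    have := Nat.le_ceil (t * 2 ^ k)
    rw [hj] at this
    exact_mod_cast this

theorem dyadicCell_index_lt {k j : ℕ} {t L : ℝ} (h : t ∈ dyadicCell k j) (ht : t ≤ L) :
    (j : ℝ) < L * 2 ^ k := by
  have h2 : (0 : ℝ) < 2 ^ k := by positivity
  have := h.1.trans_le ht
  rwa [div_lt_iff₀ h2] at this

theorem add_one_mem_dyadicCell {k j : ℕ} {t : ℝ} (h : t ∈ dyadicCell k j) :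
    t + 1 ∈ dyadicCell k (j + 2 ^ k) := by
  have h2 : (2 : ℝ) ^ k ≠ 0 := by positivity
  have e1 : ((j + 2 ^ k : ℕ) : ℝ) / 2 ^ k = (j : ℝ) / 2 ^ k + 1 := by
    push_cast; field_simp
  have e2 : (((j + 2 ^ k : ℕ) : ℝ) + 1) / 2 ^ k = ((j : ℝ) + 1) / 2 ^ k + 1 := by
    push_cast; field_simp; ring
  refine ⟨?_, ?_⟩
  · rw [e1]; linarith [h.1]
  · rw [e2]; linarith [h.2]

end Dyadic

theorem IsStairsMeasure.sigmaFinite {μ : Measure ℝ} (h : IsStairsMeasure μ) : SigmaFinite μ := by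
  refine ⟨⟨⟨fun n : ℕ => Iic 0 ∪ Ici (1 / ((n : ℝ) + 1)), fun _ => trivial, fun n => ?_, ?_⟩⟩⟩
  · refine (measure_union_le _ _).trans_lt ?_
    rw [h.carrier, zero_add]
    exact h.finite_tail _ (by positivity)
  · refine eq_univ_of_forall fun x => ?_
    rcases le_or_gt x 0 with hx | hx
    · exact mem_iUnion.2 ⟨0, Or.inl hx⟩
    · obtain ⟨n, hn⟩ := exists_nat_one_div_lt hx
      exact mem_iUnion.2 ⟨n, Or.inr hn.le⟩

theorem IsStairsMeasure.measure_Ioi_ne_top {μ : Measure ℝ} (h : IsStairsMeasure μ) {a : ℝ}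
    (ha : 0 < a) : μ (Ioi a) ≠ ∞ :=
  ((measure_mono Ioi_subset_Ici_self).trans_lt (h.finite_tail a ha)).ne

theorem stairsIntensity_Ioc_prod {μ : Measure ℝ} (h : IsStairsMeasure μ) {s t : ℝ} (hs : 0 ≤ s)
    (B : Set ℝ) :
    stairsIntensity μ (Ioc s t ×ˢ B) = ENNReal.ofReal (t - s) * μ B := by
  have := h.sigmaFinite
  rw [stairsIntensity, Measure.prod_prod, Measure.restrict_apply measurableSet_Ioc,
    inter_eq_left.2 (Ioc_subset_Ioi_self.trans (Ioi_subset_Ioi hs)), Real.volume_Ioc]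

theorem stairsIntensity_Ioc_prod_Ioi_ne_top {μ : Measure ℝ} (h : IsStairsMeasure μ) {s t a : ℝ}
    (hs : 0 ≤ s) (ha : 0 < a) : stairsIntensity μ (Ioc s t ×ˢ Ioi a) ≠ ∞ := by
  rw [stairsIntensity_Ioc_prod h hs]
  exact ENNReal.mul_ne_top ENNReal.ofReal_ne_top (h.measure_Ioi_ne_top ha)

theorem stairsIntensity_real_Ioc_prod {μ : Measure ℝ} (h : IsStairsMeasure μ) {s t : ℝ}
    (hs : 0 ≤ s) (hst : s ≤ t) (B : Set ℝ) :
    (stairsIntensity μ).real (Ioc s t ×ˢ B) = (t - s) * μ.real B := by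
  rw [measureReal_def, stairsIntensity_Ioc_prod h hs, ENNReal.toReal_mul,
    ENNReal.toReal_ofReal (by linarith), measureReal_def]

theorem stairsIntensity_real_dyadicCell_prod {μ : Measure ℝ} (h : IsStairsMeasure μ) (k j : ℕ)
    (B : Set ℝ) :
    (stairsIntensity μ).real (dyadicCell k j ×ˢ B) = μ.real B / 2 ^ k := by
  rw [dyadicCell, stairsIntensity_real_Ioc_prod h (by positivity) (by gcongr; linarith)]
  ring

/-- The almost sure properties of the driving Poisson configuration which the pathwise arguments
use. Two points at time distance exactly `1` would count together in the stairs recursion; the last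
property ensures that `τ₁ = 1` as soon as the path vanishes at time `1`. -/
structure IsRegularConfig (S : Set (ℝ × ℝ)) : Prop where
  locallyFinite : IsLocallyFiniteConfig S
  no_unit_gap : ∀ t, 0 < markAt S t → markAt S (t + 1) = 0
  after_one : stairs (markAt S) 1 = 0 → ∃ δ : ℝ, 0 < δ ∧ ∀ v, 1 < v → v ≤ 1 + δ → markAt S v = 0

section AlmostSure

variable {Ω : Type*} [MeasurableSpace Ω] {P : Measure Ω} {pts : Ω → Set (ℝ × ℝ)}
  {μ : Measure ℝ}

theorem measurableSet_strip (s : ℝ) : MeasurableSet (Iic s ×ˢ (univ : Set ℝ)) :=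
  measurableSet_Iic.prod MeasurableSet.univ

theorem disjoint_strip (s : ℝ) : Disjoint (Iic s ×ˢ (univ : Set ℝ)) (Ioi s ×ˢ univ) := by
  rw [Set.disjoint_left]
  rintro x hx hx'
  exact not_le.2 (mem_Ioi.1 hx'.1) (mem_Iic.1 hx.1)

theorem encard_inter_ne_zero {S A : Set (ℝ × ℝ)} : (S ∩ A).encard ≠ 0 ↔ ∃ p ∈ S, p ∈ A := by
  rw [Set.encard_ne_zero]; rfl

namespace IsPoissonPointProcess

/-- The numbers of points in a time strip and after it are independent. -/
theorem real_inter_of_strip [IsProbabilityMeasure P]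
    (h : IsPoissonPointProcess P pts (stairsIntensity μ)) (s : ℝ) {E F : Set Ω}
    (hE : MeasurableSet[countSigma pts (Iic s ×ˢ univ)] E)
    (hF : MeasurableSet[countSigma pts (Ioi s ×ˢ univ)] F) :
    P.real (E ∩ F) = P.real E * P.real F :=
  h.real_inter_of_countSigma (measurableSet_strip s) (measurableSet_Ioi.prod MeasurableSet.univ)
    (disjoint_strip s) hE hF

theorem real_dyadicCell_ne_zero_le [IsProbabilityMeasure P]
    (h : IsPoissonPointProcess P pts (stairsIntensity μ)) (hμ : IsStairsMeasure μ) {a : ℝ}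
    (ha : 0 < a) (k j : ℕ) :
    P.real {ω | (pts ω ∩ (dyadicCell k j ×ˢ Ioi a)).encard ≠ 0} ≤ μ.real (Ioi a) / 2 ^ k := by
  rw [← stairsIntensity_real_dyadicCell_prod hμ k j]
  exact h.real_encard_ne_zero_le ((measurableSet_dyadicCell k j).prod measurableSet_Ioi)
    (stairsIntensity_Ioc_prod_Ioi_ne_top hμ (by positivity) ha)

theorem real_two_dyadicCells_le [IsProbabilityMeasure P]
    (h : IsPoissonPointProcess P pts (stairsIntensity μ)) (hμ : IsStairsMeasure μ) {a : ℝ}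
    (ha : 0 < a) (k : ℕ) {i j : ℕ} (hij : i < j) :
    P.real ({ω | (pts ω ∩ (dyadicCell k i ×ˢ Ioi a)).encard ≠ 0} ∩
      {ω | (pts ω ∩ (dyadicCell k j ×ˢ Ioi a)).encard ≠ 0}) ≤ (μ.real (Ioi a) / 2 ^ k) ^ 2 := by
  have hle : ((i : ℝ) + 1) / 2 ^ k ≤ (j : ℝ) / 2 ^ k := by
    gcongr
    exact_mod_cast hij
  rw [h.real_inter_of_strip (((i : ℝ) + 1) / 2 ^ k), sq]
  · exact mul_le_mul (h.real_dyadicCell_ne_zero_le hμ ha k i)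
      (h.real_dyadicCell_ne_zero_le hμ ha k j) measureReal_nonneg (by positivity)
  · exact measurableSet_countSigma pts ((measurableSet_dyadicCell k i).prod measurableSet_Ioi)
      (prod_mono (dyadicCell_subset_Iic k i) (subset_univ _)) {0}ᶜ
  · exact measurableSet_countSigma pts ((measurableSet_dyadicCell k j).prod measurableSet_Ioi)
      (prod_mono (fun t ht => hle.trans_lt ht.1) (subset_univ _)) {0}ᶜ

theorem ae_isLocallyFiniteConfig (h : IsPoissonPointProcess P pts (stairsIntensity μ))
    (hμ : IsStairsMeasure μ) : ∀ᵐ ω ∂P, IsLocallyFiniteConfig (pts ω) := by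
  have h1 : ∀ n m : ℕ, ∀ᵐ ω ∂P,
      (pts ω ∩ (Ioc 0 (m : ℝ) ×ˢ Ioi (1 / ((n : ℝ) + 1)))).encard ≠ ⊤ := fun n m =>
    h.ae_encard_ne_top (measurableSet_Ioc.prod measurableSet_Ioi)
      (stairsIntensity_Ioc_prod_Ioi_ne_top hμ le_rfl (by positivity))
  filter_upwards [ae_all_iff.2 fun n => ae_all_iff.2 (h1 n)] with ω hω
  refine ⟨h.subset_quadrant ω, fun a ha L => ?_⟩
  obtain ⟨n, hn⟩ := exists_nat_one_div_lt ha
  obtain ⟨m, hm⟩ := exists_nat_ge L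
  refine (encard_ne_top_iff.1 (hω n m)).subset (inter_subset_inter_right _ (prod_mono ?_ ?_))
  · exact Ioc_subset_Ioc_right hm
  · exact Ioi_subset_Ioi hn.le

/-- The number of pairs of dyadic cells at distance `1` is of order `2 ^ k`, and both cells of a
pair contain marks larger than `a` with probability of order `4 ^ (-k)`. -/
theorem ae_no_unit_gap [IsProbabilityMeasure P]
    (h : IsPoissonPointProcess P pts (stairsIntensity μ)) (hμ : IsStairsMeasure μ) {a : ℝ}
    (ha : 0 < a) (L : ℕ) :
    ∀ᵐ ω ∂P, ¬ ∃ t x y : ℝ, t ≤ L ∧ a < x ∧ a < y ∧ (t, x) ∈ pts ω ∧ (t + 1, y) ∈ pts ω := by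
  set E := {ω | ∃ t x y : ℝ, t ≤ L ∧ a < x ∧ a < y ∧ (t, x) ∈ pts ω ∧ (t + 1, y) ∈ pts ω}
    with hE
  suffices hP : P.real E = 0 by
    rw [measureReal_eq_zero_iff] at hP
    rw [ae_iff]
    simpa only [not_not] using hP
  have hbound : ∀ k : ℕ, P.real E ≤ L * μ.real (Ioi a) ^ 2 * (1 / 2) ^ k := by
    intro k
    have hsub : E ⊆ ⋃ j ∈ Finset.range (L * 2 ^ k),
        ({ω | (pts ω ∩ (dyadicCell k j ×ˢ Ioi a)).encard ≠ 0} ∩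
          {ω | (pts ω ∩ (dyadicCell k (j + 2 ^ k) ×ˢ Ioi a)).encard ≠ 0}) := by
      rintro ω ⟨t, x, y, htL, hx, hy, hxS, hyS⟩
      obtain ⟨j, hj⟩ := exists_mem_dyadicCell k (h.subset_quadrant ω hxS).1
      have hjL : j < L * 2 ^ k := by exact_mod_cast dyadicCell_index_lt hj htL
      refine mem_iUnion₂.2 ⟨j, Finset.mem_range.2 hjL, ?_, ?_⟩
      · exact encard_inter_ne_zero.2 ⟨_, hxS, hj, hx⟩
      · exact encard_inter_ne_zero.2 ⟨_, hyS, add_one_mem_dyadicCell hj, hy⟩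
    calc P.real E ≤ _ := measureReal_mono hsub (measure_ne_top _ _)
      _ ≤ ∑ j ∈ Finset.range (L * 2 ^ k), _ := measureReal_biUnion_finset_le _ _
      _ ≤ ∑ j ∈ Finset.range (L * 2 ^ k), (μ.real (Ioi a) / 2 ^ k) ^ 2 :=
          Finset.sum_le_sum fun j _ => h.real_two_dyadicCells_le hμ ha k (by
            have := Nat.one_le_two_pow (n := k); omega)
      _ = _ := by
          rw [Finset.sum_const, Finset.card_range, nsmul_eq_mul]
          push_cast
          rw [one_div_pow]
          field_simp
  have hlim : Tendsto (fun k : ℕ => L * μ.real (Ioi a) ^ 2 * (1 / 2 : ℝ) ^ k) atTop (𝓝 0) := by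
    simpa using (tendsto_pow_atTop_nhds_zero_of_lt_one (r := (1 / 2 : ℝ)) (by norm_num)
      (by norm_num)).const_mul (L * μ.real (Ioi a) ^ 2)
  exact le_antisymm (ge_of_tendsto' hlim hbound) measureReal_nonneg

theorem ae_after_one (h : IsPoissonPointProcess P pts (stairsIntensity μ))
    (hμ : IsStairsMeasure μ) :
    ∀ᵐ ω ∂P, stairs (markAt (pts ω)) 1 = 0 →
      ∃ δ : ℝ, 0 < δ ∧ ∀ v, 1 < v → v ≤ 1 + δ → markAt (pts ω) v = 0 := by
  by_cases hfin : μ (Ioi 0) = ∞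
  · -- infinitely many points up to time `1`, hence a positive value there
    have h1 := h.count_eq_top (Ioc 0 1 ×ˢ Ioi 0) (measurableSet_Ioc.prod measurableSet_Ioi) (by
      rw [stairsIntensity_Ioc_prod hμ le_rfl, hfin]; simp)
    filter_upwards [h1, h.ae_isLocallyFiniteConfig hμ] with ω hω hlf h0
    obtain ⟨p, hp, hpA⟩ := encard_inter_ne_zero.1 (by rw [hω]; simp :
      (pts ω ∩ (Ioc 0 1 ×ˢ Ioi 0)).encard ≠ 0)
    have h2 := hlf.le_markAt (t := p.1) (x := p.2) hp
    have h3 := hlf.isStairsInput.le_stairs hpA.1.2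
    have h4 : 0 < p.2 := hpA.2
    linarith
  · -- finitely many points up to time `2`, hence none just after time `1`
    have h1 := h.ae_encard_ne_top (A := Ioc 0 2 ×ˢ Ioi 0) (measurableSet_Ioc.prod measurableSet_Ioi)
      (by
        rw [stairsIntensity_Ioc_prod hμ le_rfl]
        exact ENNReal.mul_ne_top ENNReal.ofReal_ne_top hfin)
    filter_upwards [h1, h.ae_isLocallyFiniteConfig hμ] with ω hω hlf _
    have hf : ((Prod.fst '' (pts ω ∩ (Ioc 0 2 ×ˢ Ioi 0))) ∩ Ioi 1).Finite :=
      ((encard_ne_top_iff.1 hω).image _).inter_of_left _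
    have hev : ∀ᶠ v in 𝓝[>] (1 : ℝ), v ∉ (Prod.fst '' (pts ω ∩ (Ioc 0 2 ×ˢ Ioi 0))) ∩ Ioi 1 :=
      nhdsWithin_le_nhds (hf.isClosed.isOpen_compl.mem_nhds (by simp))
    obtain ⟨u, hu, hu'⟩ := (mem_nhdsGT_iff_exists_Ioc_subset).1 hev
    have m1 := min_le_left (u - 1) 1
    have m2 := min_le_right (u - 1) 1
    refine ⟨min (u - 1) 1, lt_min (sub_pos.2 hu) one_pos, fun v hv hv' => ?_⟩
    by_contra hcon
    have hpos : 0 < markAt (pts ω) v :=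
      lt_of_le_of_ne (hlf.isStairsInput.nonneg v) (Ne.symm hcon)
    obtain ⟨x, hx, hxS⟩ := (hlf.lt_markAt_iff le_rfl).1 hpos
    exact hu' ⟨hv, by linarith⟩
      ⟨⟨(v, x), ⟨hxS, ⟨by simp only; linarith, by simp only; linarith⟩, hx⟩, rfl⟩, hv⟩

theorem ae_isRegularConfig [IsProbabilityMeasure P]
    (h : IsPoissonPointProcess P pts (stairsIntensity μ)) (hμ : IsStairsMeasure μ) :
    ∀ᵐ ω ∂P, IsRegularConfig (pts ω) := by
  have h1 := ae_all_iff.2 fun n : ℕ => ae_all_iff.2 fun L : ℕ =>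
    h.ae_no_unit_gap hμ (a := 1 / ((n : ℝ) + 1)) (by positivity) L
  filter_upwards [h.ae_isLocallyFiniteConfig hμ, h1, h.ae_after_one hμ] with ω hlf hgap hone
  refine ⟨hlf, fun t ht => ?_, hone⟩
  by_contra hcon
  have hpos : 0 < markAt (pts ω) (t + 1) :=
    lt_of_le_of_ne (hlf.isStairsInput.nonneg _) (Ne.symm hcon)
  obtain ⟨x, hx, hxS⟩ := (hlf.lt_markAt_iff le_rfl).1 ht
  obtain ⟨y, hy, hyS⟩ := (hlf.lt_markAt_iff le_rfl).1 hpos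
  obtain ⟨n, hn⟩ := exists_nat_one_div_lt (lt_min hx hy)
  obtain ⟨L, hL⟩ := exists_nat_ge t
  exact hgap n L ⟨t, x, y, hL, hn.trans_le (min_le_left _ _), hn.trans_le (min_le_right _ _),
    hxS, hyS⟩

end IsPoissonPointProcess

end AlmostSure

/-! ### Exponential tails of the first regeneration time -/

/-- Exactly one mark larger than `2` in the middle unit cell of the time block `(3k, 3k + 3]`, and
no other mark larger than `1` in this block. -/
def dominantEvent {Ω : Type*} (pts : Ω → Set (ℝ × ℝ)) (k : ℕ) : Set Ω :=
  {ω | (pts ω ∩ (Ioc (3 * k + 1 : ℝ) (3 * k + 2) ×ˢ Ioi 2)).encard = 1} ∩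
    {ω | (pts ω ∩ ((Ioc (3 * k : ℝ) (3 * k + 3) ×ˢ Ioi 1) \
      (Ioc (3 * k + 1 : ℝ) (3 * k + 2) ×ˢ Ioi 2))).encard = 0}

/-- The probability `T(2) exp (-3 T(1))` of `dominantEvent`, where `T` is the tail of `μ`. -/
noncomputable def dominantProb (μ : Measure ℝ) : ℝ :=
  μ.real (Ioi 2) * Real.exp (-(3 * μ.real (Ioi 1)))

theorem dominant_subset (k : ℕ) :
    Ioc (3 * k + 1 : ℝ) (3 * k + 2) ×ˢ Ioi (2 : ℝ) ⊆ Ioc (3 * k : ℝ) (3 * k + 3) ×ˢ Ioi (1 : ℝ) :=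
  prod_mono (Ioc_subset_Ioc (by linarith) (by linarith)) (Ioi_subset_Ioi one_le_two)

theorem measurableSet_dominantEvent {Ω : Type*} (pts : Ω → Set (ℝ × ℝ)) (k : ℕ)
    {U : Set (ℝ × ℝ)} (hU : Ioc (3 * k : ℝ) (3 * k + 3) ×ˢ Ioi (1 : ℝ) ⊆ U) :
    MeasurableSet[countSigma pts U] (dominantEvent pts k) :=
  @MeasurableSet.inter _ (countSigma pts U) _ _
    (measurableSet_countSigma pts (measurableSet_Ioc.prod measurableSet_Ioi)
      ((dominant_subset k).trans hU) {1})
    (measurableSet_countSigma pts ((measurableSet_Ioc.prod measurableSet_Ioi).diff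
      (measurableSet_Ioc.prod measurableSet_Ioi)) (sdiff_subset.trans hU) {0})

theorem IsRegularConfig.exists_regen_of_dominant {Ω : Type*} {pts : Ω → Set (ℝ × ℝ)} {ω : Ω}
    (hω : IsRegularConfig (pts ω)) {k : ℕ} (hk : ω ∈ dominantEvent pts k) :
    ∃ t ∈ regenSet (stairsPath pts ω) 0, t ≤ 3 * k + 3 := by
  obtain ⟨hA, hB⟩ := hk
  obtain ⟨⟨u, x⟩, hux⟩ := encard_eq_one.1 hA
  have hlf := hω.locallyFinite
  have hu : (u, x) ∈ pts ω ∩ (Ioc (3 * k + 1 : ℝ) (3 * k + 2) ×ˢ Ioi 2) := by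
    rw [hux]; rfl
  have hu1 : 3 * (k : ℝ) + 1 < u := hu.2.1.1
  have hu2 : u ≤ 3 * (k : ℝ) + 2 := hu.2.1.2
  have hx2 : 2 < x := hu.2.2
  have hk0 : (0 : ℝ) ≤ k := Nat.cast_nonneg k
  have hmark := hlf.le_markAt hu.1
  refine ⟨u + 1, ⟨by linarith, ?_⟩, by linarith⟩
  rw [add_sub_cancel_right]
  refine hlf.isStairsInput.stairs_add_one_eq_of_dominant zero_le_one (by linarith)
    (fun v hv hv' hne => ?_) (hω.no_unit_gap u (by linarith))
  by_contra hcon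
  obtain ⟨y, hy, hyS⟩ := (hlf.lt_markAt_iff zero_le_one).1 (not_le.1 hcon)
  have hmem : (v, y) ∈ Ioc (3 * k : ℝ) (3 * k + 3) ×ˢ Ioi (1 : ℝ) :=
    ⟨⟨by simp only; linarith, by simp only; linarith⟩, hy⟩
  by_cases hvA : (v, y) ∈ Ioc (3 * k + 1 : ℝ) (3 * k + 2) ×ˢ Ioi (2 : ℝ)
  · have : (v, y) ∈ ({(u, x)} : Set (ℝ × ℝ)) := hux ▸ ⟨hyS, hvA⟩
    exact hne (congrArg Prod.fst (mem_singleton_iff.1 this))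
  · have hne0 : (pts ω ∩ ((Ioc (3 * k : ℝ) (3 * k + 3) ×ˢ Ioi 1) \
        (Ioc (3 * k + 1 : ℝ) (3 * k + 2) ×ˢ Ioi 2))).encard ≠ 0 :=
      encard_inter_ne_zero.2 ⟨(v, y), hyS, hmem, hvA⟩
    exact hne0 hB

section Regen

variable {Ω : Type*} [MeasurableSpace Ω] {P : Measure Ω} {pts : Ω → Set (ℝ × ℝ)}
  {μ : Measure ℝ}

namespace IsPoissonPointProcess

theorem real_dominantEvent [IsProbabilityMeasure P]
    (h : IsPoissonPointProcess P pts (stairsIntensity μ)) (hμ : IsStairsMeasure μ) (k : ℕ) :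
    P.real (dominantEvent pts k) = dominantProb μ := by
  set A := Ioc (3 * k + 1 : ℝ) (3 * k + 2) ×ˢ Ioi (2 : ℝ) with hA
  set C := Ioc (3 * k : ℝ) (3 * k + 3) ×ˢ Ioi (1 : ℝ) with hC
  have mA : MeasurableSet A := measurableSet_Ioc.prod measurableSet_Ioi
  have mC : MeasurableSet C := measurableSet_Ioc.prod measurableSet_Ioi
  have fA : stairsIntensity μ A ≠ ∞ :=
    stairsIntensity_Ioc_prod_Ioi_ne_top hμ (by positivity) two_pos
  have fC : stairsIntensity μ C ≠ ∞ :=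
    stairsIntensity_Ioc_prod_Ioi_ne_top hμ (by positivity) one_pos
  have rA : (stairsIntensity μ).real A = μ.real (Ioi 2) := by
    rw [hA, stairsIntensity_real_Ioc_prod hμ (by positivity) (by linarith)]; ring
  have rC : (stairsIntensity μ).real C = 3 * μ.real (Ioi 1) := by
    rw [hC, stairsIntensity_real_Ioc_prod hμ (by positivity) (by linarith)]; ring
  have rCA : (stairsIntensity μ).real (C \ A) = 3 * μ.real (Ioi 1) - μ.real (Ioi 2) := by
    rw [measureReal_sdiff (dominant_subset k) mA fC, rA, rC]
  have fCA : stairsIntensity μ (C \ A) ≠ ∞ := measure_ne_top_of_subset sdiff_subset fC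
  refine (h.real_inter_of_countSigma mA (mC.diff mA) disjoint_sdiff_right
    (measurableSet_countSigma pts mA subset_rfl {1})
    (measurableSet_countSigma pts (mC.diff mA) subset_rfl {0})).trans ?_
  change P.real {ω | (pts ω ∩ A).encard = 1} * P.real {ω | (pts ω ∩ (C \ A)).encard = 0} = _
  rw [h.real_encard_eq_zero (mC.diff mA) fCA]
  have h1 := h.real_encard_eq mA fA 1
  simp only [Nat.cast_one, pow_one, Nat.factorial_one, div_one] at h1
  rw [h1, rA, rCA, dominantProb, mul_comm (Real.exp _), mul_assoc, ← Real.exp_add]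
  congr 2
  ring

theorem real_iInter_compl_dominantEvent [IsProbabilityMeasure P]
    (h : IsPoissonPointProcess P pts (stairsIntensity μ)) (hμ : IsStairsMeasure μ) (n : ℕ) :
    P.real (⋂ k ∈ Finset.range n, (dominantEvent pts k)ᶜ) = (1 - dominantProb μ) ^ n := by
  induction n with
  | zero => simp
  | succ n ih =>
    have hn : MeasurableSet[countSigma pts (Ioi (3 * n : ℝ) ×ˢ univ)] (dominantEvent pts n) :=
      measurableSet_dominantEvent pts n (prod_mono Ioc_subset_Ioi_self (subset_univ _))
    rw [Finset.range_add_one, Finset.set_biInter_insert, inter_comm,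
      h.real_inter_of_strip (3 * n : ℝ) ?_ (@MeasurableSet.compl _ _ (_) hn), ih, pow_succ,
      probReal_compl_eq_one_sub ((h.countSigma_le (measurableSet_Ioi.prod .univ)) _ hn),
      h.real_dominantEvent hμ]
    refine @Finset.measurableSet_biInter _ _ (_) _ _ fun k hk => @MeasurableSet.compl _ _ (_) ?_
    refine measurableSet_dominantEvent pts k (prod_mono ?_ (subset_univ _))
    refine Ioc_subset_Iic_self.trans (Iic_subset_Iic.2 ?_)
    have : ((k + 1 : ℕ) : ℝ) ≤ n := by exact_mod_cast Finset.mem_range.1 hk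
    push_cast at this
    linarith

/-- Every block of three time units makes a regeneration happen with probability at least
`dominantProb μ`, independently of the others. -/
theorem real_regen_tail_le [IsProbabilityMeasure P]
    (h : IsPoissonPointProcess P pts (stairsIntensity μ)) (hμ : IsStairsMeasure μ) (n : ℕ) :
    P.real {ω | ¬ ∃ t ∈ regenSet (stairsPath pts ω) 0, t ≤ 3 * n} ≤ (1 - dominantProb μ) ^ n := by
  rw [← h.real_iInter_compl_dominantEvent hμ n, measureReal_def, measureReal_def]
  refine ENNReal.toReal_mono (measure_ne_top _ _) (measure_mono_ae ?_)
  filter_upwards [h.ae_isRegularConfig hμ] with ω hω hno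
  refine mem_iInter₂.2 fun k hk hdom => hno ?_
  obtain ⟨t, ht, htk⟩ := hω.exists_regen_of_dominant hdom
  have : ((k + 1 : ℕ) : ℝ) ≤ n := by exact_mod_cast Finset.mem_range.1 hk
  push_cast at this
  exact ⟨t, ht, by linarith⟩

theorem dominantProb_le_one [IsProbabilityMeasure P]
    (h : IsPoissonPointProcess P pts (stairsIntensity μ)) (hμ : IsStairsMeasure μ) :
    dominantProb μ ≤ 1 := by
  rw [← h.real_dominantEvent hμ 0]
  exact measureReal_le_one

theorem ae_regenSet_nonempty [IsProbabilityMeasure P]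
    (h : IsPoissonPointProcess P pts (stairsIntensity μ)) (hμ : IsStairsMeasure μ)
    (hp : 0 < dominantProb μ) : ∀ᵐ ω ∂P, (regenSet (stairsPath pts ω) 0).Nonempty := by
  suffices hP : P.real {ω | ¬ (regenSet (stairsPath pts ω) 0).Nonempty} = 0 by
    rwa [measureReal_eq_zero_iff] at hP
  refine le_antisymm (ge_of_tendsto' (tendsto_pow_atTop_nhds_zero_of_lt_one
    (sub_nonneg.2 (h.dominantProb_le_one hμ)) (by linarith : 1 - dominantProb μ < 1)) fun n => ?_)
    measureReal_nonneg
  refine (measureReal_mono ?_ (measure_ne_top _ _)).trans (h.real_regen_tail_le hμ n)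
  exact fun ω hω ⟨t, ht, _⟩ => hω ⟨t, ht⟩

theorem real_lt_firstRegen_le [IsProbabilityMeasure P]
    (h : IsPoissonPointProcess P pts (stairsIntensity μ)) (hμ : IsStairsMeasure μ) (n : ℕ) :
    P.real {ω | (3 * n : ℝ) < firstRegen pts ω} ≤ (1 - dominantProb μ) ^ n := by
  refine (measureReal_mono ?_ (measure_ne_top _ _)).trans (h.real_regen_tail_le hμ n)
  rintro ω hω ⟨t, ht, htn⟩
  have ht1 : 1 < t := by have := ht.1; linarith
  exact absurd (IsStairsInput.sInf_regenSet_le ht1 ht.2) (not_le.2 (htn.trans_lt hω))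

end IsPoissonPointProcess

end Regen

/-! ### The first regeneration time as a stopping time -/

section Stopping

variable {Ω : Type*} {pts : Ω → Set (ℝ × ℝ)}

theorem measurable_cellMark (pts : Ω → Set (ℝ × ℝ)) (k j : ℕ) :
    Measurable[countSigma pts (Iic (((j : ℝ) + 1) / 2 ^ k) ×ˢ univ)]
      fun ω => cellMark (pts ω) k j := by
  let m := countSigma pts (Iic (((j : ℝ) + 1) / 2 ^ k) ×ˢ univ)
  refine measurable_of_Ioi fun c => ?_
  have : (fun ω => cellMark (pts ω) k j) ⁻¹' Ioi c =
      {ω | (pts ω ∩ (dyadicCell k j ×ˢ {y | c < ENNReal.ofReal y})).encard ∈ ({0}ᶜ : Set ℕ∞)} := by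
    ext ω
    simp only [mem_preimage, mem_Ioi, cellMark, lt_iSup_iff, mem_ofPred_eq, mem_compl_iff,
      mem_singleton_iff]
    rw [← ne_eq, encard_inter_ne_zero]
    constructor
    · rintro ⟨p, ⟨hp, hpc, _⟩, hc⟩
      exact ⟨p, hp, hpc, hc⟩
    · rintro ⟨p, hp, hpc, hc⟩
      exact ⟨p, ⟨hp, hpc, trivial⟩, hc⟩
  rw [this]
  exact measurableSet_countSigma pts ((measurableSet_dyadicCell k j).prod
    (measurableSet_lt measurable_const ENNReal.measurable_ofReal))
    (prod_mono (dyadicCell_subset_Iic k j) (subset_univ _)) _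

theorem countSigma_strip_mono (pts : Ω → Set (ℝ × ℝ)) {s t : ℝ} (hst : s ≤ t) :
    countSigma pts (Iic s ×ˢ univ) ≤ countSigma pts (Iic t ×ˢ univ) :=
  countSigma_mono pts (measurableSet_strip s) (prod_mono (Iic_subset_Iic.2 hst) subset_rfl)

theorem measurable_dyadicStairs (pts : Ω → Set (ℝ × ℝ)) (k j : ℕ) :
    Measurable[countSigma pts (Iic ((j : ℝ) / 2 ^ k) ×ˢ univ)]
      fun ω => dyadicStairs (pts ω) k j := by
  induction j using Nat.strong_induction_on with
  | _ j ih =>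
    cases j with
    | zero => simp_rw [dyadicStairs_zero]; exact measurable_const
    | succ j =>
      simp_rw [dyadicStairs_succ]
      have hle : ∀ i ≤ j, countSigma pts (Iic ((i : ℝ) / 2 ^ k) ×ˢ univ) ≤
          countSigma pts (Iic (((j + 1 : ℕ) : ℝ) / 2 ^ k) ×ˢ univ) := fun i hi => by
        refine countSigma_strip_mono pts ?_
        gcongr
        omega
      have hm := measurable_cellMark pts k j
      rw [← Nat.cast_succ] at hm
      let m := countSigma pts (Iic (((j + 1 : ℕ) : ℝ) / 2 ^ k) ×ˢ univ)
      exact ((ih j (by omega)).mono (hle j le_rfl) le_rfl).max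
        (((ih (j - (2 ^ k - 1)) (by omega)).mono (hle _ (by omega)) le_rfl).add hm)

/-- The limit of the grid approximations of the stairs process at time `i / 2 ^ k`, as an upper
limit, which is measurable and adapted on the whole space. -/
noncomputable def stairsLim (S : Set (ℝ × ℝ)) (k i : ℕ) : ℝ≥0∞ :=
  limsup (fun l => dyadicStairs S (k + l) (i * 2 ^ l)) atTop

theorem IsLocallyFiniteConfig.stairsLim_eq {S : Set (ℝ × ℝ)} (h : IsLocallyFiniteConfig S)
    (k i : ℕ) : stairsLim S k i = ENNReal.ofReal (stairs (markAt S) ((i : ℝ) / 2 ^ k)) :=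
  (h.tendsto_dyadicStairs k i).limsup_eq

theorem measurable_stairsLim (pts : Ω → Set (ℝ × ℝ)) (k i : ℕ) :
    Measurable[countSigma pts (Iic ((i : ℝ) / 2 ^ k) ×ˢ univ)]
      fun ω => stairsLim (pts ω) k i := by
  let m := countSigma pts (Iic ((i : ℝ) / 2 ^ k) ×ˢ univ)
  refine Measurable.limsup fun l => ?_
  have := measurable_dyadicStairs pts (k + l) (i * 2 ^ l)
  have e : ((i * 2 ^ l : ℕ) : ℝ) / 2 ^ (k + l) = (i : ℝ) / 2 ^ k := by
    push_cast
    rw [pow_add]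
    field_simp
  rwa [e] at this

theorem exists_dyadic_btwn {a b : ℝ} (ha : 1 ≤ a) (hab : a < b) :
    ∃ q ∈ {q : ℝ | ∃ l i : ℕ, q = (i : ℝ) / 2 ^ l}, a < q ∧ q < b := by
  obtain ⟨l, hl⟩ := exists_pow_lt_of_lt_one (sub_pos.2 hab) (by norm_num : (1 / 2 : ℝ) < 1)
  have h2 : (0 : ℝ) < 2 ^ l := by positivity
  have h0 : 0 ≤ a * 2 ^ l := by positivity
  refine ⟨((⌊a * 2 ^ l⌋₊ + 1 : ℕ) : ℝ) / 2 ^ l, ⟨l, _, rfl⟩, ?_, ?_⟩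
  · rw [lt_div_iff₀ h2]
    push_cast
    exact Nat.lt_floor_add_one _
  · rw [div_lt_iff₀ h2]
    push_cast
    rw [one_div_pow, div_lt_iff₀ h2, sub_mul] at hl
    linarith [Nat.floor_le h0]

/-- The event `τ₁ ≤ j / 2 ^ k`, expressed through the grid approximations. -/
def regenBefore (pts : Ω → Set (ℝ × ℝ)) (k j : ℕ) : Set Ω :=
  ⋂ n : ℕ, ⋃ l : ℕ, ⋃ i : ℕ, ⋃ _ : 2 ^ l ≤ i ∧ (i : ℝ) / 2 ^ l ≤ (j : ℝ) / 2 ^ k,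
    {ω | stairsLim (pts ω) l i <
      stairsLim (pts ω) l (i - 2 ^ l) + ENNReal.ofReal (1 / ((n : ℝ) + 1))}

theorem measurableSet_regenBefore (pts : Ω → Set (ℝ × ℝ)) (k j : ℕ) :
    MeasurableSet[countSigma pts (Iic ((j : ℝ) / 2 ^ k) ×ˢ univ)] (regenBefore pts k j) := by
  let m := countSigma pts (Iic ((j : ℝ) / 2 ^ k) ×ˢ univ)
  refine MeasurableSet.iInter fun n => MeasurableSet.iUnion fun l =>
    MeasurableSet.iUnion fun i => MeasurableSet.iUnion fun hi => ?_
  have h1 : Measurable[m] fun ω => stairsLim (pts ω) l i :=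
    (measurable_stairsLim pts l i).mono (countSigma_strip_mono pts hi.2) le_rfl
  have h2 : Measurable[m] fun ω => stairsLim (pts ω) l (i - 2 ^ l) := by
    refine (measurable_stairsLim pts l (i - 2 ^ l)).mono (countSigma_strip_mono pts ?_) le_rfl
    refine le_trans ?_ hi.2
    gcongr
    exact Nat.sub_le _ _
  exact measurableSet_lt h1 (h2.add_const _)

theorem IsRegularConfig.mem_regenBefore_iff {ω : Ω} (hω : IsRegularConfig (pts ω))
    (hne : (regenSet (stairsPath pts ω) 0).Nonempty) {k j : ℕ} (hj : 1 ≤ (j : ℝ) / 2 ^ k) :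
    ω ∈ regenBefore pts k j ↔ firstRegen pts ω ≤ (j : ℝ) / 2 ^ k := by
  have hI := hω.locallyFinite.isStairsInput
  have key := hI.sInf_regenSet_le_iff hne hω.after_one
    (Q := {q : ℝ | ∃ l i : ℕ, q = (i : ℝ) / 2 ^ l}) (fun a b ha hab => exists_dyadic_btwn ha hab)
    (s := (j : ℝ) / 2 ^ k) ⟨k, j, rfl⟩ hj
  have hlt : ∀ (l i n : ℕ), 2 ^ l ≤ i → (stairsLim (pts ω) l i <
      stairsLim (pts ω) l (i - 2 ^ l) + ENNReal.ofReal (1 / ((n : ℝ) + 1)) ↔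
      stairs (markAt (pts ω)) ((i : ℝ) / 2 ^ l) <
        stairs (markAt (pts ω)) ((i : ℝ) / 2 ^ l - 1) + 1 / ((n : ℝ) + 1)) := by
    intro l i n hi
    have h2 : (2 : ℝ) ^ l ≠ 0 := by positivity
    have hn : (0 : ℝ) < 1 / ((n : ℝ) + 1) := by positivity
    have e : ((i - 2 ^ l : ℕ) : ℝ) / 2 ^ l = (i : ℝ) / 2 ^ l - 1 := by
      rw [Nat.cast_sub hi]; push_cast; field_simp
    rw [hω.locallyFinite.stairsLim_eq, hω.locallyFinite.stairsLim_eq, e,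
      ← ENNReal.ofReal_add (hI.stairs_nonneg _) hn.le,
      ENNReal.ofReal_lt_ofReal_iff (add_pos_of_nonneg_of_pos (hI.stairs_nonneg _) hn)]
  have hone : ∀ l i : ℕ, 2 ^ l ≤ i ↔ 1 ≤ (i : ℝ) / 2 ^ l := fun l i => by
    rw [le_div_iff₀ (by positivity), one_mul]
    exact_mod_cast Iff.rfl
  refine Iff.trans ?_ key.symm
  simp only [regenBefore, mem_iInter, mem_iUnion, mem_ofPred_eq, exists_prop]
  constructor
  · intro H ε hε
    obtain ⟨n, hn⟩ := exists_nat_one_div_lt hε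
    obtain ⟨l, i, ⟨h1, h2⟩, h3⟩ := H n
    exact ⟨_, ⟨l, i, rfl⟩, (hone l i).1 h1, h2, by linarith [(hlt l i n h1).1 h3]⟩
  · intro H n
    obtain ⟨q, ⟨l, i, rfl⟩, h1, h2, h3⟩ := H (1 / ((n : ℝ) + 1)) (by positivity)
    exact ⟨l, i, ⟨(hone l i).2 h1, h2⟩, (hlt l i n ((hone l i).2 h1)).2 h3⟩

end Stopping

section Regen

variable {Ω : Type*} [MeasurableSpace Ω] {P : Measure Ω} {pts : Ω → Set (ℝ × ℝ)}
  {μ : Measure ℝ}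

namespace IsPoissonPointProcess

/-- `τ₁` is a stopping time at dyadic times, up to null sets. -/
theorem exists_measurableSet_lt_firstRegen [IsProbabilityMeasure P]
    (h : IsPoissonPointProcess P pts (stairsIntensity μ)) (hμ : IsStairsMeasure μ)
    (hp : 0 < dominantProb μ) (k j : ℕ) :
    ∃ B : Set Ω, MeasurableSet[countSigma pts (Iic ((j : ℝ) / 2 ^ k) ×ˢ univ)] B ∧
      B =ᵐ[P] {ω | (j : ℝ) / 2 ^ k < firstRegen pts ω} := by
  rcases lt_or_ge ((j : ℝ) / 2 ^ k) 1 with hj | hj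
  · refine ⟨univ, @MeasurableSet.univ _ (_), ?_⟩
    filter_upwards [h.ae_regenSet_nonempty hμ hp] with ω hne
    exact propext ⟨fun _ => hj.trans_le (IsStairsInput.one_le_sInf_regenSet hne), fun _ => trivial⟩
  · refine ⟨(regenBefore pts k j)ᶜ,
      @MeasurableSet.compl _ _ (_) (measurableSet_regenBefore pts k j), ?_⟩
    filter_upwards [h.ae_regenSet_nonempty hμ hp, h.ae_isRegularConfig hμ] with ω hne hω
    exact propext ((not_congr (hω.mem_regenBefore_iff hne hj)).trans not_le)

theorem nullMeasurableSet_lt_firstRegen [IsProbabilityMeasure P]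
    (h : IsPoissonPointProcess P pts (stairsIntensity μ)) (hμ : IsStairsMeasure μ)
    (hp : 0 < dominantProb μ) (k j : ℕ) :
    NullMeasurableSet {ω | (j : ℝ) / 2 ^ k < firstRegen pts ω} P := by
  obtain ⟨B, hB, hB'⟩ := h.exists_measurableSet_lt_firstRegen hμ hp k j
  exact NullMeasurableSet.congr
    (h.countSigma_le (measurableSet_strip _) _ hB).nullMeasurableSet hB'

end IsPoissonPointProcess

end Regen

/-! ### Measurability and integrability at the first regeneration time -/

theorem tsum_ite_natCast_lt (x : ℝ) :
    ∑' n : ℕ, (if (n : ℝ) < x then (1 : ℝ≥0∞) else 0) = (⌈x⌉₊ : ℝ≥0∞) := by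
  rw [tsum_eq_sum (s := Finset.range ⌈x⌉₊)]
  · rw [Finset.sum_congr rfl fun n hn => if_pos (Nat.lt_ceil.1 (Finset.mem_range.1 hn))]
    simp
  · intro n hn
    exact if_neg fun h => hn (Finset.mem_range.2 (Nat.lt_ceil.2 h))

theorem firstRegen_nonneg {Ω : Type*} (pts : Ω → Set (ℝ × ℝ)) (ω : Ω) : 0 ≤ firstRegen pts ω :=
  Real.sInf_nonneg fun t ht => by
    have h1 : (0 : ℝ) + 1 < t := ht.1
    linarith

theorem IsStairsInput.tendsto_stairs_dyadic_ceil {ξ : ℝ → ℝ} (hI : IsStairsInput ξ) {τ : ℝ}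
    (hτ : 0 ≤ τ) :
    Tendsto (fun k : ℕ => stairs ξ ((⌈τ * 2 ^ k⌉₊ : ℝ) / 2 ^ k)) atTop (𝓝 (stairs ξ τ)) := by
  have hlow : ∀ k : ℕ, τ ≤ (⌈τ * 2 ^ k⌉₊ : ℝ) / 2 ^ k := fun k => by
    rw [le_div_iff₀ (by positivity)]
    exact Nat.le_ceil _
  have hup : ∀ k : ℕ, (⌈τ * 2 ^ k⌉₊ : ℝ) / 2 ^ k ≤ τ + (1 / 2) ^ k := fun k => by
    rw [div_le_iff₀ (by positivity), add_mul, ← mul_pow]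
    norm_num
    exact (Nat.ceil_lt_add_one (by positivity)).le
  refine tendsto_order.2 ⟨fun c hc => Eventually.of_forall fun k =>
    hc.trans_le (hI.stairs_mono (hlow k)), fun c hc => ?_⟩
  obtain ⟨δ, hδ, H⟩ := hI.stairs_right_cont τ (half_pos (sub_pos.2 hc))
  filter_upwards [(tendsto_pow_atTop_nhds_zero_of_lt_one (r := (1 / 2 : ℝ)) (by norm_num)
    (by norm_num)).eventually_lt_const hδ] with k hk
  refine (H _ ((hup k).trans (by linarith))).trans_lt ?_
  linarith

section AtRegen

variable {Ω : Type*} [MeasurableSpace Ω] {P : Measure Ω} {pts : Ω → Set (ℝ × ℝ)}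
  {μ : Measure ℝ}

namespace IsPoissonPointProcess

theorem aemeasurable_firstRegen [IsProbabilityMeasure P]
    (h : IsPoissonPointProcess P pts (stairsIntensity μ)) (hμ : IsStairsMeasure μ)
    (hp : 0 < dominantProb μ) : AEMeasurable (firstRegen pts) P := by
  have hae := h.ae_regenSet_nonempty hμ hp
  have key : ∀ c : ℝ, NullMeasurableSet {ω | c < firstRegen pts ω} P := by
    intro c
    rcases lt_or_ge c 1 with hc | hc
    · refine MeasurableSet.univ.nullMeasurableSet.congr ?_
      filter_upwards [hae] with ω hne
      exact propext ⟨fun _ => hc.trans_le (IsStairsInput.one_le_sInf_regenSet hne),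
        fun _ => trivial⟩
    · have : {ω | c < firstRegen pts ω} = ⋃ k : ℕ, ⋃ j : ℕ, ⋃ _ : c < (j : ℝ) / 2 ^ k,
          {ω | (j : ℝ) / 2 ^ k < firstRegen pts ω} := by
        ext ω
        simp only [mem_ofPred_eq, mem_iUnion, exists_prop]
        constructor
        · intro hlt
          obtain ⟨_, ⟨k, j, rfl⟩, h1, h2⟩ := exists_dyadic_btwn hc hlt
          exact ⟨k, j, h1, h2⟩
        · rintro ⟨k, j, h1, h2⟩
          exact h1.trans h2
      rw [this]
      exact .iUnion fun k => .iUnion fun j => .iUnion fun _ =>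
        h.nullMeasurableSet_lt_firstRegen hμ hp k j
  have hm : Measurable (α := NullMeasurableSpace Ω P) (firstRegen pts) :=
    measurable_of_Ioi fun c => key c
  exact NullMeasurable.aemeasurable fun s hs => hm hs

/-- The path is evaluated at dyadic times decreasing to `τ₁`. -/
theorem aemeasurable_stairsPath_firstRegen [IsProbabilityMeasure P]
    (h : IsPoissonPointProcess P pts (stairsIntensity μ)) (hμ : IsStairsMeasure μ)
    (hp : 0 < dominantProb μ) :
    AEMeasurable (fun ω => stairsPath pts ω (firstRegen pts ω)) P := by
  have hτ := h.aemeasurable_firstRegen hμ hp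
  have hF : ∀ k : ℕ, Measurable fun q : ℕ × Ω => stairsLim (pts q.2) k q.1 := fun k =>
    measurable_from_prod_countable_right fun i =>
      (measurable_stairsLim pts k i).mono (h.countSigma_le (measurableSet_strip _)) le_rfl
  have hceil : ∀ k : ℕ, AEMeasurable (fun ω => ⌈firstRegen pts ω * 2 ^ k⌉₊) P := fun k =>
    Nat.measurable_ceil.comp_aemeasurable (hτ.mul_const _)
  have happrox : ∀ k : ℕ, AEMeasurable
      (fun ω => (stairsLim (pts ω) k ⌈firstRegen pts ω * 2 ^ k⌉₊).toReal) P := by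
    intro k
    have hpair : AEMeasurable (fun ω => (⌈firstRegen pts ω * 2 ^ k⌉₊, ω)) P :=
      (hceil k).prodMk aemeasurable_id
    exact ((hF k).comp_aemeasurable hpair).ennreal_toReal
  refine aemeasurable_of_tendsto_metrizable_ae atTop happrox ?_
  filter_upwards [h.ae_isLocallyFiniteConfig hμ] with ω hω
  have key := hω.isStairsInput.tendsto_stairs_dyadic_ceil (firstRegen_nonneg pts ω)
  refine key.congr fun k => ?_
  rw [hω.stairsLim_eq, ENNReal.toReal_ofReal (hω.isStairsInput.stairs_nonneg _)]

/-- Integrated form of the tail bound for `τ₁`. -/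
theorem lintegral_firstRegen_sub_le [IsProbabilityMeasure P]
    (h : IsPoissonPointProcess P pts (stairsIntensity μ)) (hμ : IsStairsMeasure μ)
    (hp : 0 < dominantProb μ) (l : ℕ) :
    ∫⁻ ω, ENNReal.ofReal (firstRegen pts ω - 3 * l) ∂P ≤
      ENNReal.ofReal (3 * ((1 - dominantProb μ) ^ l / dominantProb μ)) := by
  have hτ := h.aemeasurable_firstRegen hμ hp
  have hq0 : 0 ≤ 1 - dominantProb μ := sub_nonneg.2 (h.dominantProb_le_one hμ)
  have hq1 : 1 - dominantProb μ < 1 := by linarith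
  have hpt : ∀ ω, ENNReal.ofReal (firstRegen pts ω - 3 * l) ≤
      3 * ∑' n : ℕ, {ω | (3 * (l + n : ℕ) : ℝ) < firstRegen pts ω}.indicator
        (fun _ => (1 : ℝ≥0∞)) ω := by
    intro ω
    have e : ∀ n : ℕ, {ω | (3 * (l + n : ℕ) : ℝ) < firstRegen pts ω}.indicator
        (fun _ => (1 : ℝ≥0∞)) ω =
        if (n : ℝ) < (firstRegen pts ω - 3 * l) / 3 then 1 else 0 := by
      intro n
      simp only [indicator_apply, mem_ofPred_eq]
      refine if_congr ?_ rfl rfl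
      rw [lt_div_iff₀ (by norm_num)]
      push_cast
      constructor <;> intro _ <;> linarith
    simp_rw [e]
    rw [tsum_ite_natCast_lt]
    calc ENNReal.ofReal (firstRegen pts ω - 3 * l)
        ≤ ENNReal.ofReal (3 * (⌈(firstRegen pts ω - 3 * l) / 3⌉₊ : ℝ)) := by
          refine ENNReal.ofReal_le_ofReal ?_
          linarith [Nat.le_ceil ((firstRegen pts ω - 3 * l) / 3)]
      _ = _ := by
          rw [ENNReal.ofReal_mul (by norm_num), ENNReal.ofReal_natCast]
          norm_num
  have hnull : ∀ n : ℕ, NullMeasurableSet {ω | (3 * (l + n : ℕ) : ℝ) < firstRegen pts ω} P :=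
    fun n => nullMeasurableSet_lt aemeasurable_const hτ
  calc ∫⁻ ω, ENNReal.ofReal (firstRegen pts ω - 3 * l) ∂P
      ≤ ∫⁻ ω, 3 * ∑' n : ℕ, {ω | (3 * (l + n : ℕ) : ℝ) < firstRegen pts ω}.indicator
        (fun _ => (1 : ℝ≥0∞)) ω ∂P := lintegral_mono hpt
    _ = 3 * ∑' n : ℕ, P {ω | (3 * (l + n : ℕ) : ℝ) < firstRegen pts ω} := by
        rw [lintegral_const_mul' _ _ (by norm_num), lintegral_tsum fun n =>
          (aemeasurable_indicator_const_iff (1 : ℝ≥0∞)).2 (hnull n)]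
        congr 1
        refine tsum_congr fun n => ?_
        rw [lintegral_indicator_const₀ (hnull n), one_mul]
    _ ≤ 3 * ∑' n : ℕ, ENNReal.ofReal ((1 - dominantProb μ) ^ l * (1 - dominantProb μ) ^ n) := by
        gcongr with n
        rw [← ENNReal.ofReal_toReal (measure_ne_top P _), ← pow_add]
        exact ENNReal.ofReal_le_ofReal (h.real_lt_firstRegen_le hμ (l + n))
    _ = _ := by
        rw [← ENNReal.ofReal_tsum_of_nonneg (fun n => by positivity)
          ((summable_geometric_of_lt_one hq0 hq1).mul_left _), tsum_mul_left,
          tsum_geometric_of_lt_one hq0 hq1, ENNReal.ofReal_mul (by norm_num : (0 : ℝ) ≤ 3)]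
        norm_num
        rw [div_eq_mul_inv]

theorem integrable_firstRegen [IsProbabilityMeasure P]
    (h : IsPoissonPointProcess P pts (stairsIntensity μ)) (hμ : IsStairsMeasure μ)
    (hp : 0 < dominantProb μ) : Integrable (firstRegen pts) P := by
  refine ⟨(h.aemeasurable_firstRegen hμ hp).aestronglyMeasurable, ?_⟩
  rw [hasFiniteIntegral_iff_ofReal (Eventually.of_forall (firstRegen_nonneg pts))]
  have := h.lintegral_firstRegen_sub_le hμ hp 0
  simp only [Nat.cast_zero, mul_zero, sub_zero] at this
  exact this.trans_lt ENNReal.ofReal_lt_top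

theorem one_le_integral_firstRegen [IsProbabilityMeasure P]
    (h : IsPoissonPointProcess P pts (stairsIntensity μ)) (hμ : IsStairsMeasure μ)
    (hp : 0 < dominantProb μ) : 1 ≤ ∫ ω, firstRegen pts ω ∂P := by
  have := integral_mono_ae (integrable_const (1 : ℝ)) (h.integrable_firstRegen hμ hp) (by
    filter_upwards [h.ae_regenSet_nonempty hμ hp] with ω hne
    exact IsStairsInput.one_le_sInf_regenSet hne)
  simpa using this

theorem integrable_min_firstRegen [IsProbabilityMeasure P]
    (h : IsPoissonPointProcess P pts (stairsIntensity μ)) (hμ : IsStairsMeasure μ)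
    (hp : 0 < dominantProb μ) {c : ℝ} (hc : 0 ≤ c) :
    Integrable (fun ω => min (firstRegen pts ω) c) P :=
  (h.integrable_firstRegen hμ hp).mono'
    ((h.aemeasurable_firstRegen hμ hp).min aemeasurable_const).aestronglyMeasurable
    (Eventually.of_forall fun ω => by
      rw [Real.norm_of_nonneg (le_min (firstRegen_nonneg pts ω) hc)]
      exact min_le_left _ _)

theorem integral_firstRegen_le_add [IsProbabilityMeasure P]
    (h : IsPoissonPointProcess P pts (stairsIntensity μ)) (hμ : IsStairsMeasure μ)
    (hp : 0 < dominantProb μ) (l : ℕ) :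
    ∫ ω, firstRegen pts ω ∂P ≤ ∫ ω, min (firstRegen pts ω) ((3 * l : ℕ) : ℝ) ∂P +
      3 * ((1 - dominantProb μ) ^ l / dominantProb μ) := by
  have hq0 : 0 ≤ 1 - dominantProb μ := sub_nonneg.2 (h.dominantProb_le_one hμ)
  have hi1 := h.integrable_firstRegen hμ hp
  have hi2 := h.integrable_min_firstRegen hμ hp (c := ((3 * l : ℕ) : ℝ)) (by positivity)
  rw [← sub_le_iff_le_add', ← integral_sub hi1 hi2]
  have hnn : ∀ ω, 0 ≤ firstRegen pts ω - min (firstRegen pts ω) ((3 * l : ℕ) : ℝ) :=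
    fun ω => sub_nonneg.2 (min_le_left _ _)
  rw [integral_eq_lintegral_of_nonneg_ae (Eventually.of_forall hnn)
    (hi1.sub hi2).aestronglyMeasurable]
  refine ENNReal.toReal_le_of_le_ofReal (by positivity) (le_trans (lintegral_mono fun ω => ?_)
    (h.lintegral_firstRegen_sub_le hμ hp l))
  push_cast
  rcases le_total (firstRegen pts ω) (3 * l) with hle | hle
  · rw [min_eq_left hle]; simp
  · rw [min_eq_right hle]

end IsPoissonPointProcess

end AtRegen

/-! ### Large marks up to the first regeneration time -/

/-- There is a point in the `j`-th dyadic time cell of level `k` with mark larger than `z`. -/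
def cellEvent {Ω : Type*} (pts : Ω → Set (ℝ × ℝ)) (z : ℝ) (k j : ℕ) : Set Ω :=
  {ω | (pts ω ∩ (dyadicCell k j ×ˢ Ioi z)).encard ≠ 0}

theorem mem_cellEvent {Ω : Type*} {pts : Ω → Set (ℝ × ℝ)} {z : ℝ} {k j : ℕ} {ω : Ω} :
    ω ∈ cellEvent pts z k j ↔ ∃ p ∈ pts ω, p.1 ∈ dyadicCell k j ∧ z < p.2 :=
  encard_inter_ne_zero

theorem measurableSet_cellEvent_future {Ω : Type*} (pts : Ω → Set (ℝ × ℝ)) (z : ℝ) (k j : ℕ) :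
    MeasurableSet[countSigma pts (Ioi ((j : ℝ) / 2 ^ k) ×ˢ univ)] (cellEvent pts z k j) :=
  measurableSet_countSigma pts ((measurableSet_dyadicCell k j).prod measurableSet_Ioi)
    (prod_mono Ioc_subset_Ioi_self (subset_univ _)) {0}ᶜ

theorem measurableSet_cellEvent_past {Ω : Type*} (pts : Ω → Set (ℝ × ℝ)) (z : ℝ) {k i j : ℕ}
    (hij : i < j) :
    MeasurableSet[countSigma pts (Iic ((j : ℝ) / 2 ^ k) ×ˢ univ)] (cellEvent pts z k i) := by
  refine measurableSet_countSigma pts ((measurableSet_dyadicCell k i).prod measurableSet_Ioi)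
    (prod_mono ((dyadicCell_subset_Iic k i).trans (Iic_subset_Iic.2 ?_)) (subset_univ _)) {0}ᶜ
  gcongr
  exact_mod_cast hij

theorem le_sum_ite_natCast_lt (x : ℝ) (J : ℕ) :
    min x J ≤ ∑ j ∈ Finset.range J, if (j : ℝ) < x then (1 : ℝ) else 0 := by
  have : (Finset.range J).filter (fun j : ℕ => (j : ℝ) < x) = Finset.range (min J ⌈x⌉₊) := by
    ext j
    simp [Nat.lt_ceil]
  rw [← Finset.sum_filter, this]
  simp only [Finset.sum_const, Finset.card_range, nsmul_eq_mul, mul_one]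
  push_cast
  exact le_min (min_le_right _ _) ((min_le_left _ _).trans (Nat.le_ceil x))

/-- Some point with mark larger than `z` lies in a dyadic time cell of level `k`, before time `L`,
which begins before `τ₁`. -/
def bigMarkEvent {Ω : Type*} (pts : Ω → Set (ℝ × ℝ)) (z : ℝ) (L k : ℕ) : Set Ω :=
  ⋃ j ∈ Finset.range (L * 2 ^ k),
    cellEvent pts z k j ∩ {ω | (j : ℝ) / 2 ^ k < firstRegen pts ω}

theorem dyadicCell_succ_subset (k j : ℕ) : dyadicCell (k + 1) j ⊆ dyadicCell k (j / 2) := by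
  have e : ∀ x : ℝ, x / 2 ^ (k + 1) = x / 2 / 2 ^ k := fun x => by rw [pow_succ]; field_simp
  have h1 : ((j / 2 : ℕ) : ℝ) ≤ (j : ℝ) / 2 := Nat.cast_div_le
  have h2 : ((j : ℝ) + 1) / 2 ≤ ((j / 2 : ℕ) : ℝ) + 1 := by
    rw [div_le_iff₀ two_pos]
    have : j + 1 ≤ (j / 2 + 1) * 2 := by omega
    exact_mod_cast this
  refine Ioc_subset_Ioc ?_ ?_
  · rw [e]; gcongr
  · rw [e]; gcongr

theorem bigMarkEvent_antitone {Ω : Type*} (pts : Ω → Set (ℝ × ℝ)) (z : ℝ) (L : ℕ) :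
    Antitone (bigMarkEvent pts z L) := by
  refine antitone_nat_of_succ_le fun k ω hω => ?_
  obtain ⟨j, hj, hA, hB⟩ := mem_iUnion₂.1 hω
  obtain ⟨p, hp, hpc, hpz⟩ := mem_cellEvent.1 hA
  have hj' : j < L * 2 ^ (k + 1) := Finset.mem_range.1 hj
  rw [pow_succ] at hj'
  refine mem_iUnion₂.2 ⟨j / 2, Finset.mem_range.2 (Nat.div_lt_of_lt_mul (by linarith)),
    mem_cellEvent.2 ⟨p, hp, dyadicCell_succ_subset k j hpc, hpz⟩, ?_⟩
  refine lt_of_le_of_lt (b := (j : ℝ) / 2 ^ (k + 1)) ?_ hB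
  have h1 : ((j / 2 : ℕ) : ℝ) ≤ (j : ℝ) / 2 := Nat.cast_div_le
  calc ((j / 2 : ℕ) : ℝ) / 2 ^ k ≤ (j : ℝ) / 2 / 2 ^ k := by gcongr
    _ = (j : ℝ) / 2 ^ (k + 1) := by rw [pow_succ]; field_simp

theorem IsLocallyFiniteConfig.le_stairs_of_mem_bigMarkEvent {Ω : Type*} {pts : Ω → Set (ℝ × ℝ)}
    {ω : Ω} (hω : IsLocallyFiniteConfig (pts ω)) {z : ℝ} {L : ℕ}
    (h : ∀ k, ω ∈ bigMarkEvent pts z L k) : z ≤ stairsPath pts ω (firstRegen pts ω) := by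
  have hI := hω.isStairsInput
  refine le_of_forall_pos_le_add fun a ha => ?_
  obtain ⟨δ, hδ, H⟩ := hI.stairs_right_cont (firstRegen pts ω) ha
  obtain ⟨k, hk⟩ := exists_pow_lt_of_lt_one hδ (by norm_num : (1 / 2 : ℝ) < 1)
  obtain ⟨j, _, hA, hB⟩ := mem_iUnion₂.1 (h k)
  obtain ⟨p, hp, hpc, hpz⟩ := mem_cellEvent.1 hA
  have hB' : (j : ℝ) / 2 ^ k < firstRegen pts ω := hB
  have h1 : p.1 ≤ firstRegen pts ω + δ := by
    refine hpc.2.trans ?_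
    rw [add_div]
    rw [one_div_pow] at hk
    linarith
  have h2 := hω.le_markAt (t := p.1) (x := p.2) hp
  have h3 := hI.le_stairs (le_refl p.1)
  have h4 := H p.1 h1
  change z ≤ stairs (markAt (pts ω)) (firstRegen pts ω) + a
  linarith

theorem sub_sq_le_one_sub_exp_neg {y : ℝ} (hy : 0 ≤ y) : y - y ^ 2 ≤ 1 - Real.exp (-y) := by
  have h1 : Real.exp (-y) ≤ 1 / (1 + y) := by
    rw [Real.exp_neg, ← one_div]
    exact one_div_le_one_div_of_le (by linarith) (by linarith [Real.add_one_le_exp y])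
  have h2 : 1 / (1 + y) ≤ 1 - y + y ^ 2 := by
    rw [div_le_iff₀ (by linarith)]
    nlinarith [pow_nonneg hy 3]
  linarith

section Bounds

variable {Ω : Type*} [MeasurableSpace Ω] {P : Measure Ω} {pts : Ω → Set (ℝ × ℝ)}
  {μ : Measure ℝ}

namespace IsPoissonPointProcess

theorem measurableSet_cellEvent (h : IsPoissonPointProcess P pts (stairsIntensity μ)) (z : ℝ)
    (k j : ℕ) : MeasurableSet (cellEvent pts z k j) :=
  h.countSigma_le (measurableSet_Ioi.prod .univ) _ (measurableSet_cellEvent_future pts z k j)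

/-- Whether `τ₁` exceeds the left end of a cell is decided before this cell. -/
theorem real_cellEvent_inter_lt_firstRegen [IsProbabilityMeasure P]
    (h : IsPoissonPointProcess P pts (stairsIntensity μ)) (hμ : IsStairsMeasure μ)
    (hp : 0 < dominantProb μ) (z : ℝ) (k j : ℕ) :
    P.real (cellEvent pts z k j ∩ {ω | (j : ℝ) / 2 ^ k < firstRegen pts ω}) =
      P.real (cellEvent pts z k j) * P.real {ω | (j : ℝ) / 2 ^ k < firstRegen pts ω} := by
  obtain ⟨B, hB, hB'⟩ := h.exists_measurableSet_lt_firstRegen hμ hp k j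
  rw [← measureReal_congr hB', ← measureReal_congr ((ae_eq_refl _).inter hB'), inter_comm,
    h.real_inter_of_strip _ hB (measurableSet_cellEvent_future pts z k j), mul_comm]

theorem tsum_lt_firstRegen_le [IsProbabilityMeasure P]
    (h : IsPoissonPointProcess P pts (stairsIntensity μ)) (hμ : IsStairsMeasure μ)
    (hp : 0 < dominantProb μ) (k : ℕ) :
    ∑' j : ℕ, P {ω | (j : ℝ) / 2 ^ k < firstRegen pts ω} ≤
      ENNReal.ofReal (2 ^ k * ∫ ω, firstRegen pts ω ∂P + 1) := by
  have hnull := h.nullMeasurableSet_lt_firstRegen hμ hp k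
  have hi := h.integrable_firstRegen hμ hp
  have hpt : ∀ ω, ∑' j : ℕ, {ω | (j : ℝ) / 2 ^ k < firstRegen pts ω}.indicator
      (fun _ => (1 : ℝ≥0∞)) ω ≤ ENNReal.ofReal (2 ^ k * firstRegen pts ω + 1) := by
    intro ω
    have e : ∀ j : ℕ, {ω | (j : ℝ) / 2 ^ k < firstRegen pts ω}.indicator
        (fun _ => (1 : ℝ≥0∞)) ω = if (j : ℝ) < 2 ^ k * firstRegen pts ω then 1 else 0 := by
      intro j
      simp only [indicator_apply, mem_ofPred_eq]
      exact if_congr (div_lt_iff₀' (by positivity)) rfl rfl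
    simp_rw [e]
    rw [tsum_ite_natCast_lt, ← ENNReal.ofReal_natCast]
    exact ENNReal.ofReal_le_ofReal (Nat.ceil_lt_add_one
      (mul_nonneg (by positivity) (firstRegen_nonneg pts ω))).le
  calc ∑' j : ℕ, P {ω | (j : ℝ) / 2 ^ k < firstRegen pts ω}
      = ∫⁻ ω, ∑' j : ℕ, {ω | (j : ℝ) / 2 ^ k < firstRegen pts ω}.indicator
          (fun _ => (1 : ℝ≥0∞)) ω ∂P := by
        rw [lintegral_tsum fun j => (aemeasurable_indicator_const_iff (1 : ℝ≥0∞)).2 (hnull j)]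
        refine tsum_congr fun j => ?_
        rw [lintegral_indicator_const₀ (hnull j), one_mul]
    _ ≤ ∫⁻ ω, ENNReal.ofReal (2 ^ k * firstRegen pts ω + 1) ∂P := lintegral_mono hpt
    _ = _ := by
        have hi' : Integrable (fun ω => 2 ^ k * firstRegen pts ω + 1) P :=
          (hi.const_mul _).add (integrable_const _)
        rw [← ofReal_integral_eq_lintegral_ofReal hi' (Eventually.of_forall fun ω => add_nonneg
            (mul_nonneg (by positivity) (firstRegen_nonneg pts ω)) zero_le_one),
          integral_add (hi.const_mul _) (integrable_const _), integral_const_mul]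
        simp

/-- Wald's identity as an upper bound: the expected number of marks larger than `z` up to the
stopping time `τ₁` is `T(z) E τ₁`. -/
theorem real_exists_mark_le [IsProbabilityMeasure P]
    (h : IsPoissonPointProcess P pts (stairsIntensity μ)) (hμ : IsStairsMeasure μ)
    (hp : 0 < dominantProb μ) {z : ℝ} (hz : 0 < z) :
    P.real {ω | ∃ p ∈ pts ω, p.1 ≤ firstRegen pts ω ∧ z < p.2} ≤
      μ.real (Ioi z) * ∫ ω, firstRegen pts ω ∂P := by
  have hE : 0 ≤ ∫ ω, firstRegen pts ω ∂P := integral_nonneg (firstRegen_nonneg pts)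
  have hbound : ∀ k : ℕ, P.real {ω | ∃ p ∈ pts ω, p.1 ≤ firstRegen pts ω ∧ z < p.2} ≤
      μ.real (Ioi z) * ∫ ω, firstRegen pts ω ∂P + μ.real (Ioi z) * (1 / 2) ^ k := by
    intro k
    have hT : 0 ≤ μ.real (Ioi z) / 2 ^ k := by positivity
    have hsub : {ω | ∃ p ∈ pts ω, p.1 ≤ firstRegen pts ω ∧ z < p.2} ⊆
        ⋃ j : ℕ, cellEvent pts z k j ∩ {ω | (j : ℝ) / 2 ^ k < firstRegen pts ω} := by
      rintro ω ⟨p, hp, hpτ, hpz⟩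
      obtain ⟨j, hj⟩ := exists_mem_dyadicCell k (h.subset_quadrant ω hp).1
      exact mem_iUnion.2 ⟨j, mem_cellEvent.2 ⟨p, hp, hj, hpz⟩, hj.1.trans_le hpτ⟩
    refine ENNReal.toReal_le_of_le_ofReal (by positivity) ?_
    calc P {ω | ∃ p ∈ pts ω, p.1 ≤ firstRegen pts ω ∧ z < p.2}
        ≤ ∑' j : ℕ, P (cellEvent pts z k j ∩ {ω | (j : ℝ) / 2 ^ k < firstRegen pts ω}) :=
          (measure_mono hsub).trans (measure_iUnion_le _)
      _ ≤ ∑' j : ℕ, ENNReal.ofReal (μ.real (Ioi z) / 2 ^ k) *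
            P {ω | (j : ℝ) / 2 ^ k < firstRegen pts ω} := by
          refine ENNReal.tsum_le_tsum fun j => ?_
          rw [← ENNReal.ofReal_toReal (measure_ne_top P (cellEvent pts z k j ∩ _)),
            ← measureReal_def, h.real_cellEvent_inter_lt_firstRegen hμ hp,
            ENNReal.ofReal_mul measureReal_nonneg, ofReal_measureReal (measure_ne_top P _)]
          rw [ofReal_measureReal (measure_ne_top P _),
            ← ofReal_measureReal (measure_ne_top P (cellEvent pts z k j))]
          gcongr
          exact h.real_dyadicCell_ne_zero_le hμ hz k j
      _ ≤ ENNReal.ofReal (μ.real (Ioi z) / 2 ^ k) *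
            ENNReal.ofReal (2 ^ k * ∫ ω, firstRegen pts ω ∂P + 1) := by
          rw [ENNReal.tsum_mul_left]
          gcongr
          exact h.tsum_lt_firstRegen_le hμ hp k
      _ = _ := by
          rw [← ENNReal.ofReal_mul hT]
          congr 1
          rw [one_div_pow]
          field_simp
  have hlim : Tendsto (fun k : ℕ => μ.real (Ioi z) * ∫ ω, firstRegen pts ω ∂P +
      μ.real (Ioi z) * (1 / 2 : ℝ) ^ k) atTop
      (𝓝 (μ.real (Ioi z) * ∫ ω, firstRegen pts ω ∂P + μ.real (Ioi z) * 0)) :=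
    tendsto_const_nhds.add ((tendsto_pow_atTop_nhds_zero_of_lt_one (by norm_num)
      (by norm_num)).const_mul _)
  rw [mul_zero, add_zero] at hlim
  exact ge_of_tendsto' hlim hbound

theorem integral_min_firstRegen_le_sum [IsProbabilityMeasure P]
    (h : IsPoissonPointProcess P pts (stairsIntensity μ)) (hμ : IsStairsMeasure μ)
    (hp : 0 < dominantProb μ) (L k : ℕ) :
    2 ^ k * ∫ ω, min (firstRegen pts ω) (L : ℝ) ∂P ≤
      ∑ j ∈ Finset.range (L * 2 ^ k), P.real {ω | (j : ℝ) / 2 ^ k < firstRegen pts ω} := by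
  have hnull := h.nullMeasurableSet_lt_firstRegen hμ hp k
  have hint : ∀ j : ℕ, Integrable ({ω | (j : ℝ) / 2 ^ k < firstRegen pts ω}.indicator
      (fun _ => (1 : ℝ))) P := fun j => (integrable_const (1 : ℝ)).indicator₀ (hnull j)
  rw [← integral_const_mul]
  have e : ∑ j ∈ Finset.range (L * 2 ^ k), P.real {ω | (j : ℝ) / 2 ^ k < firstRegen pts ω} =
      ∫ ω, ∑ j ∈ Finset.range (L * 2 ^ k),
        {ω | (j : ℝ) / 2 ^ k < firstRegen pts ω}.indicator (fun _ => (1 : ℝ)) ω ∂P := by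
    rw [integral_finsetSum _ fun j _ => hint j]
    refine Finset.sum_congr rfl fun j _ => ?_
    rw [integral_indicator₀ (hnull j)]
    simp
  rw [e]
  refine integral_mono ((h.integrable_min_firstRegen hμ hp (Nat.cast_nonneg L)).const_mul _)
    (integrable_finsetSum _ fun j _ => hint j) fun ω => ?_
  have e2 : ∀ j : ℕ, {ω | (j : ℝ) / 2 ^ k < firstRegen pts ω}.indicator
      (fun _ => (1 : ℝ)) ω = if (j : ℝ) < firstRegen pts ω * 2 ^ k then 1 else 0 := by
    intro j
    simp only [indicator_apply, mem_ofPred_eq]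
    exact if_congr (div_lt_iff₀ (by positivity)) rfl rfl
  simp_rw [e2]
  refine le_trans (le_of_eq ?_) (le_sum_ite_natCast_lt _ _)
  rw [mul_comm, min_mul_of_nonneg _ _ (by positivity)]
  push_cast
  rfl

/-- The events of which the union is taken are made disjoint by looking at the first cell with a
mark larger than `z`; the subtracted term bounds the probability of such a mark in an earlier
cell. -/
theorem real_bigMarkEvent_ge [IsProbabilityMeasure P]
    (h : IsPoissonPointProcess P pts (stairsIntensity μ)) (hμ : IsStairsMeasure μ)
    (hp : 0 < dominantProb μ) {z : ℝ} (hz : 0 < z) (k : ℕ) (J : ℕ) :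
    (1 - Real.exp (-(μ.real (Ioi z) / 2 ^ k))) * ∑ j ∈ Finset.range J,
      (P.real {ω | (j : ℝ) / 2 ^ k < firstRegen pts ω} - j * (μ.real (Ioi z) / 2 ^ k)) ≤
      P.real (⋃ j ∈ Finset.range J,
        cellEvent pts z k j ∩ {ω | (j : ℝ) / 2 ^ k < firstRegen pts ω}) := by
  set T := μ.real (Ioi z) / 2 ^ k with hT
  have hT0 : 0 ≤ T := by positivity
  have hq : ∀ j, P.real (cellEvent pts z k j) = 1 - Real.exp (-T) := fun j => by
    rw [cellEvent, h.real_encard_ne_zero ((measurableSet_dyadicCell k j).prod measurableSet_Ioi)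
      (stairsIntensity_Ioc_prod_Ioi_ne_top hμ (by positivity) hz),
      stairsIntensity_real_dyadicCell_prod hμ]
  have hq0 : 0 ≤ 1 - Real.exp (-T) := by rw [← hq 0]; exact measureReal_nonneg
  have hqT : 1 - Real.exp (-T) ≤ T := by linarith [Real.one_sub_le_exp_neg T]
  choose B hB hB' using h.exists_measurableSet_lt_firstRegen hμ hp k
  have hBm : ∀ j, MeasurableSet (B j) := fun j =>
    h.countSigma_le (measurableSet_strip _) _ (hB j)
  induction J with
  | zero => simp
  | succ J ih =>
    set W := ⋃ j ∈ Finset.range J, cellEvent pts z k j with hW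
    have hWm : MeasurableSet[countSigma pts (Iic ((J : ℝ) / 2 ^ k) ×ˢ univ)] W :=
      @Finset.measurableSet_biUnion _ _ (_) _ _ fun j hj =>
        measurableSet_cellEvent_past pts z (Finset.mem_range.1 hj)
    have hWP : P.real W ≤ J * T := by
      refine (measureReal_biUnion_finset_le _ _).trans ?_
      simp only [hq, Finset.sum_const, Finset.card_range, nsmul_eq_mul]
      gcongr
    -- the first cell with a large mark is the `J`-th one, and it begins before `τ₁`
    have hnew : (1 - Real.exp (-T)) * (P.real {ω | (J : ℝ) / 2 ^ k < firstRegen pts ω} - J * T) ≤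
        P.real (cellEvent pts z k J ∩ (B J \ W)) := by
      rw [inter_comm, h.real_inter_of_strip _ (@MeasurableSet.diff _ (_) _ _ (hB J) hWm)
        (measurableSet_cellEvent_future pts z k J), hq, mul_comm (P.real _)]
      gcongr
      rw [← measureReal_congr (hB' J)]
      have := le_measureReal_sdiff (μ := P) (s₁ := B J) (s₂ := W) (measure_ne_top _ _)
      linarith
    set U := ⋃ j ∈ Finset.range J,
      cellEvent pts z k j ∩ {ω | (j : ℝ) / 2 ^ k < firstRegen pts ω} with hU
    have hUW : U ⊆ W := iUnion₂_mono fun j _ => inter_subset_left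
    rw [Finset.sum_range_succ, mul_add]
    have hdisj : Disjoint U (cellEvent pts z k J ∩ (B J \ W)) :=
      (disjoint_sdiff_right.mono_left hUW).mono_right inter_subset_right
    have hVm : MeasurableSet (cellEvent pts z k J ∩ (B J \ W)) :=
      (h.measurableSet_cellEvent z k J).inter ((hBm J).diff
        (h.countSigma_le (measurableSet_strip _) _ hWm))
    calc _ ≤ P.real U + P.real (cellEvent pts z k J ∩ (B J \ W)) := add_le_add ih hnew
      _ = P.real (U ∪ (cellEvent pts z k J ∩ (B J \ W))) :=
          (measureReal_union hdisj hVm (measure_ne_top _ _) (measure_ne_top _ _)).symm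
      _ ≤ _ := by
          refine ENNReal.toReal_mono (measure_ne_top _ _) (measure_mono_ae ?_)
          filter_upwards [hB' J] with ω hω hmem
          rw [Finset.range_add_one, Finset.set_biUnion_insert]
          rcases hmem with hmem | hmem
          · exact Or.inr hmem
          · exact Or.inl ⟨hmem.1, (iff_of_eq hω).1 hmem.2.1⟩

/-- Lower bound for the tail of the path at `τ₁`, by the probability of a mark larger than `z`
before `τ₁` and `L`; the term `L ^ 2 * T(z) ^ 2` accounts for a second such mark. -/
theorem le_real_stairsPath_firstRegen [IsProbabilityMeasure P]
    (h : IsPoissonPointProcess P pts (stairsIntensity μ)) (hμ : IsStairsMeasure μ)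
    (hp : 0 < dominantProb μ) {z : ℝ} (hz : 0 < z) (L : ℕ) :
    μ.real (Ioi z) * (∫ ω, min (firstRegen pts ω) (L : ℝ) ∂P - L ^ 2 * μ.real (Ioi z)) ≤
      P.real {ω | z ≤ stairsPath pts ω (firstRegen pts ω)} := by
  set T := μ.real (Ioi z) with hT
  have hT0 : 0 ≤ T := measureReal_nonneg
  set e := ∫ ω, min (firstRegen pts ω) (L : ℝ) ∂P - L ^ 2 * T with he
  rcases lt_or_ge e 0 with hneg | hpos
  · exact (mul_nonpos_of_nonneg_of_nonpos hT0 hneg.le).trans measureReal_nonneg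
  have hbound : ∀ k : ℕ, (T - T ^ 2 * (1 / 2) ^ k) * e ≤ P.real (bigMarkEvent pts z L k) := by
    intro k
    have h2 : (0 : ℝ) < 2 ^ k := by positivity
    have hsum : 2 ^ k * e ≤ ∑ j ∈ Finset.range (L * 2 ^ k),
        (P.real {ω | (j : ℝ) / 2 ^ k < firstRegen pts ω} - j * (T / 2 ^ k)) := by
      rw [Finset.sum_sub_distrib]
      have h3 := h.integral_min_firstRegen_le_sum hμ hp L k
      have h4 : ∑ j ∈ Finset.range (L * 2 ^ k), (j : ℝ) * (T / 2 ^ k) ≤ 2 ^ k * (L ^ 2 * T) := by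
        calc ∑ j ∈ Finset.range (L * 2 ^ k), (j : ℝ) * (T / 2 ^ k)
            ≤ ∑ j ∈ Finset.range (L * 2 ^ k), ((L * 2 ^ k : ℕ) : ℝ) * (T / 2 ^ k) := by
              refine Finset.sum_le_sum fun j hj => ?_
              gcongr
              exact (Finset.mem_range.1 hj).le
          _ = _ := by
              rw [Finset.sum_const, Finset.card_range, nsmul_eq_mul]
              push_cast
              field_simp
      rw [he, mul_sub]
      linarith
    refine le_trans ?_ (h.real_bigMarkEvent_ge hμ hp hz k (L * 2 ^ k))
    have hy : 0 ≤ T / 2 ^ k := by positivity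
    have h5 := sub_sq_le_one_sub_exp_neg hy
    have h6 : 0 ≤ 1 - Real.exp (-(T / 2 ^ k)) := by
      rw [sub_nonneg, Real.exp_le_one_iff]; linarith
    calc (T - T ^ 2 * (1 / 2) ^ k) * e = (T / 2 ^ k - (T / 2 ^ k) ^ 2) * (2 ^ k * e) := by
          rw [one_div_pow]; field_simp
      _ ≤ (1 - Real.exp (-(T / 2 ^ k))) * (2 ^ k * e) := by gcongr
      _ ≤ _ := by gcongr
  have hnull : ∀ k, NullMeasurableSet (bigMarkEvent pts z L k) P := fun k =>
    Finset.nullMeasurableSet_biUnion _ fun j _ =>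
      (h.measurableSet_cellEvent z k j).nullMeasurableSet.inter
        (h.nullMeasurableSet_lt_firstRegen hμ hp k j)
  have hlim := tendsto_measure_iInter_atTop hnull (bigMarkEvent_antitone pts z L)
    ⟨0, measure_ne_top P _⟩
  have hlim' := (ENNReal.tendsto_toReal (measure_ne_top P _)).comp hlim
  have hlim2 : Tendsto (fun k : ℕ => (T - T ^ 2 * (1 / 2 : ℝ) ^ k) * e) atTop
      (𝓝 ((T - T ^ 2 * 0) * e)) :=
    (tendsto_const_nhds.sub ((tendsto_pow_atTop_nhds_zero_of_lt_one (by norm_num)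
      (by norm_num)).const_mul _)).mul_const _
  rw [mul_zero, sub_zero] at hlim2
  refine (le_of_tendsto_of_tendsto' hlim2 hlim' hbound).trans ?_
  refine ENNReal.toReal_mono (measure_ne_top _ _) (measure_mono_ae ?_)
  filter_upwards [h.ae_isLocallyFiniteConfig hμ] with ω hω hmem
  exact hω.le_stairs_of_mem_bigMarkEvent fun k => mem_iInter.1 hmem k

/-- A large value of the path at `τ₁` is due to a single mark of about the same size, unless `τ₁`
exceeds `3 l` or there are two unit time cells before `3 l` with a mark larger than `b`. -/
theorem real_stairsPath_firstRegen_le [IsProbabilityMeasure P]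
    (h : IsPoissonPointProcess P pts (stairsIntensity μ)) (hμ : IsStairsMeasure μ)
    (hp : 0 < dominantProb μ) {b z : ℝ} (hb : 0 < b) (hz : 0 < z) (l : ℕ) :
    P.real {ω | 3 * l * b + z < stairsPath pts ω (firstRegen pts ω)} ≤
      μ.real (Ioi z) * ∫ ω, firstRegen pts ω ∂P + (1 - dominantProb μ) ^ l +
        (3 * l) ^ 2 * μ.real (Ioi b) ^ 2 := by
  classical
  set n := 3 * l with hn
  set I := (Finset.range n ×ˢ Finset.range n).filter fun q => q.1 < q.2 with hI
  set D := ⋃ q ∈ I, cellEvent pts b 0 q.1 ∩ cellEvent pts b 0 q.2 with hD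
  have hDP : P.real D ≤ (3 * l) ^ 2 * μ.real (Ioi b) ^ 2 := by
    calc P.real D ≤ ∑ q ∈ I, _ := measureReal_biUnion_finset_le _ _
      _ ≤ ∑ q ∈ I, μ.real (Ioi b) ^ 2 := Finset.sum_le_sum fun q hq => by
          have := h.real_two_dyadicCells_le hμ hb 0 (Finset.mem_filter.1 hq).2
          simpa [cellEvent] using this
      _ ≤ _ := by
          rw [Finset.sum_const, nsmul_eq_mul]
          gcongr
          have : I.card ≤ n ^ 2 := (Finset.card_filter_le _ _).trans (by simp [sq])
          calc (I.card : ℝ) ≤ ((n ^ 2 : ℕ) : ℝ) := by exact_mod_cast this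
            _ = _ := by rw [hn]; push_cast; ring
  have hsub : ∀ᵐ ω ∂P, 3 * l * b + z < stairsPath pts ω (firstRegen pts ω) →
      ω ∈ ({ω | ∃ p ∈ pts ω, p.1 ≤ firstRegen pts ω ∧ z < p.2} ∪
        {ω | (3 * l : ℝ) < firstRegen pts ω}) ∪ D := by
    filter_upwards [h.ae_isLocallyFiniteConfig hμ] with ω hω hlt
    by_contra hcon
    simp only [mem_union, not_or] at hcon
    obtain ⟨⟨hc1, hc2⟩, hc3⟩ := hcon
    have hτn : firstRegen pts ω ≤ (n : ℝ) := by
      rw [hn]; push_cast; exact not_lt.1 hc2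
    -- all marks before `τ₁` are at most `z`, and at most `b` outside the unit cell number `j₀`
    have H1 : ∀ v ≤ firstRegen pts ω, markAt (pts ω) v ≤ z := fun v hv => by
      by_contra hc
      obtain ⟨x, hx, hxS⟩ := (hω.lt_markAt_iff hz.le).1 (not_le.1 hc)
      exact hc1 ⟨(v, x), hxS, hv, hx⟩
    have hcell : ∀ v ≤ firstRegen pts ω, b < markAt (pts ω) v →
        ∃ j < n, v ∈ dyadicCell 0 j ∧ ω ∈ cellEvent pts b 0 j := fun v hv hbv => by
      obtain ⟨x, hx, hxS⟩ := (hω.lt_markAt_iff hb.le).1 hbv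
      obtain ⟨j, hj⟩ := exists_mem_dyadicCell 0 (hω.subset_quadrant hxS).1
      have := dyadicCell_index_lt hj (hv.trans hτn)
      rw [pow_zero, mul_one] at this
      exact ⟨j, by exact_mod_cast this, hj, mem_cellEvent.2 ⟨_, hxS, hj, hx⟩⟩
    obtain ⟨j₀, hj₀⟩ : ∃ j₀ : ℕ, ∀ j < n, ω ∈ cellEvent pts b 0 j → j = j₀ := by
      by_cases hex : ∃ j₀ < n, ω ∈ cellEvent pts b 0 j₀
      · obtain ⟨j₀, hj₀n, hj₀⟩ := hex
        refine ⟨j₀, fun j hjn hj => ?_⟩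
        by_contra hne
        refine hc3 ?_
        rcases lt_or_gt_of_ne hne with hlt | hlt
        · exact mem_iUnion₂.2 ⟨(j, j₀), by simp [hI, hjn, hj₀n, hlt], hj, hj₀⟩
        · exact mem_iUnion₂.2 ⟨(j₀, j), by simp [hI, hjn, hj₀n, hlt], hj₀, hj⟩
      · push Not at hex
        exact ⟨0, fun j hjn hj => absurd hj (hex j hjn)⟩
    have H2 : ∀ v ≤ firstRegen pts ω, ¬ ((j₀ : ℝ) < v ∧ v ≤ (j₀ : ℝ) + 1) →
        markAt (pts ω) v ≤ b := fun v hv hvc => by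
      by_contra hc
      obtain ⟨j, hjn, hvj, hj⟩ := hcell v hv (not_le.1 hc)
      rw [hj₀ j hjn hj] at hvj
      refine hvc ⟨by simpa using hvj.1, by simpa using hvj.2⟩
    have := IsStairsInput.stairs_le_of_one_big_cell hb.le hz.le H1 H2 hτn
    rw [hn] at this
    push_cast at this
    exact absurd hlt (not_lt.2 this)
  calc P.real {ω | 3 * l * b + z < stairsPath pts ω (firstRegen pts ω)}
      ≤ P.real (({ω | ∃ p ∈ pts ω, p.1 ≤ firstRegen pts ω ∧ z < p.2} ∪
        {ω | (3 * l : ℝ) < firstRegen pts ω}) ∪ D) :=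
        ENNReal.toReal_mono (measure_ne_top _ _) (measure_mono_ae hsub)
    _ ≤ P.real {ω | ∃ p ∈ pts ω, p.1 ≤ firstRegen pts ω ∧ z < p.2} +
        P.real {ω | (3 * l : ℝ) < firstRegen pts ω} + P.real D :=
        (measureReal_union_le _ _).trans (add_le_add_left (measureReal_union_le _ _) _)
    _ ≤ _ := by
        gcongr
        · exact h.real_exists_mark_le hμ hp hz
        · exact h.real_lt_firstRegen_le hμ l

end IsPoissonPointProcess

end Bounds

/-! ### Regularly varying tails -/

/-- A positive nonincreasing function on `(0, ∞)` which is regularly varying at `+∞` with index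
`-α`. -/
structure IsRegularTail (g : ℝ → ℝ) (α : ℝ) : Prop where
  pos : ∀ y, 0 < y → 0 < g y
  anti : ∀ x y, 0 < x → x ≤ y → g y ≤ g x
  tendsto : ∀ l : ℝ, 0 < l → Tendsto (fun y => g (l * y) / g y) atTop (𝓝 (l ^ (-α)))

namespace IsRegularTail

variable {g : ℝ → ℝ} {α : ℝ}

/-- A bound on `g (2 * y) / g y` is iterated along powers of `2`; monotonicity fills the gaps
between these, at the cost of the factor `2 ^ r`. -/
theorem upper_of_doubling (hg : IsRegularTail g α) {r y₀ : ℝ} (hr : 0 ≤ r) (hy₀ : 0 < y₀)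
    (H : ∀ y ≥ y₀, g (2 * y) ≤ 2 ^ (-r) * g y) :
    ∀ y ≥ y₀, ∀ x ≥ 1, g (y * x) ≤ 2 ^ r * x ^ (-r) * g y := by
  intro y hy x hx
  have hy0 : 0 < y := hy₀.trans_le hy
  have hiter : ∀ n : ℕ, g (y * 2 ^ n) ≤ ((2 : ℝ) ^ (-r)) ^ n * g y := by
    intro n
    induction n with
    | zero => simp
    | succ n ih =>
      have h1 : y₀ ≤ y * 2 ^ n := hy.trans (le_mul_of_one_le_right hy0.le (one_le_pow₀ one_le_two))
      have h2 := H _ h1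
      calc g (y * 2 ^ (n + 1)) = g (2 * (y * 2 ^ n)) := by ring_nf
        _ ≤ 2 ^ (-r) * (((2 : ℝ) ^ (-r)) ^ n * g y) := h2.trans (by gcongr)
        _ = _ := by ring
  obtain ⟨n, hn1, hn2⟩ := exists_nat_pow_near hx one_lt_two
  have hgy := hg.pos y hy0
  calc g (y * x) ≤ g (y * 2 ^ n) := hg.anti _ _ (by positivity) (by gcongr)
    _ ≤ ((2 : ℝ) ^ (-r)) ^ n * g y := hiter n
    _ ≤ 2 ^ r * x ^ (-r) * g y := by
        gcongr
        have h3 : ((2 : ℝ) ^ (-r)) ^ n = (2 ^ n) ^ (-r) := by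
          rw [← Real.rpow_natCast, ← Real.rpow_mul two_pos.le, mul_comm, Real.rpow_mul two_pos.le,
            Real.rpow_natCast]
        have h4 : (2 : ℝ) ^ r = (1 / 2) ^ (-r) := by
          rw [one_div, Real.inv_rpow two_pos.le, ← Real.rpow_neg two_pos.le, neg_neg]
        rw [h3, h4, ← Real.mul_rpow (by norm_num) (by linarith)]
        refine Real.rpow_le_rpow_of_nonpos (by linarith) ?_ (by linarith)
        rw [pow_succ] at hn2
        linarith

theorem lower_of_doubling (hg : IsRegularTail g α) {r y₀ : ℝ} (hr : 0 ≤ r) (hy₀ : 0 < y₀)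
    (H : ∀ y ≥ y₀, 2 ^ (-r) * g y ≤ g (2 * y)) :
    ∀ y ≥ y₀, ∀ x ≥ 1, 2 ^ (-r) * x ^ (-r) * g y ≤ g (y * x) := by
  intro y hy x hx
  have hy0 : 0 < y := hy₀.trans_le hy
  have hiter : ∀ n : ℕ, ((2 : ℝ) ^ (-r)) ^ n * g y ≤ g (y * 2 ^ n) := by
    intro n
    induction n with
    | zero => simp
    | succ n ih =>
      have h1 : y₀ ≤ y * 2 ^ n := hy.trans (le_mul_of_one_le_right hy0.le (one_le_pow₀ one_le_two))
      have h2 := H _ h1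
      calc ((2 : ℝ) ^ (-r)) ^ (n + 1) * g y = 2 ^ (-r) * (((2 : ℝ) ^ (-r)) ^ n * g y) := by ring
        _ ≤ g (2 * (y * 2 ^ n)) := le_trans (by gcongr) h2
        _ = _ := by ring_nf
  obtain ⟨n, hn1, hn2⟩ := exists_nat_pow_near hx one_lt_two
  have hgy := hg.pos y hy0
  calc 2 ^ (-r) * x ^ (-r) * g y ≤ ((2 : ℝ) ^ (-r)) ^ (n + 1) * g y := by
        gcongr
        have h3 : ((2 : ℝ) ^ (-r)) ^ (n + 1) = (2 ^ (n + 1)) ^ (-r) := by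
          rw [← Real.rpow_natCast, ← Real.rpow_mul two_pos.le, mul_comm, Real.rpow_mul two_pos.le,
            Real.rpow_natCast]
        rw [h3, ← Real.mul_rpow (by norm_num) (by linarith)]
        refine Real.rpow_le_rpow_of_nonpos (by positivity) ?_ (by linarith)
        rw [pow_succ]
        linarith
    _ ≤ g (y * 2 ^ (n + 1)) := hiter _
    _ ≤ g (y * x) := hg.anti _ _ (by positivity) (by gcongr)

/-- Potter bounds, uniform on `[c₀, ∞)`. The exponents `3 * α / 4` and `5 * α / 4` are such that the
square of the upper bound is of smaller order than the lower bound. -/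
theorem potter (hg : IsRegularTail g α) (hα : 0 < α) {c₀ : ℝ} (hc₀ : 0 < c₀) :
    ∃ C : ℝ, 0 < C ∧ ∀ y ≥ c₀, ∀ x ≥ 1, g (y * x) ≤ C * x ^ (-(3 * α / 4)) * g y ∧
      C⁻¹ * x ^ (-(5 * α / 4)) * g y ≤ g (y * x) := by
  have h2 := hg.tendsto 2 two_pos
  have hup : (2 : ℝ) ^ (-α) < 2 ^ (-(3 * α / 4)) :=
    Real.rpow_lt_rpow_of_exponent_lt one_lt_two (by linarith)
  have hlo : (2 : ℝ) ^ (-(5 * α / 4)) < 2 ^ (-α) :=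
    Real.rpow_lt_rpow_of_exponent_lt one_lt_two (by linarith)
  obtain ⟨y₀, hy₀⟩ := eventually_atTop.1 ((h2.eventually_lt_const hup).and
    (h2.eventually_const_lt hlo))
  set y₁ := max y₀ c₀ with hy₁
  have hy₁0 : 0 < y₁ := lt_max_of_lt_right hc₀
  have hc₁ : c₀ ≤ y₁ := le_max_right _ _
  have U := hg.upper_of_doubling (r := 3 * α / 4) (y₀ := y₁) (by positivity) hy₁0 fun y hy => by
    have := (hy₀ y ((le_max_left _ _).trans hy)).1
    rw [div_lt_iff₀ (hg.pos y (hy₁0.trans_le hy))] at this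
    exact this.le
  have V := hg.lower_of_doubling (r := 5 * α / 4) (y₀ := y₁) (by positivity) hy₁0 fun y hy => by
    have := (hy₀ y ((le_max_left _ _).trans hy)).2
    rw [lt_div_iff₀ (hg.pos y (hy₁0.trans_le hy))] at this
    exact this.le
  set r := 3 * α / 4 with hr
  set s := 5 * α / 4 with hs
  have hr0 : 0 ≤ r := by positivity
  have hs0 : 0 ≤ s := by positivity
  have hgc := hg.pos c₀ hc₀
  have hgy := hg.pos y₁ hy₁0
  -- beyond `y₁` the bounds come from the doubling estimates, with constants `2 ^ r` and `2 ^ s`;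
  -- the other factors of `A` and `B` take care of arguments in `[c₀, y₁]`, where `g` is bounded
  -- above and below by monotonicity
  set A := (2 : ℝ) ^ r * (y₁ / c₀) ^ r with hA
  set B := (2 : ℝ) ^ s * (g c₀ / g y₁) with hB
  have h2r : (1 : ℝ) ≤ 2 ^ r := Real.one_le_rpow one_le_two hr0
  have hyc : 1 ≤ y₁ / c₀ := (one_le_div hc₀).2 hc₁
  have hycr : 1 ≤ (y₁ / c₀) ^ r := Real.one_le_rpow hyc hr0
  have hgg : 1 ≤ g c₀ / g y₁ := (one_le_div hgy).2 (hg.anti _ _ hc₀ hc₁)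
  have h2s0 : (0 : ℝ) < 2 ^ s := by positivity
  have hB0 : 0 < B := by positivity
  have hA0 : 0 < A := by positivity
  refine ⟨max A B, lt_max_of_lt_left hA0, fun y hy x hx => ?_⟩
  have hy0 : 0 < y := hc₀.trans_le hy
  have hx0 : 0 < x := one_pos.trans_le hx
  have hgy' := hg.pos y hy0
  have hxr : 0 < x ^ (-r) := Real.rpow_pos_of_pos hx0 _
  have hxs : 0 < x ^ (-s) := Real.rpow_pos_of_pos hx0 _
  constructor
  · refine le_trans (b := A * x ^ (-r) * g y) ?_ (by gcongr; exact le_max_left _ _)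
    rcases le_or_gt y₁ y with h | h
    · refine (U y h x hx).trans ?_
      gcongr
      exact le_mul_of_one_le_right (by positivity) hycr
    rcases le_or_gt y₁ (y * x) with h' | h'
    · have h3 := U y₁ le_rfl (y * x / y₁) ((one_le_div hy₁0).2 h')
      rw [mul_div_cancel₀ _ hy₁0.ne'] at h3
      refine h3.trans ?_
      rw [hA, mul_assoc, mul_assoc, mul_assoc]
      gcongr (2 : ℝ) ^ r * ?_
      rw [← mul_assoc]
      refine mul_le_mul ?_ (hg.anti _ _ hy0 h.le) hgy.le (by positivity)
      have e1 : (y₁ / c₀) ^ r = (c₀ / y₁) ^ (-r) := by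
        rw [Real.rpow_neg (by positivity), ← Real.inv_rpow (by positivity), inv_div]
      rw [e1, ← Real.mul_rpow (by positivity) hx0.le]
      refine Real.rpow_le_rpow_of_nonpos (by positivity) ?_ (by linarith)
      rw [div_mul_eq_mul_div]
      gcongr
    · have h3 : g (y * x) ≤ g y := hg.anti _ _ hy0 (le_mul_of_one_le_right hy0.le hx)
      have h4 : x ≤ y₁ / c₀ := by
        rw [le_div_iff₀ hc₀]
        nlinarith
      have h5 : 1 ≤ (y₁ / c₀) ^ r * x ^ (-r) := by
        rw [Real.rpow_neg hx0.le, ← div_eq_mul_inv, one_le_div (by positivity)]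
        exact Real.rpow_le_rpow hx0.le h4 hr0
      have h6 : 1 ≤ A * x ^ (-r) := by
        rw [hA, mul_assoc]
        exact one_le_mul_of_one_le_of_one_le h2r h5
      nlinarith
  · refine le_trans (b := B⁻¹ * x ^ (-s) * g y) (by gcongr; exact le_max_right _ _) ?_
    have hBinv : B⁻¹ = 2 ^ (-s) * (g y₁ / g c₀) := by
      rw [hB, mul_inv, inv_div, Real.rpow_neg two_pos.le]
    have h2s : (0 : ℝ) < 2 ^ (-s) := by positivity
    rcases le_or_gt y₁ y with h | h
    · refine le_trans ?_ (V y h x hx)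
      gcongr
      rw [hBinv]
      refine mul_le_of_le_one_right h2s.le ?_
      rw [div_le_one hgc]
      exact hg.anti _ _ hc₀ hc₁
    · refine le_trans ?_ ((V y₁ le_rfl x hx).trans
        (hg.anti _ _ (by positivity) (by gcongr)))
      have h3 : g y₁ / g c₀ * g y ≤ g y₁ := by
        rw [div_mul_eq_mul_div, div_le_iff₀ hgc]
        gcongr
        exact hg.anti _ _ hc₀ hy
      rw [hBinv]
      calc 2 ^ (-s) * (g y₁ / g c₀) * x ^ (-s) * g y
          = 2 ^ (-s) * x ^ (-s) * (g y₁ / g c₀ * g y) := by ring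
        _ ≤ _ := by gcongr

end IsRegularTail

/-- The time horizon `3 l`, with `l` of the order of a small power of `x`, makes both error terms
in the upper bound for the tail of the path at `τ₁` negligible with respect to the tail. -/
theorem eventually_exists_horizon {α p a₁ a₂ δ η : ℝ} (hα : 0 < α) (hp : 0 < p) (hp1 : p ≤ 1)
    (ha₁ : 0 < a₁) (hδ : 0 < δ) (hη : 0 < η) :
    ∀ᶠ x : ℝ in atTop, ∃ l : ℕ, 1 ≤ l ∧ 1 ≤ δ * x / (3 * l) ∧
      (1 - p) ^ l + (3 * l) ^ 2 * (a₂ * (δ * x / (3 * l)) ^ (-(3 * α / 4))) ^ 2 ≤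
        η * (a₁ * x ^ (-(5 * α / 4))) := by
  -- with `l` of order `x ^ κ`, the second error term is of order `x ^ (2 κ - (1 - κ) * 3 α / 2)`;
  -- `κ` is so small that this is of smaller order than `x ^ (-5 α / 4)`
  set κ := α / (8 * (α + 1)) with hκ
  have hκ0 : 0 < κ := by positivity
  have hκ1 : κ < 1 := by
    rw [hκ, div_lt_one (by positivity)]; linarith
  have hexp : κ * (2 + 3 * α / 2) < α / 4 := by
    rw [hκ, div_mul_eq_mul_div, div_lt_iff₀ (by positivity)]
    nlinarith
  set M := 36 * a₂ ^ 2 * (δ / 6) ^ (-(3 * α / 2)) with hM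
  have hM0 : 0 ≤ M := by positivity
  set ρ := 5 * α / 4 + (2 * κ - (1 - κ) * (3 * α / 2)) with hρ
  have hρ0 : ρ < 0 := by rw [hρ]; nlinarith
  have t1 : Tendsto (fun x : ℝ => x ^ κ) atTop atTop := tendsto_rpow_atTop hκ0
  have t2 : Tendsto (fun x : ℝ => (x ^ κ) ^ (5 * α / 4 / κ) * Real.exp (-p * x ^ κ)) atTop (𝓝 0) :=
    (tendsto_rpow_mul_exp_neg_mul_atTop_nhds_zero (5 * α / 4 / κ) p hp).comp t1
  have t3 : Tendsto (fun x : ℝ => M * x ^ ρ) atTop (𝓝 (M * 0)) := by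
    have := (tendsto_rpow_neg_atTop (y := -ρ) (by linarith)).const_mul M
    simpa using this
  rw [mul_zero] at t3
  have t4 : Tendsto (fun x : ℝ => x ^ (1 - κ)) atTop atTop := tendsto_rpow_atTop (by linarith)
  have t5 := (t2.add t3)
  rw [add_zero] at t5
  filter_upwards [eventually_ge_atTop 1, t4.eventually_ge_atTop (6 / δ),
    t5.eventually_lt_const (show 0 < η * a₁ by positivity)] with x hx1 hx2 hx3
  have hx0 : 0 < x := one_pos.trans_le hx1
  have hxκ : 1 ≤ x ^ κ := Real.one_le_rpow hx1 hκ0.le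
  have hl1 : x ^ κ ≤ (⌈x ^ κ⌉₊ : ℝ) := Nat.le_ceil _
  have hl2 : (⌈x ^ κ⌉₊ : ℝ) ≤ 2 * x ^ κ := by
    have := (Nat.ceil_lt_add_one (zero_le_one.trans hxκ)).le
    linarith
  have hl0 : 1 ≤ ⌈x ^ κ⌉₊ := Nat.one_le_ceil_iff.2 (by linarith)
  set l := ⌈x ^ κ⌉₊ with hl
  have hl0' : (0 : ℝ) < l := by exact_mod_cast hl0
  have hsplit : x = x ^ κ * x ^ (1 - κ) := by
    rw [← Real.rpow_add hx0]; simp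
  have hxk0 : 0 < x ^ κ := by positivity
  have hxk1 : 0 < x ^ (1 - κ) := by positivity
  have hb : δ / 6 * x ^ (1 - κ) ≤ δ * x / (3 * l) := by
    rw [le_div_iff₀ (by positivity)]
    calc δ / 6 * x ^ (1 - κ) * (3 * l) ≤ δ / 6 * x ^ (1 - κ) * (3 * (2 * x ^ κ)) := by gcongr
      _ = δ * (x ^ κ * x ^ (1 - κ)) := by ring
      _ = δ * x := by rw [← hsplit]
  have hb1 : 1 ≤ δ / 6 * x ^ (1 - κ) := by
    rw [div_le_iff₀ hδ] at hx2
    linarith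
  refine ⟨l, hl0, hb1.trans hb, ?_⟩
  have e1 : (1 - p) ^ l ≤ Real.exp (-p * x ^ κ) := by
    calc (1 - p) ^ l ≤ (Real.exp (-p)) ^ l :=
          pow_le_pow_left₀ (by linarith) (Real.one_sub_le_exp_neg p) l
      _ = Real.exp (-p * l) := by rw [← Real.exp_nat_mul]; ring_nf
      _ ≤ _ := by
          refine Real.exp_le_exp.2 ?_
          nlinarith
  have e2 : (3 * (l : ℝ)) ^ 2 * (a₂ * (δ * x / (3 * l)) ^ (-(3 * α / 4))) ^ 2 ≤
      M * x ^ (2 * κ - (1 - κ) * (3 * α / 2)) := by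
    have h1 : (δ * x / (3 * l)) ^ (-(3 * α / 4)) ≤ (δ / 6 * x ^ (1 - κ)) ^ (-(3 * α / 4)) :=
      Real.rpow_le_rpow_of_nonpos (by positivity) hb (by linarith)
    have h2 : ((δ / 6 * x ^ (1 - κ)) ^ (-(3 * α / 4))) ^ 2 =
        (δ / 6) ^ (-(3 * α / 2)) * x ^ (-((1 - κ) * (3 * α / 2))) := by
      rw [← Real.rpow_natCast, ← Real.rpow_mul (by positivity),
        Real.mul_rpow (by positivity) (by positivity), ← Real.rpow_mul hx0.le]
      push_cast
      congr 2 <;> ring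
    have h3 : (x ^ κ) ^ 2 = x ^ (2 * κ) := by
      rw [← Real.rpow_natCast, ← Real.rpow_mul hx0.le]
      push_cast
      ring_nf
    calc (3 * (l : ℝ)) ^ 2 * (a₂ * (δ * x / (3 * l)) ^ (-(3 * α / 4))) ^ 2
        = (3 * (l : ℝ)) ^ 2 * (a₂ ^ 2 * ((δ * x / (3 * l)) ^ (-(3 * α / 4))) ^ 2) := by
          rw [mul_pow a₂]
      _ ≤ (3 * (2 * x ^ κ)) ^ 2 * (a₂ ^ 2 * ((δ / 6 * x ^ (1 - κ)) ^ (-(3 * α / 4))) ^ 2) := by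
          gcongr
      _ = M * (x ^ (2 * κ) * x ^ (-((1 - κ) * (3 * α / 2)))) := by
          rw [h2, mul_pow, mul_pow 2, h3, hM]; ring
      _ = _ := by rw [← Real.rpow_add hx0]; ring_nf
  have e3 : (x ^ κ) ^ (5 * α / 4 / κ) = x ^ (5 * α / 4) := by
    rw [← Real.rpow_mul hx0.le]
    congr 1
    field_simp
  have e4 : x ^ (-(5 * α / 4)) * x ^ (5 * α / 4) = 1 := by
    rw [← Real.rpow_add hx0]; simp
  have e5 : x ^ ρ = x ^ (5 * α / 4) * x ^ (2 * κ - (1 - κ) * (3 * α / 2)) := by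
    rw [← Real.rpow_add hx0]
  rw [e3, e5] at hx3
  have hneg : 0 < x ^ (-(5 * α / 4)) := by positivity
  calc (1 - p) ^ l + (3 * (l : ℝ)) ^ 2 * (a₂ * (δ * x / (3 * l)) ^ (-(3 * α / 4))) ^ 2
      ≤ Real.exp (-p * x ^ κ) + M * x ^ (2 * κ - (1 - κ) * (3 * α / 2)) := add_le_add e1 e2
    _ = x ^ (-(5 * α / 4)) * (x ^ (5 * α / 4) * Real.exp (-p * x ^ κ) +
          M * (x ^ (5 * α / 4) * x ^ (2 * κ - (1 - κ) * (3 * α / 2)))) := by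
        linear_combination (-Real.exp (-p * x ^ κ) -
          M * x ^ (2 * κ - (1 - κ) * (3 * α / 2))) * e4
    _ ≤ x ^ (-(5 * α / 4)) * (η * a₁) := by gcongr
    _ = _ := by ring

/-! ### Tail asymptotics, uniformly over a family of stairs measures -/

/-- For a fixed stairs measure, the ratio is controlled by comparing the tail `T` at `x`,
`(1 - δ) x` and `(1 + δ) x`, once the error terms are small. -/
theorem IsPoissonPointProcess.abs_ratio_sub_one_le {Ω : Type*} [MeasurableSpace Ω] {P : Measure Ω}
    [IsProbabilityMeasure P] {pts : Ω → Set (ℝ × ℝ)} {μ : Measure ℝ}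
    (h : IsPoissonPointProcess P pts (stairsIntensity μ)) (hμ : IsStairsMeasure μ)
    (hp : 0 < dominantProb μ) {x δ e : ℝ} (hx : 0 < x) (hδ0 : 0 < δ) (hδ1 : δ < 1) (he : 0 < e)
    (hT : 0 < μ.real (Ioi x))
    (hup : μ.real (Ioi ((1 - δ) * x)) ≤ (1 + e) * μ.real (Ioi x))
    (hlo : (1 - e) * μ.real (Ioi x) ≤ μ.real (Ioi ((1 + δ) * x)))
    {l : ℕ} (hl : 1 ≤ l)
    (hbad : (1 - dominantProb μ) ^ l + (3 * l) ^ 2 * μ.real (Ioi (δ * x / (3 * l))) ^ 2 ≤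
      e * μ.real (Ioi x))
    {m : ℕ} (hm : 3 * ((1 - dominantProb μ) ^ m / dominantProb μ) ≤ e)
    (hm' : (3 * m) ^ 2 * μ.real (Ioi ((1 + δ) * x)) ≤ e) :
    |P.real {ω | x < stairsPath pts ω (firstRegen pts ω)} /
      ((∫ ω, firstRegen pts ω ∂P) * μ.real (Ici x)) - 1| ≤ 4 * e := by
  have hE := h.one_le_integral_firstRegen hμ hp
  have hl0 : (0 : ℝ) < l := by exact_mod_cast hl
  have hz : 0 < (1 - δ) * x := mul_pos (by linarith) hx
  have hz' : 0 < (1 + δ) * x := by positivity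
  have hb : 0 < δ * x / (3 * l) := by positivity
  have hIci1 : μ.real (Ioi x) ≤ μ.real (Ici x) :=
    measureReal_mono Ioi_subset_Ici_self (hμ.finite_tail x hx).ne
  have hIci2 : μ.real (Ici x) ≤ μ.real (Ioi ((1 - δ) * x)) :=
    measureReal_mono (Ici_subset_Ioi.2 (by nlinarith)) (hμ.measure_Ioi_ne_top hz)
  have hU := h.real_stairsPath_firstRegen_le hμ hp hb hz l
  have hxeq : 3 * l * (δ * x / (3 * l)) + (1 - δ) * x = x := by field_simp; ring
  rw [hxeq] at hU
  have hV := h.le_real_stairsPath_firstRegen hμ hp hz' (3 * m)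
  have hint := h.integral_firstRegen_le_add hμ hp m
  have hsub : P.real {ω | (1 + δ) * x ≤ stairsPath pts ω (firstRegen pts ω)} ≤
      P.real {ω | x < stairsPath pts ω (firstRegen pts ω)} := by
    refine measureReal_mono (fun ω hω => ?_) (measure_ne_top _ _)
    exact lt_of_lt_of_le (b := (1 + δ) * x) (by nlinarith) hω
  have hpow : (((3 * m : ℕ) : ℝ)) ^ 2 = (3 * m) ^ 2 := by push_cast; ring
  rw [hpow] at hV
  set E := ∫ ω, firstRegen pts ω ∂P
  set F := ∫ ω, min (firstRegen pts ω) ((3 * m : ℕ) : ℝ) ∂P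
  set p := P.real {ω | x < stairsPath pts ω (firstRegen pts ω)}
  set T := μ.real (Ioi x)
  set T' := μ.real (Ici x)
  set Tz := μ.real (Ioi ((1 + δ) * x))
  have hTz : 0 ≤ Tz := measureReal_nonneg
  have hT' : 0 < T' := hT.trans_le hIci1
  have hET' : 0 < E * T' := by positivity
  have upper : p ≤ (1 + 2 * e) * (E * T') := by
    have h1 : μ.real (Ioi ((1 - δ) * x)) * E ≤ (1 + e) * T * E := by gcongr
    have h2 : e * T ≤ e * T * E := le_mul_of_one_le_right (by positivity) hE
    have h3 : T * E ≤ E * T' := by rw [mul_comm]; gcongr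
    nlinarith
  have lower : (1 - 4 * e) * (E * T') ≤ p := by
    have h1 : E * (1 - 2 * e) ≤ F - (3 * m) ^ 2 * Tz := by nlinarith
    have h2 : Tz * (E * (1 - 2 * e)) ≤ p := (mul_le_mul_of_nonneg_left h1 hTz).trans (hV.trans hsub)
    rcases le_or_gt (1 - 2 * e) 0 with h3 | h3
    · have : (1 - 4 * e) * (E * T') ≤ 0 := mul_nonpos_of_nonpos_of_nonneg (by linarith) hET'.le
      exact this.trans measureReal_nonneg
    · have h4 : (1 - e) * T * (E * (1 - 2 * e)) ≤ p :=
        (mul_le_mul_of_nonneg_right hlo (by positivity)).trans h2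
      have h5 : T' ≤ (1 + e) * T := hIci2.trans hup
      rcases le_or_gt (1 - 4 * e) 0 with h6 | h6
      · have : (1 - 4 * e) * (E * T') ≤ 0 := mul_nonpos_of_nonpos_of_nonneg h6 hET'.le
        exact this.trans measureReal_nonneg
      · refine le_trans ?_ h4
        calc (1 - 4 * e) * (E * T') ≤ (1 - 4 * e) * (E * ((1 + e) * T)) := by gcongr
          _ = (1 - 4 * e) * (1 + e) * (E * T) := by ring
          _ ≤ (1 - e) * (1 - 2 * e) * (E * T) :=
              mul_le_mul_of_nonneg_right (by nlinarith) (by positivity)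
          _ = _ := by ring
  rw [abs_le]
  constructor
  · rw [le_sub_iff_add_le, le_div_iff₀ hET']
    linarith
  · rw [sub_le_iff_le_add, div_le_iff₀ hET']
    nlinarith

/-- The asymptotics hold beyond a common threshold for all stairs measures with tail
`x ↦ K g (c x)`, where `c` is bounded below and `K g c` is bounded above and below. -/
theorem IsRegularTail.exists_threshold {g : ℝ → ℝ} {α : ℝ} (hg : IsRegularTail g α) (hα : 0 < α)
    {c₀ κ₁ κ₂ ε : ℝ} (hc₀ : 0 < c₀) (hκ₁ : 0 < κ₁) (hκ₂ : 0 < κ₂) (hε : 0 < ε) :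
    ∃ x₀ : ℝ, 0 < x₀ ∧ ∀ K c : ℝ, 0 < K → c₀ ≤ c → κ₁ ≤ K * g c → K * g c ≤ κ₂ →
      ∀ μ : Measure ℝ, IsStairsMeasure μ → (∀ x, 0 < x → μ.real (Ioi x) = K * g (c * x)) →
      0 < dominantProb μ ∧
      ∀ (Ω : Type*) [MeasurableSpace Ω] (P : Measure Ω) [IsProbabilityMeasure P]
        (pts : Ω → Set (ℝ × ℝ)), IsPoissonPointProcess P pts (stairsIntensity μ) →
        ∀ x ≥ x₀, |P.real {ω | x < stairsPath pts ω (firstRegen pts ω)} /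
          ((∫ ω, firstRegen pts ω ∂P) * μ.real (Ici x)) - 1| ≤ ε := by
  obtain ⟨C, hC, hpot⟩ := hg.potter hα hc₀
  set a₁ := C⁻¹ * κ₁ with ha₁
  set a₂ := C * κ₂ with ha₂
  have ha₁0 : 0 < a₁ := by positivity
  have ha₂0 : 0 < a₂ := by positivity
  -- a lower bound for `dominantProb`, valid for the whole family
  set q := min (a₁ * 2 ^ (-(5 * α / 4)) * Real.exp (-(3 * κ₂))) 1 with hq
  have hq0 : 0 < q := lt_min (by positivity) one_pos
  have hq1 : q ≤ 1 := min_le_right _ _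
  set e := min (ε / 4) (1 / 2) with he
  have he0 : 0 < e := lt_min (by positivity) (by norm_num)
  have he1 : e < 1 := (min_le_right _ _).trans_lt (by norm_num)
  have heε : 4 * e ≤ ε := by linarith [min_le_left (ε / 4) (1 / 2)]
  -- `δ` makes `((1 ± δ) x) ^ (-α)` close to `x ^ (-α)`
  obtain ⟨δ, hδ0, hδ1, hδu, hδl⟩ : ∃ δ : ℝ, 0 < δ ∧ δ < 1 ∧ (1 - δ) ^ (-α) < 1 + e ∧
      1 - e < (1 + δ) ^ (-α) := by
    have c1 : ContinuousAt (fun δ : ℝ => (1 - δ) ^ (-α)) 0 :=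
      (continuousAt_const.sub continuousAt_id).rpow_const (Or.inl (by norm_num))
    have c2 : ContinuousAt (fun δ : ℝ => (1 + δ) ^ (-α)) 0 :=
      (continuousAt_const.add continuousAt_id).rpow_const (Or.inl (by norm_num))
    have e1 := c1.eventually_lt_const (u := 1 + e) (by simp [he0])
    have e2 := c2.eventually_const_lt (u := 1 - e) (by simp [he0])
    have e3 : ∀ᶠ δ : ℝ in 𝓝 0, δ < 1 := eventually_lt_nhds one_pos
    have e4 : ∀ᶠ δ : ℝ in 𝓝[>] 0, (1 - δ) ^ (-α) < 1 + e ∧ 1 - e < (1 + δ) ^ (-α) ∧ δ < 1 :=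
      nhdsWithin_le_nhds (e1.and (e2.and e3))
    obtain ⟨δ, ⟨h1, h2, h3⟩, h4⟩ := (e4.and self_mem_nhdsWithin).exists
    exact ⟨δ, h4, h3, h1, h2⟩
  obtain ⟨y₁, hy₁⟩ := eventually_atTop.1
    (((hg.tendsto (1 - δ) (by linarith)).eventually_lt_const hδu).and
      ((hg.tendsto (1 + δ) (by linarith)).eventually_const_lt hδl))
  -- the regeneration time contributes at most `e` to its expectation beyond `3 m`
  obtain ⟨m, hm⟩ : ∃ m : ℕ, 3 * ((1 - q) ^ m / q) ≤ e := by
    obtain ⟨m, hm⟩ := exists_pow_lt_of_lt_one (show 0 < e * q / 3 by positivity)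
      (show 1 - q < 1 by linarith)
    refine ⟨m, ?_⟩
    rw [← mul_div_assoc, div_le_iff₀ hq0]
    linarith
  have hsmall : ∀ᶠ x : ℝ in atTop, (3 * (m : ℝ)) ^ 2 * (a₂ * x ^ (-(3 * α / 4))) < e := by
    have := ((tendsto_rpow_neg_atTop (y := 3 * α / 4) (by positivity)).const_mul a₂).const_mul
      ((3 * (m : ℝ)) ^ 2)
    rw [mul_zero, mul_zero] at this
    exact this.eventually_lt_const he0
  obtain ⟨x₁, hx₁⟩ := eventually_atTop.1 (hsmall.and
    (eventually_exists_horizon (a₂ := a₂) hα hq0 hq1 ha₁0 hδ0 he0))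
  refine ⟨max (max x₁ 1) (max y₁ 0 / c₀), by positivity, ?_⟩
  intro K c hK hc hK1 hK2 μ hμ hTμ
  have hc0 : 0 < c := hc₀.trans_le hc
  have hTup : ∀ x, 1 ≤ x → μ.real (Ioi x) ≤ a₂ * x ^ (-(3 * α / 4)) := by
    intro x hx
    have hx0 : 0 < x := one_pos.trans_le hx
    rw [hTμ x hx0]
    calc K * g (c * x) ≤ K * (C * x ^ (-(3 * α / 4)) * g c) := by
          gcongr
          exact (hpot c hc x hx).1
      _ = C * (K * g c) * x ^ (-(3 * α / 4)) := by ring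
      _ ≤ _ := by rw [ha₂]; gcongr
  have hTlo : ∀ x, 1 ≤ x → a₁ * x ^ (-(5 * α / 4)) ≤ μ.real (Ioi x) := by
    intro x hx
    have hx0 : 0 < x := one_pos.trans_le hx
    rw [hTμ x hx0]
    calc a₁ * x ^ (-(5 * α / 4)) ≤ C⁻¹ * (K * g c) * x ^ (-(5 * α / 4)) := by
          rw [ha₁]; gcongr
      _ = K * (C⁻¹ * x ^ (-(5 * α / 4)) * g c) := by ring
      _ ≤ _ := by
          gcongr
          exact (hpot c hc x hx).2
  have hdq : q ≤ dominantProb μ := by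
    refine (min_le_left _ _).trans ?_
    have h1 := hTlo 2 one_le_two
    have h2 : μ.real (Ioi 1) ≤ κ₂ := by rw [hTμ 1 one_pos, mul_one]; exact hK2
    rw [dominantProb]
    gcongr
  have hd0 : 0 < dominantProb μ := hq0.trans_le hdq
  refine ⟨hd0, ?_⟩
  intro Ω _ P _ pts hP x hx
  have hd1 := hP.dominantProb_le_one hμ
  have hxx₁ : x₁ ≤ x := (le_max_left _ _).trans ((le_max_left _ _).trans hx)
  have hx1 : 1 ≤ x := (le_max_right _ _).trans ((le_max_left _ _).trans hx)
  have hx0 : 0 < x := one_pos.trans_le hx1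
  have hcx : y₁ ≤ c * x := by
    have h1 : max y₁ 0 / c₀ ≤ x := (le_max_right _ _).trans hx
    rw [div_le_iff₀ hc₀] at h1
    calc y₁ ≤ max y₁ 0 := le_max_left _ _
      _ ≤ x * c₀ := h1
      _ ≤ x * c := by gcongr
      _ = c * x := mul_comm _ _
  obtain ⟨hs, l, hl, hb1, hbad⟩ := hx₁ x hxx₁
  have hTx : 0 < μ.real (Ioi x) := by
    rw [hTμ x hx0]
    exact mul_pos hK (hg.pos _ (by positivity))
  have hgx := hg.pos (c * x) (by positivity)
  have hpowmono : ∀ n : ℕ, (1 - dominantProb μ) ^ n ≤ (1 - q) ^ n := fun n =>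
    pow_le_pow_left₀ (by linarith) (by linarith) n
  refine (hP.abs_ratio_sub_one_le hμ hd0 (m := m) hx0 hδ0 hδ1 he0 hTx ?_ ?_ hl ?_ ?_ ?_).trans
    heε
  · rw [hTμ _ (mul_pos (by linarith) hx0), hTμ x hx0]
    have := (hy₁ _ hcx).1
    rw [div_lt_iff₀ hgx] at this
    calc K * g (c * ((1 - δ) * x)) = K * g ((1 - δ) * (c * x)) := by ring_nf
      _ ≤ K * ((1 + e) * g (c * x)) := by gcongr
      _ = _ := by ring
  · rw [hTμ ((1 + δ) * x) (by positivity), hTμ x hx0]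
    have := (hy₁ _ hcx).2
    rw [lt_div_iff₀ hgx] at this
    calc (1 - e) * (K * g (c * x)) = K * ((1 - e) * g (c * x)) := by ring
      _ ≤ K * g ((1 + δ) * (c * x)) := by gcongr
      _ = _ := by ring_nf
  · calc (1 - dominantProb μ) ^ l + (3 * (l : ℝ)) ^ 2 * μ.real (Ioi (δ * x / (3 * l))) ^ 2
        ≤ (1 - q) ^ l + (3 * (l : ℝ)) ^ 2 * (a₂ * (δ * x / (3 * l)) ^ (-(3 * α / 4))) ^ 2 := by
          gcongr ?_ + _ * ?_ ^ 2
          · exact hpowmono l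
          · exact hTup _ hb1
      _ ≤ e * (a₁ * x ^ (-(5 * α / 4))) := hbad
      _ ≤ _ := by
          gcongr
          exact hTlo x hx1
  · refine le_trans ?_ hm
    have hqn : 0 ≤ (1 - q) ^ m := pow_nonneg (by linarith) m
    gcongr
  · refine le_trans ?_ hs.le
    gcongr
    have h1 : μ.real (Ioi ((1 + δ) * x)) ≤ μ.real (Ioi x) :=
      measureReal_mono (Ioi_subset_Ioi (by nlinarith)) (hμ.measure_Ioi_ne_top hx0)
    exact h1.trans (hTup x hx1)

/-! ### The tail of the stairs measures `μ_N` -/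

theorem sub_one_le_neg_log_one_sub_div {p : ℝ} (hp : 0 < p) (hp1 : p < 1) :
    1 ≤ -Real.log (1 - p) / p ∧ -Real.log (1 - p) / p ≤ (1 - p)⁻¹ := by
  have h1 : Real.log (1 - p) ≤ -p := by
    have := Real.log_le_sub_one_of_pos (show 0 < 1 - p by linarith)
    linarith
  have h2 : -Real.log (1 - p) ≤ (1 - p)⁻¹ - 1 := by
    rw [← Real.log_inv]
    exact Real.log_le_sub_one_of_pos (by rw [inv_pos]; linarith)
  constructor
  · rw [le_div_iff₀ hp]; linarith
  · rw [div_le_iff₀ hp]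
    refine h2.trans (le_of_eq ?_)
    have : (1 : ℝ) - p ≠ 0 := by linarith
    field_simp
    ring

theorem tendsto_neg_log_one_sub_div {p : ℝ → ℝ} (hp : ∀ y, 0 < p y)
    (hlim : Tendsto p atTop (𝓝 0)) :
    Tendsto (fun y => -Real.log (1 - p y) / p y) atTop (𝓝 1) := by
  have h1 : ∀ᶠ y in atTop, p y < 1 := hlim.eventually_lt_const one_pos
  have h2 : Tendsto (fun y => (1 - p y)⁻¹) atTop (𝓝 1) := by
    have := (tendsto_const_nhds (x := (1 : ℝ))).sub hlim
    rw [sub_zero] at this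
    simpa using this.inv₀ one_ne_zero
  refine tendsto_of_tendsto_of_tendsto_of_le_of_le' tendsto_const_nhds h2 ?_ ?_
  · filter_upwards [h1] with y hy using (sub_one_le_neg_log_one_sub_div (hp y) hy).1
  · filter_upwards [h1] with y hy using (sub_one_le_neg_log_one_sub_div (hp y) hy).2

theorem tailInv_inv {Ω₀ : Type*} [MeasurableSpace Ω₀] {P₀ : Measure Ω₀} {X : Ω₀ → ℝ} (x : ℝ) :
    (tailInv P₀ X x)⁻¹ = P₀.real {ω | x < X ω} := by
  rw [tailInv, one_div, inv_inv]

/-- The tail `-log (1 - P(X > y))`, of which the tails of the measures `μ_N` are rescalings. -/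
noncomputable def logTail {Ω₀ : Type*} [MeasurableSpace Ω₀] (P₀ : Measure Ω₀) (X : Ω₀ → ℝ)
    (y : ℝ) : ℝ :=
  -Real.log (1 - (tailInv P₀ X y)⁻¹)

theorem logTail_eq {Ω₀ : Type*} [MeasurableSpace Ω₀] {P₀ : Measure Ω₀} {X : Ω₀ → ℝ} (y : ℝ) :
    logTail P₀ X y = -Real.log (1 - P₀.real {ω | y < X ω}) := by
  rw [logTail, tailInv_inv]

section Tail

variable {Ω₀ : Type*} [MeasurableSpace Ω₀] {P₀ : Measure Ω₀} [IsProbabilityMeasure P₀]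
  {X : Ω₀ → ℝ} {α : ℝ}

theorem real_lt_antitone {x y : ℝ} (hxy : x ≤ y) :
    P₀.real {ω | y < X ω} ≤ P₀.real {ω | x < X ω} :=
  measureReal_mono (fun _ hω => lt_of_le_of_lt hxy hω) (measure_ne_top _ _)

theorem IsRegularlyVarying.real_lt_pos (h : IsRegularlyVarying (tailInv P₀ X) α) (x : ℝ) :
    0 < P₀.real {ω | x < X ω} := by
  obtain ⟨y, hy, hxy⟩ := (h.2.1.and (eventually_ge_atTop x)).exists
  rw [← inv_pos, tailInv_inv] at hy
  exact hy.trans_le (real_lt_antitone hxy)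

theorem IsRegularlyVarying.tailInv_mono (h : IsRegularlyVarying (tailInv P₀ X) α) {x y : ℝ}
    (hxy : x ≤ y) : tailInv P₀ X x ≤ tailInv P₀ X y :=
  one_div_le_one_div_of_le (h.real_lt_pos y) (real_lt_antitone hxy)

theorem tendsto_real_lt_atTop (hX : AEMeasurable X P₀) :
    Tendsto (fun x : ℝ => P₀.real {ω | x < X ω}) atTop (𝓝 0) := by
  have hlim := tendsto_measure_iInter_atTop (μ := P₀) (s := fun n : ℕ => {ω | (n : ℝ) < X ω})
    (fun n => nullMeasurableSet_lt aemeasurable_const hX)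
    (fun n m hnm ω hω => lt_of_le_of_lt (b := (m : ℝ)) (by exact_mod_cast hnm) hω)
    ⟨0, measure_ne_top _ _⟩
  have hempty : ⋂ n : ℕ, {ω | (n : ℝ) < X ω} = ∅ := by
    refine eq_empty_of_forall_notMem fun ω hω => ?_
    obtain ⟨n, hn⟩ := exists_nat_ge (X ω)
    have h1 : (n : ℝ) < X ω := mem_iInter.1 hω n
    linarith
  rw [hempty, measure_empty] at hlim
  have hlim' := (ENNReal.tendsto_toReal ENNReal.zero_ne_top).comp hlim
  rw [ENNReal.toReal_zero] at hlim'
  refine tendsto_order.2 ⟨fun c hc => Eventually.of_forall fun x =>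
    hc.trans_le measureReal_nonneg, fun c hc => ?_⟩
  obtain ⟨n, hn⟩ := (hlim'.eventually_lt_const hc).exists
  filter_upwards [eventually_ge_atTop (n : ℝ)] with x hx
  exact (real_lt_antitone hx).trans_lt hn

theorem tendsto_tailInv_atTop (hX : AEMeasurable X P₀)
    (h : IsRegularlyVarying (tailInv P₀ X) α) : Tendsto (tailInv P₀ X) atTop atTop := by
  have h1 : Tendsto (fun x : ℝ => P₀.real {ω | x < X ω}) atTop (𝓝[>] 0) :=
    tendsto_nhdsWithin_iff.2 ⟨tendsto_real_lt_atTop hX, Eventually.of_forall h.real_lt_pos⟩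
  refine (tendsto_inv_nhdsGT_zero.comp h1).congr fun x => ?_
  simp [tailInv]

theorem tendsto_logTail_div (hX : AEMeasurable X P₀)
    (h : IsRegularlyVarying (tailInv P₀ X) α) :
    Tendsto (fun y => logTail P₀ X y / P₀.real {ω | y < X ω}) atTop (𝓝 1) := by
  simp_rw [logTail_eq]
  exact tendsto_neg_log_one_sub_div h.real_lt_pos (tendsto_real_lt_atTop hX)

theorem isRegularTail_logTail (hX : AEMeasurable X P₀)
    (h : IsRegularlyVarying (tailInv P₀ X) α) (hlt : ∀ y, 0 < y → P₀.real {ω | y < X ω} < 1) :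
    IsRegularTail (logTail P₀ X) α where
  pos y hy := by
    rw [logTail_eq]
    have := Real.log_neg (x := 1 - P₀.real {ω | y < X ω}) (by linarith [hlt y hy])
      (by linarith [h.real_lt_pos y])
    linarith
  anti x y hx hxy := by
    rw [logTail_eq, logTail_eq]
    refine neg_le_neg (Real.log_le_log (by linarith [hlt x hx]) ?_)
    linarith [real_lt_antitone (P₀ := P₀) (X := X) hxy]
  tendsto l hl := by
    have h1 := tendsto_logTail_div hX h
    have h2 : Tendsto (fun y : ℝ => l * y) atTop atTop := tendsto_id.const_mul_atTop hl
    have h3 := (h.2.2 l hl).inv₀ (Real.rpow_pos_of_pos hl α).ne'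
    have h4 := ((h1.comp h2).mul h3).mul (h1.inv₀ one_ne_zero)
    rw [← Real.rpow_neg hl.le, one_mul, inv_one, mul_one] at h4
    refine h4.congr fun y => ?_
    have p1 := h.real_lt_pos (l * y)
    have p2 := h.real_lt_pos y
    simp only [Function.comp_apply, tailInv]
    field_simp

theorem IsStairsMeasure.exists_Ioi_ne_zero {μ : Measure ℝ} (hμ : IsStairsMeasure μ) :
    ∃ x₀ : ℝ, 0 < x₀ ∧ ∀ x ≤ x₀, μ (Ioi x) ≠ 0 := by
  by_contra! hcon
  refine hμ.ne_zero ?_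
  have h0 : ∀ n : ℕ, μ (Ioi (1 / ((n : ℝ) + 1))) = 0 := fun n => by
    obtain ⟨x, hx, hx0⟩ := hcon (1 / ((n : ℝ) + 1)) (by positivity)
    exact measure_mono_null (Ioi_subset_Ioi hx) hx0
  have hcover : (univ : Set ℝ) ⊆ Iic 0 ∪ ⋃ n : ℕ, Ioi (1 / ((n : ℝ) + 1)) := by
    intro x _
    rcases le_or_gt x 0 with hx | hx
    · exact Or.inl hx
    · obtain ⟨n, hn⟩ := exists_nat_one_div_lt hx
      exact Or.inr (mem_iUnion.2 ⟨n, hn⟩)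
  rw [← Measure.measure_univ_eq_zero]
  exact measure_mono_null hcover (measure_union_null hμ.carrier (measure_iUnion_null h0))

theorem IsStairsMeasure.exists_Ioi_lt {μ : Measure ℝ} (hμ : IsStairsMeasure μ) {a : ℝ≥0∞}
    (ha : 0 < a) : ∃ x : ℝ, 0 < x ∧ μ (Ioi x) < a := by
  have hlim := tendsto_measure_iInter_atTop (μ := μ) (s := fun n : ℕ => Ioi ((n : ℝ) + 1))
    (fun n => measurableSet_Ioi.nullMeasurableSet)
    (fun n m hnm => Ioi_subset_Ioi (by gcongr))
    ⟨0, hμ.measure_Ioi_ne_top (by positivity)⟩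
  have hempty : ⋂ n : ℕ, Ioi ((n : ℝ) + 1) = ∅ := by
    refine eq_empty_of_forall_notMem fun x hx => ?_
    obtain ⟨n, hn⟩ := exists_nat_ge x
    have h1 : (n : ℝ) + 1 < x := mem_iInter.1 hx n
    linarith
  rw [hempty, measure_empty] at hlim
  obtain ⟨n, hn⟩ := (hlim.eventually_lt_const ha).exists
  exact ⟨_, by positivity, hn⟩

/-- If `x ↦ -γ log (1 - 1 / h(c x))` is the tail of a stairs measure, then the parameters are
positive and the logarithm is not evaluated at `0`. -/
theorem IsStairsMeasure.params_pos {μ : Measure ℝ} (hμ : IsStairsMeasure μ)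
    {γ c : ℝ} (hc : 0 ≤ c)
    (hT : ∀ x : ℝ, 0 < x → μ (Ioi x) = ENNReal.ofReal
      (-γ * Real.log (1 - (tailInv P₀ X (c * x))⁻¹))) :
    0 < γ ∧ 0 < c ∧ ∀ y, 0 < y → P₀.real {ω | y < X ω} < 1 := by
  simp_rw [tailInv_inv] at hT
  obtain ⟨x₀, hx₀, hne⟩ := hμ.exists_Ioi_ne_zero
  have hγ : 0 < γ := by
    by_contra hγ
    refine hne x₀ le_rfl ?_
    rw [hT x₀ hx₀, ENNReal.ofReal_eq_zero]
    refine mul_nonpos_of_nonneg_of_nonpos (by linarith) (Real.log_nonpos ?_ ?_)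
    · linarith [measureReal_le_one (μ := P₀) (s := {ω | c * x₀ < X ω})]
    · linarith [measureReal_nonneg (μ := P₀) (s := {ω | c * x₀ < X ω})]
  have hc0 : 0 < c := by
    refine lt_of_le_of_ne hc fun hc' => ?_
    obtain ⟨x, hx, hlt⟩ := hμ.exists_Ioi_lt (pos_iff_ne_zero.2 (hne x₀ le_rfl))
    rw [hT x hx, hT x₀ hx₀, ← hc', zero_mul, zero_mul] at hlt
    exact lt_irrefl _ hlt
  refine ⟨hγ, hc0, fun y hy => ?_⟩
  by_contra hy1
  -- otherwise the logarithm takes its default value `log 0 = 0` at some small argument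
  have hx1 : 0 < min x₀ (y / c) := lt_min hx₀ (by positivity)
  refine hne (min x₀ (y / c)) (min_le_left _ _) ?_
  have hle : c * min x₀ (y / c) ≤ y := by
    calc c * min x₀ (y / c) ≤ c * (y / c) := by gcongr; exact min_le_right _ _
      _ = y := mul_div_cancel₀ _ hc0.ne'
  have h1 : P₀.real {ω | c * min x₀ (y / c) < X ω} = 1 :=
    le_antisymm measureReal_le_one ((not_lt.1 hy1).trans (real_lt_antitone hle))
  rw [hT _ hx1, h1]
  simp

end Tail

/-! ### Normalisation of the scales `c_N` -/

theorem exists_pos_forall_le_of_eventually {f : ℕ → ℝ} {a : ℝ} (ha : 0 < a)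
    (hf : ∀ᶠ n in atTop, a ≤ f n) : ∃ b : ℝ, 0 < b ∧ ∀ n, 0 < f n → b ≤ f n := by
  obtain ⟨N, hN⟩ := eventually_atTop.1 hf
  have key : ∀ M : ℕ, ∃ b : ℝ, 0 < b ∧ ∀ n < M, 0 < f n → b ≤ f n := by
    intro M
    induction M with
    | zero => exact ⟨1, one_pos, fun n hn => absurd hn (Nat.not_lt_zero n)⟩
    | succ M ih =>
      obtain ⟨b, hb, H⟩ := ih
      by_cases hM : 0 < f M
      · refine ⟨min b (f M), lt_min hb hM, fun n hn hfn => ?_⟩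
        rcases Nat.lt_succ_iff_lt_or_eq.1 hn with h | rfl
        · exact (min_le_left _ _).trans (H n h hfn)
        · exact min_le_right _ _
      · refine ⟨b, hb, fun n hn hfn => ?_⟩
        rcases Nat.lt_succ_iff_lt_or_eq.1 hn with h | rfl
        · exact H n h hfn
        · exact absurd hfn hM
  obtain ⟨b, hb, H⟩ := key N
  refine ⟨min a b, lt_min ha hb, fun n hfn => ?_⟩
  rcases lt_or_ge n N with h | h
  · exact (min_le_right _ _).trans (H n h hfn)
  · exact (min_le_left _ _).trans (hN n h)

theorem exists_forall_le_of_eventually {f : ℕ → ℝ} {a : ℝ} (hf : ∀ᶠ n in atTop, f n ≤ a) :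
    ∃ b : ℝ, 0 < b ∧ ∀ n, f n ≤ b := by
  obtain ⟨N, hN⟩ := eventually_atTop.1 hf
  obtain ⟨B, hB⟩ := ((finite_lt_nat N).image f).bddAbove
  refine ⟨max (max a B) 1, by positivity, fun n => ?_⟩
  rcases lt_or_ge n N with h | h
  · exact (hB ⟨n, h, rfl⟩).trans ((le_max_right _ _).trans (le_max_left _ _))
  · exact (hN n h).trans ((le_max_left _ _).trans (le_max_left _ _))

theorem tendsto_mul_logb_atTop :
    Tendsto (fun N : ℕ => 2 * (N : ℝ) * Real.logb 2 (N : ℝ)) atTop atTop := by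
  have h1 : Tendsto (fun N : ℕ => (N : ℝ)) atTop atTop := tendsto_natCast_atTop_atTop
  exact (h1.const_mul_atTop two_pos).atTop_mul_atTop₀
    ((Real.tendsto_logb_atTop one_lt_two).comp h1)

section Scale

variable {Ω₀ : Type*} [MeasurableSpace Ω₀] {P₀ : Measure Ω₀} [IsProbabilityMeasure P₀]
  {X : Ω₀ → ℝ} {α : ℝ}

theorem generalizedInverse_nonneg (h : ℝ → ℝ) (v : ℝ) : 0 ≤ generalizedInverse h v :=
  Real.sInf_nonneg fun _ hx => hx.1

theorem lt_of_generalizedInverse_lt {h : ℝ → ℝ} (hmono : Monotone h)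
    (htop : Tendsto h atTop atTop) {v x : ℝ} (hx : generalizedInverse h v < x) : v < h x := by
  obtain ⟨y, hy, hy0⟩ := ((htop.eventually_gt_atTop v).and (eventually_ge_atTop 0)).exists
  have hne : {x : ℝ | 0 ≤ x ∧ v < h x}.Nonempty := ⟨y, hy0, hy⟩
  obtain ⟨z, hz, hzx⟩ := exists_lt_of_csInf_lt hne hx
  exact hz.2.trans_le (hmono hzx.le)

theorem le_of_lt_generalizedInverse {h : ℝ → ℝ} {v x : ℝ} (hx0 : 0 ≤ x)
    (hx : x < generalizedInverse h v) : h x ≤ v := by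
  by_contra hcon
  have hbdd : BddBelow {x : ℝ | 0 ≤ x ∧ v < h x} := ⟨0, fun _ hy => hy.1⟩
  have hmem : x ∈ {x : ℝ | 0 ≤ x ∧ v < h x} := ⟨hx0, not_le.1 hcon⟩
  exact absurd (csInf_le hbdd hmem) (not_le.2 hx)

theorem tendsto_generalizedInverse {h : ℝ → ℝ} (hmono : Monotone h)
    (htop : Tendsto h atTop atTop) : Tendsto (generalizedInverse h) atTop atTop := by
  refine tendsto_atTop.2 fun M => ?_
  filter_upwards [eventually_ge_atTop (h M)] with v hv
  by_contra hcon
  exact absurd (lt_of_generalizedInverse_lt hmono htop (not_le.1 hcon)) (not_lt.2 hv)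

/-- The mass `γ_N g(c_N)` which the measure with parameters `γ_N`, `c_N` gives to `(1, ∞)` stays
bounded and bounded away from `0`, because `h(c_N)` is of the order of `2 N log₂ N`. -/
theorem eventually_normalisation (hX : AEMeasurable X P₀)
    (h : IsRegularlyVarying (tailInv P₀ X) α) {γ : ℕ → ℝ}
    (hγ : Tendsto (fun N : ℕ => γ N / (2 * (N : ℝ) * Real.logb 2 (N : ℝ))) atTop (𝓝 1)) :
    ∀ᶠ N : ℕ in atTop, 1 ≤ spaceScale (tailInv P₀ X) N ∧
      (1 / 2) ^ (α + 3) ≤ γ N * logTail P₀ X (spaceScale (tailInv P₀ X) N) ∧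
      γ N * logTail P₀ X (spaceScale (tailInv P₀ X) N) ≤ 2 ^ (α + 3) := by
  have hmono : Monotone (tailInv P₀ X) := fun x y hxy => h.tailInv_mono hxy
  have htop := tendsto_tailInv_atTop hX h
  have hv := tendsto_mul_logb_atTop
  have hc : Tendsto (fun N => spaceScale (tailInv P₀ X) N) atTop atTop :=
    (tendsto_generalizedInverse hmono htop).comp hv
  have hα2 : (0 : ℝ) < 2 ^ α := by positivity
  have hα2' : (0 : ℝ) < (1 / 2) ^ α := by positivity
  have l1 := (h.2.2 2 two_pos).comp hc
  have l2 := (h.2.2 (1 / 2) (by norm_num)).comp hc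
  have l3 := (tendsto_logTail_div hX h).comp hc
  filter_upwards [hc.eventually_ge_atTop 1, hv.eventually_gt_atTop 0,
    l1.eventually_lt_const (show (2 : ℝ) ^ α < 2 * 2 ^ α by linarith),
    l2.eventually_const_lt (show (1 / 2) * (1 / 2 : ℝ) ^ α < (1 / 2) ^ α by linarith),
    l3.eventually_lt_const (show (1 : ℝ) < 2 by norm_num),
    l3.eventually_const_lt (show (1 / 2 : ℝ) < 1 by norm_num),
    hγ.eventually_lt_const (show (1 : ℝ) < 2 by norm_num),
    hγ.eventually_const_lt (show (1 / 2 : ℝ) < 1 by norm_num)] with N hN1 hN2 h1 h2 h3 h4 h5 h6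
  simp only [Function.comp_apply] at h1 h2 h3 h4
  refine ⟨hN1, ?_⟩
  have hu1 := lt_of_generalizedInverse_lt hmono htop
    (v := 2 * (N : ℝ) * Real.logb 2 (N : ℝ)) (x := 2 * spaceScale (tailInv P₀ X) N) (by
      change spaceScale (tailInv P₀ X) N < _
      linarith)
  have hu2 := le_of_lt_generalizedInverse (h := tailInv P₀ X)
    (v := 2 * (N : ℝ) * Real.logb 2 (N : ℝ)) (x := 1 / 2 * spaceScale (tailInv P₀ X) N)
    (by linarith) (by
      change _ < spaceScale (tailInv P₀ X) N
      linarith)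
  set c := spaceScale (tailInv P₀ X) N
  set v := 2 * (N : ℝ) * Real.logb 2 (N : ℝ)
  have hp := h.real_lt_pos c
  have hh : tailInv P₀ X c = (P₀.real {ω | c < X ω})⁻¹ := by rw [tailInv, one_div]
  have hh0 : 0 < tailInv P₀ X c := by rw [hh]; positivity
  set p := P₀.real {ω | c < X ω}
  have hup : v * p ≤ 2 * 2 ^ α := by
    rw [hh, div_inv_eq_mul] at h1
    exact (mul_le_mul_of_nonneg_right hu1.le hp.le).trans h1.le
  have hlo : 1 / 2 * (1 / 2) ^ α ≤ v * p := by
    rw [hh, div_inv_eq_mul] at h2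
    exact h2.le.trans (mul_le_mul_of_nonneg_right hu2 hp.le)
  have e : γ N * logTail P₀ X c = (γ N / v) * (v * p) * (logTail P₀ X c / p) := by
    field_simp
  have e1 : (1 / 2 : ℝ) ^ (α + 3) = (1 / 2) * (1 / 2 * (1 / 2) ^ α) * (1 / 2) := by
    rw [Real.rpow_add (by norm_num)]; norm_num; ring
  have e2 : (2 : ℝ) ^ (α + 3) = 2 * (2 * 2 ^ α) * 2 := by
    rw [Real.rpow_add (by norm_num)]; norm_num; ring
  rw [e]
  constructor
  · rw [e1]
    have hvp : 0 ≤ v * p := by positivity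
    gcongr
  · rw [e2]
    gcongr

end Scale

theorem mainTheorem5
    {Ω₀ : Type*} [MeasurableSpace Ω₀] (P₀ : Measure Ω₀) [IsProbabilityMeasure P₀]
    (X : Ω₀ → ℝ) (hX : AEMeasurable X P₀) (hX_nonneg : ∀ᵐ ω ∂P₀, 0 ≤ X ω)
    (α : ℝ) (hα : 0 < α) (h_rv : IsRegularlyVarying (tailInv P₀ X) α)
    (γ : ℕ → ℝ)
    (hγ : Tendsto (fun N : ℕ => γ N / (2 * (N : ℝ) * Real.logb 2 (N : ℝ))) atTop (𝓝 1))
    (ε : ℝ) (hε : 0 < ε) :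
    ∃ x₀ : ℝ, 0 < x₀ ∧
      ∀ N : ℕ, 1 ≤ N →
      ∀ μ : Measure ℝ, IsStairsMeasure μ →
      (∀ x : ℝ, 0 < x → μ (Ioi x) = ENNReal.ofReal
        (-γ N * Real.log (1 - (tailInv P₀ X (spaceScale (tailInv P₀ X) N * x))⁻¹))) →
      ∀ (Ω : Type*) [MeasurableSpace Ω] (P : Measure Ω) [IsProbabilityMeasure P]
        (pts : Ω → Set (ℝ × ℝ)), IsPoissonPointProcess P pts (stairsIntensity μ) →
        (∀ᵐ ω ∂P, (regenSet (stairsPath pts ω) 0).Nonempty) ∧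
        Integrable (firstRegen pts) P ∧
        AEMeasurable (fun ω => stairsPath pts ω (firstRegen pts ω)) P ∧
        (⨆ x ∈ Ici x₀, ENNReal.ofReal
          |P.real {ω | x < stairsPath pts ω (firstRegen pts ω)} /
              ((∫ ω, firstRegen pts ω ∂P) * μ.real (Ici x)) - 1|) < ENNReal.ofReal ε := by
  have hscale : ∀ N, 0 ≤ spaceScale (tailInv P₀ X) N := fun N => generalizedInverse_nonneg _ _
  -- if `P(X > y) = 1` for some `y > 0`, the formula for `μ_N` never defines a stairs measure
  by_cases hlt : ∀ y, 0 < y → P₀.real {ω | y < X ω} < 1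
  swap
  · exact ⟨1, one_pos, fun N _ μ hμ hT => absurd (hμ.params_pos (hscale N) hT).2.2 hlt⟩
  have hg := isRegularTail_logTail hX h_rv hlt
  have hnorm := eventually_normalisation hX h_rv hγ
  -- bounds for all large `N` extend to all `N`, because those which are left are finitely many
  obtain ⟨c₀, hc₀, Hc⟩ := exists_pos_forall_le_of_eventually one_pos (hnorm.mono fun _ h => h.1)
  obtain ⟨κ₁, hκ₁, Hκ₁⟩ := exists_pos_forall_le_of_eventually
    (show (0 : ℝ) < (1 / 2) ^ (α + 3) by positivity) (hnorm.mono fun _ h => h.2.1)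
  obtain ⟨κ₂, hκ₂, Hκ₂⟩ := exists_forall_le_of_eventually (hnorm.mono fun _ h => h.2.2)
  obtain ⟨x₀, hx₀, H⟩ := hg.exists_threshold hα hc₀ hκ₁ hκ₂ (half_pos hε)
  refine ⟨x₀, hx₀, fun N _ μ hμ hT Ω _ P _ pts hP => ?_⟩
  obtain ⟨hγN, hcN, _⟩ := hμ.params_pos (hscale N) hT
  have hTg : ∀ x, 0 < x → μ.real (Ioi x) =
      γ N * logTail P₀ X (spaceScale (tailInv P₀ X) N * x) := fun x hx => by
    have h1 := hg.pos (spaceScale (tailInv P₀ X) N * x) (by positivity)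
    have h2 : -γ N * Real.log (1 - (tailInv P₀ X (spaceScale (tailInv P₀ X) N * x))⁻¹) =
        γ N * logTail P₀ X (spaceScale (tailInv P₀ X) N * x) := by
      rw [logTail]; ring
    rw [measureReal_def, hT x hx, h2, ENNReal.toReal_ofReal (by positivity)]
  have hmass : 0 < γ N * logTail P₀ X (spaceScale (tailInv P₀ X) N) :=
    mul_pos hγN (hg.pos _ hcN)
  obtain ⟨hd, H'⟩ := H (γ N) (spaceScale (tailInv P₀ X) N) hγN (Hc N hcN) (Hκ₁ N hmass) (Hκ₂ N)
    μ hμ hTg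
  refine ⟨hP.ae_regenSet_nonempty hμ hd, hP.integrable_firstRegen hμ hd,
    hP.aemeasurable_stairsPath_firstRegen hμ hd, ?_⟩
  refine lt_of_le_of_lt (iSup₂_le fun x hx => ENNReal.ofReal_le_ofReal (H' Ω P pts hP x hx)) ?_
  exact (ENNReal.ofReal_lt_ofReal_iff hε).2 (half_lt_self hε)
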